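/- **Setting.** For each $n$, let $W_i=(Y_i,X_i,Z_i)$, $i\in[n]$, be i.i.d. with $Y_i,X_i\in\mathbb R$, $Z_i\in\mathbb R^{d_n}$. The law of $X_i$ is fixed; the conditional law of $(Y_i,Z_i)$ given $X_i=x$ (of which a version, a Markov kernel in $x$, is fixed) and $d_n$ may depend on $n$. The cutoff is $0$, and $\tau=\tau_n=\mathbb E[Y_i|X_i=0^+]-\mathbb E[Y_i|X_i=0^-]$ (one-sided limits). $\mathcal X$ is the support of $X_i$ and $\mathcal X_h=\mathcal X\cap[-h,h]$. Fix integers $S,R\ge1$. The units are randomly split, independently of the data, into $S$ folds $I_1,\dots,I_S$ of equal size (up to one unit); $s(i)$ is the fold of $i$. The first-stage estimate $\widehat\eta_s$ is a function $\mathbb R^{d_n}\to\mathbb R$ computed from the data outside fold $s$, jointly measurable in the data and its argument. Write $M_i(\eta)=Y_i-\eta(Z_i)$. **Estimator and interval.** With a kernel $K$, a deterministic bandwidth $h=h_n>0$, $K_h^+(x)=h^{-1}K(x/h)1\{x\ge0\}$, $K_h^-(x)=h^{-1}K(x/h)1\{x<0\}$, $\widetilde X_i=(1,X_i)^\top$ and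 $e_0=(1,0)^\top,e_1=(0,1)^\top$, put for $v\in\{0,1\}$ $$w_{i,v}=w^+_{i,v}-w^-_{i,v},\qquad w^\star_{i,v}=e_v^\top\Big(\sum_{j=1}^nK_h^\star(X_j)\widetilde X_j\widetilde X_j^\top\Big)^{-1}K_h^\star(X_i)\widetilde X_i .$$ Let $\widehat\tau(h;\widehat\eta)=\sum_i w_{i,0}M_i(\widehat\eta_{s(i)})$ and $$\widehat{\mathrm{se}}^2(h;\widehat\eta)=\sum_i w_{i,0}^2\Big(M_i(\widehat\eta_{s(i)})-\tfrac1R\sum_{j\in\mathcal R_i}M_j(\widehat\eta_{s(j)})\Big)^2,$$ where $\mathcal R_i$ is the set of the $R$ nearest neighbours of unit $i$ (other than $i$) in terms of $X$ on the same side of the cutoff. For $\alpha\in(0,1)$ let $z_\alpha$ be the $1-\alpha/2$ quantile of $N(0,1)$, and $$CI^{us}_{1-\alpha}=[\widehat\tau(h;\widehat\eta)-z_\alpha\widehat{\mathrm{se}}(h;\widehat\eta),\ \widehat\tau(h;\widehat\eta)+z_\alpha\widehat{\mathrm{se}}(h;\widehat\eta)].$$ **Assumptions.** Let $\mathcal E=\mathcal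 E_n$ be the class of measurable $\eta:\mathbb R^{d_n}\to\mathbb R$ for which $\mathbb E[\eta(Z_i)|X_i=x]$ exists and is twice continuously differentiable in a neighbourhood of $0$. 1. For each $n$ there are $\mathcal T_n\subset\mathcal E$ and $\bar\eta=\bar\eta_n\in\mathcal T_n$ such that, for every $s$, $\widehat\eta_s\in\mathcal T_n$ with probability approaching one, and for some deterministic $r_n=o(1)$, $\sup_{\eta\in\mathcal T_n}\sup_{x\in\mathcal X_h}\mathbb E[(\eta(Z_i)-\bar\eta(Z_i))^2|X_i=x]=O(r_n^2)$. There are open sets $\widetilde{\mathcal X}_h\supset\mathcal X_h$ such that this rate condition also holds (for some such $r_n$) with $\mathcal X_h$ replaced by $\widetilde{\mathcal X}_h\cap\mathcal X$, and a constant $B$ with $\mathbb E[(M_i(\eta)-\mathbb E[M_i(\eta)|X_i])^4|X_i=x]\le B$ for all $n$, $\eta\in\mathcal T_n$, $x\in\widetilde{\mathcal X}_h\cap\mathcal X$. 2. For $j\in\{1,2\}$ and some deterministic $v_{j,n}=o(1)$: for all large $n$ and all $\eta\in\mathcal T_n$, the function $x\mapsto\mathbb E[\eta(Z_i)-\bar\eta(Z_i)|X_i=x]$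 is twice differentiable at each $x\in\mathcal X_h\setminus\{0\}$, and $\sup_{\eta\in\mathcal T_n}\sup_{x\in\mathcal X_h\setminus\{0\}}|\partial_x^j\mathbb E[\eta(Z_i)-\bar\eta(Z_i)|X_i=x]|=O(v_{j,n})$. 3. $X_i$ has a density that is continuous and bounded away from zero on an open neighbourhood of $0$; $K$ is a bounded symmetric probability density, continuous on its support and zero outside $[-1,1]$; $h\to0$ and $nh\to\infty$. 4. There are constants $C>0$, $L$ and $q>2$ such that for all $n$: $\mathbb E[M_i(\bar\eta)|X_i=x]$ is twice continuously differentiable on $\mathcal X\setminus\{0\}$, with second derivative bounded by $C$ and $L$-Lipschitz on each side of the cutoff; $\mathbb E[|M_i(\bar\eta)-\mathbb E[M_i(\bar\eta)|X_i]|^q|X_i=x]\le C$ for $x\in\mathcal X$; $\mathbb V[M_i(\bar\eta)|X_i=x]\ge1/C$ for $x\in\mathcal X\setminus\{0\}$; and $\mathbb E[M_i(\bar\eta)|X_i=x]$ and $\mathbb V[M_i(\bar\eta)|X_i=x]$ are $L$-Lipschitz on each side of the cutoff. 5. For $v\in\{0,1\}$, $\sum_i w_{i,v}^2\,\iota_i=o_P((nh^{1+2v})^{-1})$,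 where $$\iota_i=\sum_{(j,l)\in\mathcal R_i^2,\ (j,l)\notin I_{s(i)}^2}\big\{(\widehat\eta_{s(i)}(Z_i)-\bar\eta(Z_i))-(\widehat\eta_{s(j)}(Z_j)-\bar\eta(Z_j))\big\}\,\big(M_i(\bar\eta)-M_l(\bar\eta)\big).$$ **Proposition.** Under these assumptions, if $nh^5=o(1)$, then for every $\alpha\in(0,1)$ $$\mathbb P\big(\tau\in CI^{us}_{1-\alpha}\big)\ \ge\ 1-\alpha+o(1)\qquad(n\to\infty).$$ -/

import Mathlib

open MeasureTheory ProbabilityTheory Filter Topology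

noncomputable section

/-- One observation `W = (X, (Y, Z))`: running variable, outcome, covariates in `ℝ ^ k`. -/
abbrev RDObs (k : ℕ) : Type := ℝ × (ℝ × (Fin k → ℝ))

/-- The data-generating process and the choices of the researcher in a sharp regression
discontinuity design with cutoff `0`, along a sequence of sample sizes `n`.

The law of the running variable is fixed; the conditional law of `(Y, Z)` given `X = x`, and the
number of covariates, may change with `n`.  The conditional laws are given as a Markov kernel, so
that `E[f(Y,Z) | X = x]` is a function of the point `x`. -/
structure RDSetup where
  /-- number of cross-fitting folds -/
  S : ℕ
  S_pos : 0 < S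
  /-- number of nearest neighbours used in the standard error -/
  R : ℕ
  R_pos : 0 < R
  /-- number of covariates -/
  d : ℕ → ℕ
  /-- law of the running variable -/
  lawX : Measure ℝ
  [prob_lawX : IsProbabilityMeasure lawX]
  /-- conditional law of `(Y, Z)` given `X = x` -/
  cond : ∀ n, Kernel ℝ (ℝ × (Fin (d n) → ℝ))
  [markov_cond : ∀ n, IsMarkovKernel (cond n)]
  /-- law of the random assignment of the `n` units to folds (drawn independently of the data) -/
  foldLaw : ∀ n, Measure (Fin n → Fin S)
  [prob_foldLaw : ∀ n, IsProbabilityMeasure (foldLaw n)]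
  /-- the folds have equal size (up to one unit if `S` does not divide `n`) -/
  balanced : ∀ n, ∀ᵐ f ∂(foldLaw n), ∀ s : Fin S,
    (Finset.univ.filter fun i => f i = s).card = n / S ∨
      (Finset.univ.filter fun i => f i = s).card = n / S + 1
  /-- the first-stage estimator: `etaHat n J w` is the adjustment function estimated from the
  observations `w` of the units in `J` -/
  etaHat : ∀ n (J : Finset (Fin n)), (J → RDObs (d n)) → (Fin (d n) → ℝ) → ℝ
  measurable_etaHat : ∀ n (J : Finset (Fin n)), Measurable (Function.uncurry (etaHat n J))
  /-- kernel function -/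
  K : ℝ → ℝ
  /-- bandwidth sequence -/
  h : ℕ → ℝ

attribute [instance] RDSetup.prob_lawX RDSetup.markov_cond RDSetup.prob_foldLaw

namespace RDSetup

variable (D : RDSetup)

/-- Space of covariate values. -/
abbrev Cov (n : ℕ) : Type := Fin (D.d n) → ℝ

/-- Sample space at sample size `n`: fold assignment and data. -/
abbrev Sample (n : ℕ) : Type := (Fin n → Fin D.S) × (Fin n → RDObs (D.d n))

/-- Law of one observation `(X, (Y, Z))`. -/
def lawW (n : ℕ) : Measure (RDObs (D.d n)) := D.lawX.compProd (D.cond n)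

/-- The data are i.i.d. and independent of the fold assignment. -/
def P (n : ℕ) : Measure (D.Sample n) :=
  (D.foldLaw n).prod (Measure.pi fun _ : Fin n => D.lawW n)

/-- `ξ_n = o_P(1)`. -/
def IsLittleOP (ξ : ∀ n, D.Sample n → ℝ) : Prop :=
  ∀ ε : ℝ, 0 < ε → Tendsto (fun n => D.P n {ω | ε ≤ |ξ n ω|}) atTop (𝓝 0)

/-! ### The data and the covariate-adjusted outcomes -/

variable {D} in
/-- Fold `s(i)` of unit `i`. -/
def fold {n : ℕ} (ω : D.Sample n) (i : Fin n) : Fin D.S := ω.1 i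

variable {D} in
/-- Running variable `X_i`. -/
def X {n : ℕ} (ω : D.Sample n) (i : Fin n) : ℝ := (ω.2 i).1

variable {D} in
/-- Covariates `Z_i`. -/
def Z {n : ℕ} (ω : D.Sample n) (i : Fin n) : D.Cov n := (ω.2 i).2.2

/-- The adjusted outcome `M(η) = Y - η(Z)` as a function of `(Y, Z)`. -/
def adj {n : ℕ} (η : D.Cov n → ℝ) (u : ℝ × D.Cov n) : ℝ := u.1 - η u.2

variable {D} in
/-- The adjusted outcome `M_i(η)` of unit `i`. -/
def M {n : ℕ} (η : D.Cov n → ℝ) (ω : D.Sample n) (i : Fin n) : ℝ := D.adj η (ω.2 i).2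

variable {D} in
/-- `η̂_s`: the first-stage estimate computed from the data outside fold `s`. -/
def etaHatCF {n : ℕ} (ω : D.Sample n) (s : Fin D.S) : D.Cov n → ℝ :=
  D.etaHat n (Finset.univ.filter fun i => fold ω i ≠ s) (fun j => ω.2 j)

variable {D} in
/-- `M_i(η̂_{s(i)})`. -/
def MHat {n : ℕ} (ω : D.Sample n) (i : Fin n) : ℝ := M (etaHatCF ω (fold ω i)) ω i

/-! ### Local polynomial weights, estimator and standard error -/

open Classical in
/-- `K_h^+(x) = K(x/h)/h 1{x ≥ 0}`. -/
def KPlus (n : ℕ) (x : ℝ) : ℝ := if 0 ≤ x then D.K (x / D.h n) / D.h n else 0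

open Classical in
/-- `K_h^-(x) = K(x/h)/h 1{x < 0}`. -/
def KMinus (n : ℕ) (x : ℝ) : ℝ := if x < 0 then D.K (x / D.h n) / D.h n else 0

/-- `(1, x, …, x^p)`. -/
def polyVec (p : ℕ) (x : ℝ) : Fin (p + 1) → ℝ := fun k => x ^ (k : ℕ)

/-- `e_v' (∑_j k(X_j) X̃_{p,j} X̃_{p,j}')⁻¹ k(X_i) X̃_{p,i}` for a weight function `k`. -/
def sideWeight (p : ℕ) (v : Fin (p + 1)) (k : ℝ → ℝ) {n : ℕ} (x : Fin n → ℝ) (i : Fin n) : ℝ :=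
  ((∑ j, k (x j) • Matrix.vecMulVec (polyVec p (x j)) (polyVec p (x j)))⁻¹.mulVec
    (k (x i) • polyVec p (x i))) v

variable {D} in
/-- The weight `w_{i,v,p}(h) = w⁺_{i,v,p}(h) - w⁻_{i,v,p}(h)`. -/
def weight (p : ℕ) (v : Fin (p + 1)) {n : ℕ} (ω : D.Sample n) (i : Fin n) : ℝ :=
  sideWeight p v (D.KPlus n) (X ω) i - sideWeight p v (D.KMinus n) (X ω) i

variable {D} in
/-- `τ̂_{v,p}(h; η̂)`. -/
def tauHat (p : ℕ) (v : Fin (p + 1)) {n : ℕ} (ω : D.Sample n) : ℝ :=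
  ∑ i, weight p v ω i * MHat ω i

open Classical in
variable {D} in
/-- `ℛ_i`: the `R` nearest neighbours of unit `i`, other than `i`, in terms of the running variable
and on the same side of the cutoff.  Ties, which have probability zero if `X` has a density, are
broken by the index. -/
def neighbors {n : ℕ} (ω : D.Sample n) (i : Fin n) : Finset (Fin n) :=
  let side : Finset (Fin n) := Finset.univ.filter fun j => j ≠ i ∧ (0 ≤ X ω j ↔ 0 ≤ X ω i)
  side.filter fun j =>
    (side.filter fun l => |X ω l - X ω i| < |X ω j - X ω i| ∨
      (|X ω l - X ω i| = |X ω j - X ω i| ∧ l < j)).card < D.R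

variable {D} in
/-- The nearest-neighbour variance estimate `σ̂_i²(η̂)`. -/
def sigmaHatSq {n : ℕ} (ω : D.Sample n) (i : Fin n) : ℝ :=
  (MHat ω i - (1 / (D.R : ℝ)) * ∑ j ∈ neighbors ω i, MHat ω j) ^ 2

variable {D} in
/-- The standard error `ŝe_{v,p}(h; η̂)`. -/
def seHat (p : ℕ) (v : Fin (p + 1)) {n : ℕ} (ω : D.Sample n) : ℝ :=
  Real.sqrt (∑ i, weight p v ω i ^ 2 * sigmaHatSq ω i)

/-- The `u`-quantile of the standard normal distribution. -/
def stdNormalQuantile (u : ℝ) : ℝ := sInf {z : ℝ | u ≤ cdf (gaussianReal 0 1) z}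

variable {D} in
/-- `CI^{us}_{1-α} = [τ̂(h; η̂) ± z_α ŝe(h; η̂)]`, based on the local linear estimator, where `z_α`
is the `1 - α/2` quantile of the standard normal distribution. -/
def CIus (α : ℝ) {n : ℕ} (ω : D.Sample n) : Set ℝ :=
  Set.Icc (tauHat 1 0 ω - stdNormalQuantile (1 - α / 2) * seHat 1 0 ω)
    (tauHat 1 0 ω + stdNormalQuantile (1 - α / 2) * seHat 1 0 ω)

/-! ### Population quantities -/

/-- `E[f(Y, Z) | X = x]`. -/
def condMean (n : ℕ) (f : ℝ × D.Cov n → ℝ) (x : ℝ) : ℝ := ∫ u, f u ∂(D.cond n x)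

/-- `E[M(η) | X = x]`. -/
def meanM {n : ℕ} (η : D.Cov n → ℝ) (x : ℝ) : ℝ := D.condMean n (D.adj η) x

/-- `V[M(η) | X = x]`. -/
def varM {n : ℕ} (η : D.Cov n → ℝ) (x : ℝ) : ℝ := variance (D.adj η) (D.cond n x)

/-- The RD parameter `τ = E[Y | X = 0⁺] - E[Y | X = 0⁻]`, a difference of one-sided limits. -/
def tau (n : ℕ) : ℝ :=
  limUnder (𝓝[>] (0 : ℝ)) (D.condMean n fun u => u.1) -
    limUnder (𝓝[<] (0 : ℝ)) (D.condMean n fun u => u.1)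

/-- The support `𝒳` of the running variable. -/
def suppX : Set ℝ := D.lawX.support

/-- `𝒳_h = 𝒳 ∩ [-h, h]`. -/
def suppXh (n : ℕ) : Set ℝ := D.suppX ∩ Set.Icc (-D.h n) (D.h n)

/-- The class `ℰ` of admissible adjustment functions: `E[η(Z) | X = x]` exists and is twice
continuously differentiable around the cutoff. -/
def admissible (n : ℕ) : Set (D.Cov n → ℝ) :=
  {η | Measurable η ∧ ∃ δ : ℝ, 0 < δ ∧
    (∀ x ∈ Set.Ioo (-δ) δ, Integrable (fun u : ℝ × D.Cov n => η u.2) (D.cond n x)) ∧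
    ContDiffOn ℝ 2 (D.condMean n fun u => η u.2) (Set.Ioo (-δ) δ)}

/-- `f` is `L`-Lipschitz on `𝒳 ∩ (0, ∞)` and on `𝒳 ∩ (-∞, 0)`, that is, on each side of the
cutoff. -/
def SidewiseLipschitz (L : ℝ) (f : ℝ → ℝ) : Prop :=
  (∀ x ∈ D.suppX ∩ Set.Ioi 0, ∀ y ∈ D.suppX ∩ Set.Ioi 0, |f x - f y| ≤ L * |x - y|) ∧
    (∀ x ∈ D.suppX ∩ Set.Iio 0, ∀ y ∈ D.suppX ∩ Set.Iio 0, |f x - f y| ≤ L * |x - y|)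

/-! ### Assumptions -/

/-- First-stage estimator: `T n ⊆ ℰ` contains `etaBar n` and, with probability approaching one, the
estimates `η̂_s`, and `sup_{η ∈ T n} sup_{x ∈ A n} E[(η(Z) - etaBar(Z))² | X = x] = O(r_n²)` for some
`r_n = o(1)`. -/
structure FirstStage (T : ∀ n, Set (D.Cov n → ℝ)) (etaBar : ∀ n, D.Cov n → ℝ)
    (A : ℕ → Set ℝ) : Prop where
  subset : ∀ n, T n ⊆ D.admissible n
  mem : ∀ n, etaBar n ∈ T n
  prob : ∀ s : Fin D.S, Tendsto (fun n => D.P n {ω | etaHatCF ω s ∉ T n}) atTop (𝓝 0)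
  rate : ∃ r : ℕ → ℝ, Tendsto r atTop (𝓝 0) ∧ ∃ c : ℝ, ∀ᶠ n in atTop, ∀ η ∈ T n, ∀ x ∈ A n,
    ∫⁻ u, ENNReal.ofReal ((η u.2 - etaBar n u.2) ^ 2) ∂(D.cond n x) ≤ ENNReal.ofReal (c * r n ^ 2)

/-- `sup_{η ∈ T n} sup_{x ∈ 𝒳_h \ {0}} |∂_x^j E[η(Z) - etaBar(Z) | X = x]| = O(v_{j,n})` for some
`v_{j,n} = o(1)`, `j = 1, 2`. -/
def DerivativeRates (T : ∀ n, Set (D.Cov n → ℝ)) (etaBar : ∀ n, D.Cov n → ℝ) : Prop :=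
  ∃ v₁ v₂ : ℕ → ℝ, Tendsto v₁ atTop (𝓝 0) ∧ Tendsto v₂ atTop (𝓝 0) ∧
    ∃ c : ℝ, ∀ᶠ n in atTop, ∀ η ∈ T n, ∀ x ∈ D.suppXh n \ {0},
      let m : ℝ → ℝ := D.condMean n fun u => η u.2 - etaBar n u.2
      (∀ᶠ y in 𝓝 x, DifferentiableAt ℝ m y) ∧ DifferentiableAt ℝ (deriv m) x ∧
        |deriv m x| ≤ c * |v₁ n| ∧ |deriv (deriv m) x| ≤ c * |v₂ n|

/-- Running variable, kernel function and bandwidth. -/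
structure DesignRegularity : Prop where
  density : ∃ f : ℝ → ℝ, Measurable f ∧ (∀ x, 0 ≤ f x) ∧
    D.lawX = (volume : Measure ℝ).withDensity (fun x => ENNReal.ofReal (f x)) ∧
    ∃ δ c : ℝ, 0 < δ ∧ 0 < c ∧ ContinuousOn f (Set.Ioo (-δ) δ) ∧ ∀ x ∈ Set.Ioo (-δ) δ, c ≤ f x
  K_measurable : Measurable D.K
  K_nonneg : ∀ v, 0 ≤ D.K v
  K_integral : ∫ v, D.K v = 1
  K_bounded : ∃ b, ∀ v, D.K v ≤ b
  K_symm : ∀ v, D.K (-v) = D.K v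
  K_continuousOn : ContinuousOn D.K (Function.support D.K)
  K_zero : ∀ v, 1 < |v| → D.K v = 0
  h_pos : ∀ n, 0 < D.h n
  h_tendsto : Tendsto D.h atTop (𝓝 0)
  nh_tendsto : Tendsto (fun n : ℕ => (n : ℝ) * D.h n) atTop atTop

/-- Smoothness and moments of `M(etaBar)` given `X`, with constants that do not depend on `n`. -/
structure OutcomeRegularity (etaBar : ∀ n, D.Cov n → ℝ) (C L q : ℝ) : Prop where
  C_pos : 0 < C
  two_lt_q : 2 < q
  integrable : ∀ n, ∀ x ∈ D.suppX \ {0}, Integrable (D.adj (etaBar n)) (D.cond n x)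
  contDiffOn : ∀ n, ContDiffOn ℝ 2 (D.meanM (etaBar n)) (D.suppX \ {0})
  second_deriv_le : ∀ n, ∀ x ∈ D.suppX \ {0},
    |iteratedDerivWithin 2 (D.meanM (etaBar n)) (D.suppX \ {0}) x| ≤ C
  second_deriv_lipschitz : ∀ n,
    D.SidewiseLipschitz L (iteratedDerivWithin 2 (D.meanM (etaBar n)) (D.suppX \ {0}))
  moment : ∀ n, ∀ x ∈ D.suppX,
    ∫⁻ u, ENNReal.ofReal (|D.adj (etaBar n) u - D.meanM (etaBar n) x| ^ q) ∂(D.cond n x)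
      ≤ ENNReal.ofReal C
  variance_lipschitz : ∀ n, D.SidewiseLipschitz L (D.varM (etaBar n))
  variance_lower : ∀ n, ∀ x ∈ D.suppX \ {0}, 1 / C ≤ D.varM (etaBar n) x

open Classical in
variable {D} in
/-- `ι_i(η̂)`: the sum over the pairs `(j, l) ∈ ℛ_i²` that do not both lie in the fold of `i` of
`((η̂_{s(i)} - etaBar)(Z_i) - (η̂_{s(j)} - etaBar)(Z_j)) (M_i(etaBar) - M_l(etaBar))`. -/
def iota {n : ℕ} (etaBar : D.Cov n → ℝ) (ω : D.Sample n) (i : Fin n) : ℝ :=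
  ∑ jl ∈ (neighbors ω i ×ˢ neighbors ω i).filter
      (fun jl => ¬ (fold ω jl.1 = fold ω i ∧ fold ω jl.2 = fold ω i)),
    ((etaHatCF ω (fold ω i) (Z ω i) - etaBar (Z ω i)) -
        (etaHatCF ω (fold ω jl.1) (Z ω jl.1) - etaBar (Z ω jl.1))) *
      (M etaBar ω i - M etaBar ω jl.2)

/-- `∑_i w_{i,v,p}(h)² ι_i(η̂) = o_P((n h^{1+2v})⁻¹)` for `0 ≤ v ≤ p`. -/
def NeighborRemainder (etaBar : ∀ n, D.Cov n → ℝ) (p : ℕ) : Prop :=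
  ∀ v : Fin (p + 1), D.IsLittleOP fun n ω =>
    (n : ℝ) * D.h n ^ (1 + 2 * (v : ℕ)) * ∑ i, weight p v ω i ^ 2 * iota (etaBar n) ω i

/-- `E[(M(η) - E[M(η) | X])⁴ | X = x] ≤ B` for all `η ∈ T n`, `x ∈ A n` and all `n`. -/
def FourthMoments (T : ∀ n, Set (D.Cov n → ℝ)) (A : ℕ → Set ℝ) (B : ℝ) : Prop :=
  ∀ n, ∀ η ∈ T n, ∀ x ∈ A n,
    ∫⁻ u, ENNReal.ofReal ((D.adj η u - D.meanM η x) ^ 4) ∂(D.cond n x) ≤ ENNReal.ofReal B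

end RDSetup

end

/-! Since M_i(η̂) = M_i(η̄) − (η̂ − η̄)(Z_i), the error τ̂ − τ is the weighted sum of the residuals
of M_i(η̄) given X_i, plus the smoothing bias, minus the weighted first-stage errors. Let s² = ∑
w_i² V[M_i(η̄)|X_i] (`seSq`), which is of exact order 1/(nh) on a well-behaved design. Coverage
follows from three facts: the residual sum divided by s is asymptotically standard normal; bias and
first-stage error are o_P((nh)^{-1/2}); and the squared standard error is at least s² − o_P(1/(nh)).
An upper bound on the standard error is not needed, because a larger one only widens the interval
and the claim is one-sided.

Conditioning is replaced by an invariance: redrawing (Y_i, Z_i) from the kernel at X_i preserves the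
law of the sample (`measurePreserving_resample`). Weights, neighbours and folds are unaffected by
this, and by cross-fitting so is the first-stage estimate of the fold of i. Hence products
containing a centred factor of a single unit integrate to zero, and weighted sums have additive
second moments (`lintegral_sum_sq_le_of_orthogonal`). The same device, applied to one factor of the
characteristic function at a time, gives the central limit theorem (`norm_charFun_sum_sub_le`).

For the first-stage error (`isLittleOP_first_stage_error`), the part centred given X is orthogonal
within a fold and has vanishing second moment. The conditional mean of η̂_s − η̄ is continuous with
continuous derivative at the cutoff, so one line approximates it on both sides. The local linear
weights annihilate lines over the full sample, and within one fold up to O_P((nh)^{-1/2})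
(`isLittleOP_fold_sum`); the coefficients of the line are small, so the product is negligible. The
quadratic remainder is removed by nh⁵ → 0, as is the bias.

For the standard error (`whp_seHat_sq_ge`), a weighted Young inequality (`sq_add_sub_ge`) isolates
the squared residual of the unit and its product with the neighbours' residuals. The former
concentrates around s², the latter averages out, and differences of means and first-stage errors
enter only through small squares. -/

/-! ### Redrawing the outcome and covariates of one unit -/

/-- Replacing one coordinate of a product measure by an independent copy. -/
theorem measurePreserving_update_pi {ι : Type*} [Fintype ι] [DecidableEq ι] {α : ι → Type*}
    [∀ i, MeasurableSpace (α i)] (μ : ∀ i, Measure (α i)) [∀ i, IsProbabilityMeasure (μ i)]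
    (i : ι) :
    MeasurePreserving (fun p : (∀ j, α j) × α i => Function.update p.1 i p.2)
      ((Measure.pi μ).prod (μ i)) (Measure.pi μ) := by
  have hm : Measurable (fun p : (∀ j, α j) × α i => Function.update p.1 i p.2) :=
    measurable_update'
  refine ⟨hm, (Measure.pi_eq fun s hs => ?_).symm⟩
  rw [Measure.map_apply hm (MeasurableSet.univ_pi hs)]
  have : (fun p : (∀ j, α j) × α i => Function.update p.1 i p.2) ⁻¹' (Set.univ.pi s)
      = (Set.univ.pi (Function.update s i Set.univ)) ×ˢ s i := by
    ext p
    simp only [Set.mem_preimage, Set.mem_pi, Set.mem_univ, true_implies, Set.mem_prod]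
    constructor
    · intro h
      refine ⟨fun j => ?_, by simpa using h i⟩
      by_cases hj : j = i
      · subst hj; simp
      · simpa [hj] using h j
    · rintro ⟨h1, h2⟩ j
      by_cases hj : j = i
      · subst hj; simpa using h2
      · simpa [hj] using h1 j
  rw [this, Measure.prod_prod, Measure.pi_pi, ← Finset.mul_prod_erase _ _ (Finset.mem_univ i),
    ← Finset.mul_prod_erase (Finset.univ) (fun j => μ j (s j)) (Finset.mem_univ i)]
  simp only [Function.update_self, measure_univ, one_mul]
  rw [mul_comm]
  congr 1
  refine Finset.prod_congr rfl fun j hj => ?_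
  rw [Function.update_of_ne (Finset.ne_of_mem_erase hj)]

namespace RDSetup

variable {D : RDSetup}

instance (n : ℕ) : IsProbabilityMeasure (D.lawW n) := by
  unfold lawW; infer_instance

instance (n : ℕ) : IsProbabilityMeasure (D.P n) := by
  unfold P; infer_instance

/-- Replace the outcome and covariates of unit `i` by `v`, keeping everything else. -/
def resample {n : ℕ} (ω : D.Sample n) (i : Fin n) (v : ℝ × D.Cov n) : D.Sample n :=
  (ω.1, Function.update ω.2 i (X ω i, v))

@[simp] theorem fold_resample {n : ℕ} (ω : D.Sample n) (i : Fin n) (v : ℝ × D.Cov n) :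
    fold (resample ω i v) = fold ω := rfl

@[simp] theorem X_resample {n : ℕ} (ω : D.Sample n) (i : Fin n) (v : ℝ × D.Cov n) :
    X (resample ω i v) = X ω := by
  funext j
  by_cases h : j = i
  · subst h; simp [X, resample]
  · simp [X, resample, h]

theorem resample_snd_self {n : ℕ} (ω : D.Sample n) (i : Fin n) (v : ℝ × D.Cov n) :
    ((resample ω i v).2 i).2 = v := by simp [resample]

theorem resample_snd_ne {n : ℕ} (ω : D.Sample n) {i j : Fin n} (h : j ≠ i) (v : ℝ × D.Cov n) :
    (resample ω i v).2 j = ω.2 j := by simp [resample, h]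

@[simp] theorem M_resample_self {n : ℕ} (η : D.Cov n → ℝ) (ω : D.Sample n) (i : Fin n)
    (v : ℝ × D.Cov n) : M η (resample ω i v) i = D.adj η v := by
  simp [M, resample_snd_self]

theorem M_resample_ne {n : ℕ} (η : D.Cov n → ℝ) (ω : D.Sample n) {i j : Fin n} (h : j ≠ i)
    (v : ℝ × D.Cov n) : M η (resample ω i v) j = M η ω j := by
  simp [M, resample_snd_ne ω h]

@[fun_prop] theorem measurable_X {n : ℕ} (i : Fin n) :
    Measurable fun ω : D.Sample n => X ω i := by
  unfold X; fun_prop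

theorem measurable_resample {n : ℕ} (i : Fin n) :
    Measurable fun p : D.Sample n × (ℝ × D.Cov n) => resample p.1 i p.2 := by
  unfold resample
  refine Measurable.prodMk (by fun_prop) ?_
  have h : Measurable fun q : (Fin n → RDObs (D.d n)) × RDObs (D.d n) =>
    Function.update q.1 i q.2 := measurable_update'
  exact h.comp (g := fun q : (Fin n → RDObs (D.d n)) × RDObs (D.d n) => Function.update q.1 i q.2)
    (f := fun p : D.Sample n × (ℝ × D.Cov n) => (p.1.2, (X p.1 i, p.2)))
    (Measurable.prodMk (by fun_prop)
      (Measurable.prodMk ((measurable_X i).comp measurable_fst) measurable_snd))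

/-- The conditional law of `(Y_i, Z_i)` given the running variables, as a kernel on the sample
space. -/
def condAt (n : ℕ) (i : Fin n) : Kernel (D.Sample n) (ℝ × D.Cov n) :=
  (D.cond n).comap (fun ω => X ω i) (measurable_X i)

instance (n : ℕ) (i : Fin n) : IsMarkovKernel (condAt (D := D) n i) := by
  unfold condAt; infer_instance

/-- By `key`, the whole observation of unit i may be replaced by a fresh pair (x, v) on both sides.
Redrawing v once more given x then changes nothing, since the second draw overwrites the first. -/
theorem lintegral_resample_pi {n : ℕ} (i : Fin n) (F : (Fin n → RDObs (D.d n)) → ENNReal)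
    (hF : Measurable F) :
    ∫⁻ w, F w ∂(Measure.pi fun _ : Fin n => D.lawW n)
      = ∫⁻ w, ∫⁻ v, F (Function.update w i ((w i).1, v)) ∂(D.cond n (w i).1)
          ∂(Measure.pi fun _ : Fin n => D.lawW n) := by
  have key : ∀ G : (Fin n → RDObs (D.d n)) → ENNReal, Measurable G →
      ∫⁻ w, G w ∂(Measure.pi fun _ : Fin n => D.lawW n)
        = ∫⁻ w, ∫⁻ x, ∫⁻ v, G (Function.update w i (x, v)) ∂(D.cond n x) ∂D.lawX
          ∂(Measure.pi fun _ : Fin n => D.lawW n) := by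
    intro G hG
    have hmp := measurePreserving_update_pi (fun _ : Fin n => D.lawW n) i
    have hm := hmp.measurable
    rw [← hmp.lintegral_comp hG, lintegral_prod (fun p : (Fin n → RDObs (D.d n)) × RDObs (D.d n) =>
        G (Function.update p.1 i p.2)) (hG.comp hm).aemeasurable]
    refine lintegral_congr fun w => ?_
    have h2 : Measurable fun y : RDObs (D.d n) => G (Function.update w i y) :=
      hG.comp (measurable_update w)
    exact Measure.lintegral_compProd h2
  have hG : Measurable fun w : Fin n → RDObs (D.d n) =>
      ∫⁻ v, F (Function.update w i ((w i).1, v)) ∂(D.cond n (w i).1) := by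
    have h1 : Measurable fun p : (Fin n → RDObs (D.d n)) × (ℝ × D.Cov n) =>
        F (Function.update p.1 i ((p.1 i).1, p.2)) := by
      refine hF.comp ?_
      have h : Measurable fun q : (Fin n → RDObs (D.d n)) × RDObs (D.d n) =>
        Function.update q.1 i q.2 := measurable_update'
      exact h.comp (g := fun q : (Fin n → RDObs (D.d n)) × RDObs (D.d n) =>
        Function.update q.1 i q.2)
        (f := fun p : (Fin n → RDObs (D.d n)) × (ℝ × D.Cov n) => (p.1, ((p.1 i).1, p.2)))
        (by fun_prop)
    exact Measurable.lintegral_kernel_prod_right (f := fun w v =>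
        F (Function.update w i ((w i).1, v))) (κ := (D.cond n).comap
          (fun w : Fin n → RDObs (D.d n) => (w i).1) (by fun_prop)) h1
  rw [key F hF, key _ hG]
  refine lintegral_congr fun w => ?_
  refine lintegral_congr fun x => ?_
  simp

/-- This takes the place of conditioning on everything except (Y_i, Z_i). The fold assignment is an
independent factor, so for each fixed assignment the claim reduces to the product measure of the
data. -/
theorem measurePreserving_resample {n : ℕ} (i : Fin n) :
    MeasurePreserving (fun p : D.Sample n × (ℝ × D.Cov n) => resample p.1 i p.2)
      ((D.P n).compProd (condAt n i)) (D.P n) := by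
  have hm := measurable_resample (D := D) i
  refine ⟨hm, Measure.ext fun s hs => ?_⟩
  have hind : Measurable (s.indicator (1 : D.Sample n → ENNReal)) := measurable_one.indicator hs
  rw [Measure.map_apply hm hs, ← lintegral_indicator_one hs, ← lintegral_indicator_one (hm hs)]
  have hc : Measurable fun p : D.Sample n × (ℝ × D.Cov n) =>
      s.indicator (1 : D.Sample n → ENNReal) (resample p.1 i p.2) := hind.comp hm
  have : (fun p : D.Sample n × (ℝ × D.Cov n) =>
      ((fun p : D.Sample n × (ℝ × D.Cov n) => resample p.1 i p.2) ⁻¹' s).indicator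
        (1 : D.Sample n × (ℝ × D.Cov n) → ENNReal) p) = fun p => s.indicator (1 : D.Sample n → ENNReal)
          (resample p.1 i p.2) := rfl
  rw [this, Measure.lintegral_compProd hc]
  have hin : Measurable fun ω : D.Sample n =>
      ∫⁻ v, s.indicator (1 : D.Sample n → ENNReal) (resample ω i v) ∂(condAt n i ω) :=
    Measurable.lintegral_kernel_prod_right (f := fun ω v =>
      s.indicator (1 : D.Sample n → ENNReal) (resample ω i v)) hc
  unfold P
  rw [lintegral_prod _ hin.aemeasurable, lintegral_prod _ hind.aemeasurable]
  refine lintegral_congr fun f => ?_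
  rw [lintegral_resample_pi i (fun w => s.indicator (1 : D.Sample n → ENNReal) (f, w))
    (hind.comp (by fun_prop))]
  rfl

theorem lintegral_eq_resample {n : ℕ} (i : Fin n) {F : D.Sample n → ENNReal}
    (hF : Measurable F) :
    ∫⁻ ω, F ω ∂(D.P n)
      = ∫⁻ ω, ∫⁻ v, F (resample ω i v) ∂(D.cond n (X ω i)) ∂(D.P n) := by
  rw [← (measurePreserving_resample i).lintegral_comp hF,
    Measure.lintegral_compProd (f := fun p : D.Sample n × (ℝ × D.Cov n) => F (resample p.1 i p.2))
      (hF.comp (measurable_resample i))]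
  rfl

theorem integral_eq_resample {E : Type*} [NormedAddCommGroup E] [NormedSpace ℝ E]
    {n : ℕ} (i : Fin n) {F : D.Sample n → E}
    (hF : Integrable F (D.P n)) :
    ∫ ω, F ω ∂(D.P n)
      = ∫ ω, ∫ v, F (resample ω i v) ∂(D.cond n (X ω i)) ∂(D.P n) := by
  have hmp := measurePreserving_resample (D := D) i
  have h1 : ∫ ω, F ω ∂(D.P n)
      = ∫ p, F (resample p.1 i p.2) ∂((D.P n).compProd (condAt n i)) := by
    conv_lhs => rw [← hmp.map_eq]
    rw [integral_map hmp.measurable.aemeasurable]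
    rw [hmp.map_eq]; exact hF.1
  rw [h1, Measure.integral_compProd]
  · rfl
  · exact hmp.integrable_comp_of_integrable hF

/-- A function whose conditional mean given everything but `(Y_i, Z_i)` vanishes has mean zero. -/
theorem integral_eq_zero_of_resample {n : ℕ} (i : Fin n) {F : D.Sample n → ℝ}
    (h : ∀ ω, ∫ v, F (resample ω i v) ∂(D.cond n (X ω i)) = 0) :
    ∫ ω, F ω ∂(D.P n) = 0 := by
  -- Without integrability the Bochner integral is 0 by convention, so no integrability hypothesis
  -- is required.
  by_cases hF : Integrable F (D.P n)
  · rw [integral_eq_resample i hF]; simp [h]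
  · exact integral_undef hF

end RDSetup

/-! ### Orthogonal sums and convergence in probability -/

/-- Expanding the square leaves only the diagonal. The bound is phrased with `∫⁻` so that it is
trivial when some second moment is infinite, which spares every application an integrability check.
-/
theorem lintegral_sum_sq_le_of_orthogonal {Ω ι : Type*} [MeasurableSpace Ω] (μ : Measure Ω)
    (s : Finset ι) (Y : ι → Ω → ℝ) (hY : ∀ i ∈ s, Measurable (Y i))
    (horth : ∀ i ∈ s, ∀ j ∈ s, i ≠ j → ∫ ω, Y i ω * Y j ω ∂μ = 0) :
    ∫⁻ ω, ENNReal.ofReal ((∑ i ∈ s, Y i ω) ^ 2) ∂μ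
      ≤ ∑ i ∈ s, ∫⁻ ω, ENNReal.ofReal (Y i ω ^ 2) ∂μ := by
  by_cases hfin : ∀ i ∈ s, ∫⁻ ω, ENNReal.ofReal (Y i ω ^ 2) ∂μ ≠ ⊤
  swap
  · push Not at hfin
    obtain ⟨i, hi, h⟩ := hfin
    have : ∑ i ∈ s, ∫⁻ ω, ENNReal.ofReal (Y i ω ^ 2) ∂μ = ⊤ := ENNReal.sum_eq_top.2 ⟨i, hi, h⟩
    rw [this]; exact le_top
  have hsq : ∀ i ∈ s, Integrable (fun ω => Y i ω ^ 2) μ := fun i hi => by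
    refine ⟨((hY i hi).pow_const 2).aestronglyMeasurable, ?_⟩
    rw [hasFiniteIntegral_iff_ofReal (ae_of_all _ fun ω => sq_nonneg _)]
    exact lt_top_iff_ne_top.2 (hfin i hi)
  have hL : ∀ i ∈ s, MemLp (Y i) 2 μ := fun i hi =>
    (memLp_two_iff_integrable_sq (hY i hi).aestronglyMeasurable).2 (hsq i hi)
  have hprod : ∀ i ∈ s, ∀ j ∈ s, Integrable (fun ω => Y i ω * Y j ω) μ := fun i hi j hj =>
    (hL i hi).integrable_mul (hL j hj)
  have hexp : ∀ ω, (∑ i ∈ s, Y i ω) ^ 2 = ∑ i ∈ s, ∑ j ∈ s, Y i ω * Y j ω := fun ω => by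
    rw [sq, Finset.sum_mul_sum]
  have hint : Integrable (fun ω => (∑ i ∈ s, Y i ω) ^ 2) μ := by
    simp_rw [hexp]
    exact integrable_finsetSum _ fun i hi => integrable_finsetSum _ fun j hj => hprod i hi j hj
  rw [← ofReal_integral_eq_lintegral_ofReal hint (ae_of_all _ fun ω => sq_nonneg _)]
  have : ∫ ω, (∑ i ∈ s, Y i ω) ^ 2 ∂μ = ∑ i ∈ s, ∫ ω, Y i ω ^ 2 ∂μ := by
    simp_rw [hexp]
    rw [integral_finsetSum _ fun i hi => integrable_finsetSum _ fun j hj => hprod i hi j hj]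
    refine Finset.sum_congr rfl fun i hi => ?_
    rw [integral_finsetSum _ fun j hj => hprod i hi j hj, Finset.sum_eq_single i]
    · simp_rw [sq]
    · intro j hj hne; exact horth i hi j hj hne.symm
    · intro h; exact absurd hi h
  rw [this, ENNReal.ofReal_sum_of_nonneg fun i _ => integral_nonneg fun ω => sq_nonneg _]
  refine Finset.sum_le_sum fun i hi => ?_
  rw [ofReal_integral_eq_lintegral_ofReal (hsq i hi) (ae_of_all _ fun ω => sq_nonneg _)]

namespace RDSetup

variable (D : RDSetup)

/-- `p` holds with probability approaching one. -/
def WHP (p : ∀ n, D.Sample n → Prop) : Prop :=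
  Tendsto (fun n => D.P n {ω | ¬ p n ω}) atTop (𝓝 0)

variable {D}

theorem WHP.mono {p q : ∀ n, D.Sample n → Prop} (hp : D.WHP p)
    (h : ∀ᶠ n in atTop, ∀ ω, p n ω → q n ω) : D.WHP q := by
  refine tendsto_of_tendsto_of_tendsto_of_le_of_le' tendsto_const_nhds hp
    (Eventually.of_forall fun _ => zero_le) ?_
  filter_upwards [h] with n hn
  exact measure_mono fun ω hω hpω => hω (hn ω hpω)

theorem WHP.and {p q : ∀ n, D.Sample n → Prop} (hp : D.WHP p) (hq : D.WHP q) :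
    D.WHP fun n ω => p n ω ∧ q n ω := by
  have := hp.add hq
  rw [add_zero] at this
  refine tendsto_of_tendsto_of_tendsto_of_le_of_le tendsto_const_nhds this
    (fun _ => zero_le) fun n => ?_
  refine (measure_mono fun ω hω => ?_).trans (measure_union_le _ _)
  simp only [Set.mem_ofPred_eq, Set.mem_union] at hω ⊢
  tauto

theorem WHP.forall_fin {S : ℕ} {p : Fin S → ∀ n, D.Sample n → Prop} (hp : ∀ s, D.WHP (p s)) :
    D.WHP fun n ω => ∀ s, p s n ω := by
  have : Tendsto (fun n => ∑ s : Fin S, D.P n {ω | ¬ p s n ω}) atTop (𝓝 (∑ s : Fin S, 0)) :=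
    tendsto_finsetSum _ fun s _ => hp s
  rw [Finset.sum_const_zero] at this
  refine tendsto_of_tendsto_of_tendsto_of_le_of_le tendsto_const_nhds this
    (fun _ => zero_le) fun n => ?_
  refine (measure_mono fun ω hω => ?_).trans (measure_biUnion_finset_le _ _)
  simp only [Set.mem_ofPred_eq, not_forall] at hω
  obtain ⟨s, hs⟩ := hω
  exact Set.mem_biUnion (Finset.mem_coe.2 (Finset.mem_univ s)) hs

theorem WHP.of_eventually {p : ∀ n, D.Sample n → Prop} (h : ∀ᶠ n in atTop, ∀ ω, p n ω) :
    D.WHP p := by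
  refine tendsto_const_nhds.congr' ?_
  filter_upwards [h] with n hn
  simp [hn]

theorem WHP.of_ae {p : ∀ n, D.Sample n → Prop} (h : ∀ᶠ n in atTop, ∀ᵐ ω ∂(D.P n), p n ω) :
    D.WHP p := by
  refine tendsto_const_nhds.congr' ?_
  filter_upwards [h] with n hn
  exact (ae_iff.1 hn).symm

theorem isLittleOP_iff_whp {ξ : ∀ n, D.Sample n → ℝ} :
    D.IsLittleOP ξ ↔ ∀ ε : ℝ, 0 < ε → D.WHP fun n ω => |ξ n ω| < ε := by
  simp [IsLittleOP, WHP]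

theorem IsLittleOP.whp {ξ : ∀ n, D.Sample n → ℝ} (h : D.IsLittleOP ξ) {ε : ℝ} (hε : 0 < ε) :
    D.WHP fun n ω => |ξ n ω| < ε := isLittleOP_iff_whp.1 h ε hε

/-- Chebyshev's inequality. -/
theorem IsLittleOP.of_lintegral_sq {ξ : ∀ n, D.Sample n → ℝ} (hξ : ∀ n, Measurable (ξ n))
    {β : ℕ → ℝ} (hβ : Tendsto β atTop (𝓝 0))
    (h : ∀ᶠ n in atTop, ∫⁻ ω, ENNReal.ofReal (ξ n ω ^ 2) ∂(D.P n) ≤ ENNReal.ofReal (β n)) :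
    D.IsLittleOP ξ := by
  intro ε hε
  have hε2 : 0 < ε ^ 2 := by positivity
  have hlim : Tendsto (fun n => ENNReal.ofReal (β n) / ENNReal.ofReal (ε ^ 2)) atTop (𝓝 0) := by
    have h1 := (ENNReal.continuous_ofReal.tendsto 0).comp hβ
    have h2 := ENNReal.Tendsto.div_const (b := ENNReal.ofReal (ε ^ 2)) h1
      (Or.inr (by simp [hε.ne']))
    simpa using h2
  refine tendsto_of_tendsto_of_tendsto_of_le_of_le' tendsto_const_nhds hlim
    (Eventually.of_forall fun _ => zero_le) ?_
  filter_upwards [h] with n hn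
  have h1 := meas_ge_le_lintegral_div (μ := D.P n)
    (f := fun ω => ENNReal.ofReal (ξ n ω ^ 2)) ((hξ n).pow_const 2).ennreal_ofReal.aemeasurable
    (ε := ENNReal.ofReal (ε ^ 2)) (by simp [hε.ne']) ENNReal.ofReal_ne_top
  refine le_trans (measure_mono fun ω hω => ?_) (h1.trans (ENNReal.div_le_div_right hn _))
  simp only [Set.mem_ofPred_eq] at hω ⊢
  refine ENNReal.ofReal_le_ofReal ?_
  rw [← sq_abs (ξ n ω)]
  exact pow_le_pow_left₀ hε.le hω 2

theorem IsLittleOP.of_lintegral_abs {ξ : ∀ n, D.Sample n → ℝ} (hξ : ∀ n, Measurable (ξ n))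
    {β : ℕ → ℝ} (hβ : Tendsto β atTop (𝓝 0))
    (h : ∀ᶠ n in atTop, ∫⁻ ω, ENNReal.ofReal |ξ n ω| ∂(D.P n) ≤ ENNReal.ofReal (β n)) :
    D.IsLittleOP ξ := by
  -- The second-moment criterion is applied to √|ξ|, whose square is |ξ|.
  have h1 : D.IsLittleOP fun n ω => √|ξ n ω| := by
    refine IsLittleOP.of_lintegral_sq (fun n => (hξ n).abs.sqrt) hβ ?_
    simpa [Real.sq_sqrt] using h
  intro ε hε
  refine (h1 (√ε) (Real.sqrt_pos.2 hε)).congr fun n => ?_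
  congr 1
  ext ω
  simp only [Set.mem_ofPred_eq, abs_of_nonneg (Real.sqrt_nonneg _)]
  exact Real.sqrt_le_sqrt_iff (abs_nonneg _)

theorem IsLittleOP.mono {ξ ζ : ∀ n, D.Sample n → ℝ} (hξ : D.IsLittleOP ξ)
    (h : D.WHP fun n ω => |ζ n ω| ≤ |ξ n ω|) : D.IsLittleOP ζ := by
  rw [isLittleOP_iff_whp]
  intro ε hε
  exact ((hξ.whp hε).and h).mono (Eventually.of_forall fun n ω hω => hω.2.trans_lt hω.1)

theorem IsLittleOP.add {ξ ζ : ∀ n, D.Sample n → ℝ} (hξ : D.IsLittleOP ξ) (hζ : D.IsLittleOP ζ) :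
    D.IsLittleOP fun n ω => ξ n ω + ζ n ω := by
  rw [isLittleOP_iff_whp]
  intro ε hε
  refine ((hξ.whp (half_pos hε)).and (hζ.whp (half_pos hε))).mono
    (Eventually.of_forall fun n ω hω => ?_)
  have := abs_add_le (ξ n ω) (ζ n ω)
  linarith [hω.1, hω.2]

theorem IsLittleOP.const_mul {ξ : ∀ n, D.Sample n → ℝ} (hξ : D.IsLittleOP ξ) (c : ℝ) :
    D.IsLittleOP fun n ω => c * ξ n ω := by
  rw [isLittleOP_iff_whp]
  intro ε hε
  have h1 : 0 < |c| + 1 := by positivity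
  refine (hξ.whp (div_pos hε h1)).mono (Eventually.of_forall fun n ω hω => ?_)
  rw [abs_mul]
  rw [lt_div_iff₀ h1] at hω
  nlinarith [abs_nonneg c, abs_nonneg (ξ n ω)]

theorem IsLittleOP.of_tendsto {β : ℕ → ℝ} (hβ : Tendsto β atTop (𝓝 0)) :
    D.IsLittleOP fun n _ => β n := by
  rw [isLittleOP_iff_whp]
  intro ε hε
  refine WHP.of_eventually ?_
  filter_upwards [hβ.eventually (Metric.ball_mem_nhds 0 hε)] with n hn ω
  simpa using hn

theorem IsLittleOP.sum {ι : Type*} (s : Finset ι) {ξ : ι → ∀ n, D.Sample n → ℝ}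
    (hξ : ∀ i ∈ s, D.IsLittleOP (ξ i)) : D.IsLittleOP fun n ω => ∑ i ∈ s, ξ i n ω := by
  classical
  induction s using Finset.induction_on with
  | empty => simpa using IsLittleOP.of_tendsto (D := D) (tendsto_const_nhds (x := (0 : ℝ)))
  | insert a s ha ih =>
    simp_rw [Finset.sum_insert ha]
    exact (hξ a (Finset.mem_insert_self _ _)).add
      (ih fun i hi => hξ i (Finset.mem_insert_of_mem hi))

/-- Passes a probability bound from one event to another that contains it off an asymptotically
negligible set. Only monotonicity and subadditivity of the outer measure enter, so none of the
events has to be measurable. -/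
theorem WHP.eventually_measureReal_ge {p : ∀ n, D.Sample n → Prop} (hp : D.WHP p)
    {q : ∀ n, D.Sample n → Prop} {r : ∀ n, D.Sample n → Prop}
    (hr : ∀ᶠ n in atTop, ∀ ω, p n ω → q n ω → r n ω) {δ : ℝ} (hδ : 0 < δ) :
    ∀ᶠ n in atTop, (D.P n).real {ω | q n ω} - δ ≤ (D.P n).real {ω | r n ω} := by
  have h1 : Tendsto (fun n => (D.P n).real {ω | ¬ p n ω}) atTop (𝓝 0) := by
    have := (ENNReal.tendsto_toReal ENNReal.zero_ne_top).comp hp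
    simpa [Measure.real, Function.comp_def] using this
  filter_upwards [hr, h1.eventually (gt_mem_nhds hδ)] with n hn hlt
  have : (D.P n).real {ω | q n ω} ≤ (D.P n).real {ω | r n ω} + (D.P n).real {ω | ¬ p n ω} := by
    refine (measureReal_mono (fun ω hω => ?_)).trans (measureReal_union_le _ _)
    by_cases hpω : p n ω
    · exact Or.inl (hn ω hpω hω)
    · exact Or.inr hpω
  linarith

end RDSetup

/-! ### One-sided expansions at the cutoff -/

/-- A function on `(0, h]` with a bounded derivative is Lipschitz there and has a limit at `0`. -/
theorem exists_tendsto_of_deriv_bounded {f : ℝ → ℝ} {h c : ℝ} (hh : 0 < h) (hc : 0 ≤ c)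
    (hf : ∀ x ∈ Set.Ioc 0 h, DifferentiableAt ℝ f x) (hb : ∀ x ∈ Set.Ioc 0 h, |deriv f x| ≤ c) :
    ∃ a, Tendsto f (𝓝[>] 0) (𝓝 a) ∧ ∀ x ∈ Set.Ioc 0 h, |f x - a| ≤ c * x := by
  have hlip : LipschitzOnWith ⟨c, hc⟩ f (Set.Ioc 0 h) :=
    LipschitzOnWith.of_dist_le_mul fun x hx y hy => by
      rw [dist_eq_norm, dist_eq_norm]
      exact (convex_Ioc 0 h).norm_image_sub_le_of_norm_deriv_le hf hb hy hx
  -- A Lipschitz extension to the whole line supplies the limit at 0 as its value there.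
  obtain ⟨g, hg, hfg⟩ := hlip.extend_real
  refine ⟨g 0, ?_, fun x hx => ?_⟩
  · have h1 : Tendsto g (𝓝[>] 0) (𝓝 (g 0)) := hg.continuous.continuousAt.mono_left inf_le_left
    refine h1.congr' ?_
    filter_upwards [Ioc_mem_nhdsGT hh] with x hx using (hfg hx).symm
  · have := hg.dist_le_mul x 0
    rw [Real.dist_eq, Real.dist_eq, sub_zero, abs_of_pos hx.1, ← hfg hx] at this
    exact this

/-- One-sided first order expansion with a bounded second derivative. -/
theorem exists_linear_approx {f : ℝ → ℝ} {h c : ℝ} (hh : 0 < h) (hc : 0 ≤ c)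
    (hf : ∀ x ∈ Set.Ioc 0 h, DifferentiableAt ℝ f x)
    (hf' : ∀ x ∈ Set.Ioc 0 h, DifferentiableAt ℝ (deriv f) x)
    (hb : ∀ x ∈ Set.Ioc 0 h, |deriv (deriv f) x| ≤ c) :
    ∃ a b, Tendsto f (𝓝[>] 0) (𝓝 a) ∧ Tendsto (deriv f) (𝓝[>] 0) (𝓝 b) ∧
      ∀ x ∈ Set.Ioc 0 h, |f x - a - b * x| ≤ c * x ^ 2 := by
  obtain ⟨b, hbt, hbb⟩ := exists_tendsto_of_deriv_bounded hh hc hf' hb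
  have hd : ∀ y ∈ Set.Ioc 0 h, HasDerivAt (fun z => f z - b * z) (deriv f y - b) y := fun y hy => by
    have h1 : HasDerivAt (fun z : ℝ => b * z) b y := by simpa using (hasDerivAt_id y).const_mul b
    exact (hf y hy).hasDerivAt.fun_sub h1
  -- After subtraction of b z the derivative is at most c x on (0, x], so the first-order lemma on
  -- that interval has Lipschitz constant c x. The constant depends on x, hence one application per
  -- x; uniqueness of limits identifies the intercepts.
  have key : ∀ x ∈ Set.Ioc 0 h, ∃ a, Tendsto (fun z => f z - b * z) (𝓝[>] 0) (𝓝 a) ∧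
      |f x - b * x - a| ≤ c * x * x := fun x hx => by
    have hsub : ∀ y ∈ Set.Ioc 0 x, y ∈ Set.Ioc 0 h := fun y hy => ⟨hy.1, hy.2.trans hx.2⟩
    obtain ⟨a, ha, hab⟩ := exists_tendsto_of_deriv_bounded (f := fun z => f z - b * z)
      (c := c * x) hx.1 (mul_nonneg hc hx.1.le)
      (fun y hy => (hd y (hsub y hy)).differentiableAt) (fun y hy => by
        rw [(hd y (hsub y hy)).deriv]
        exact (hbb y (hsub y hy)).trans (mul_le_mul_of_nonneg_left hy.2 hc))
    exact ⟨a, ha, hab x ⟨hx.1, le_rfl⟩⟩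
  obtain ⟨a, ha, -⟩ := key h ⟨hh, le_rfl⟩
  refine ⟨a, b, ?_, hbt, fun x hx => ?_⟩
  · have h0 : Tendsto (fun z : ℝ => b * z) (𝓝[>] 0) (𝓝 0) := by
      have : Tendsto (fun z : ℝ => b * z) (𝓝 0) (𝓝 (b * 0)) :=
        (continuous_const_mul b).tendsto 0
      rw [mul_zero] at this
      exact this.mono_left inf_le_left
    simpa using ha.add h0
  · obtain ⟨a', ha', hx'⟩ := key x hx
    rw [tendsto_nhds_unique ha ha']
    rw [show f x - a' - b * x = f x - b * x - a' by ring, sq, ← mul_assoc]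
    exact hx'

/-! ### Third order expansion of the characteristic function -/

/-- For |x| ≤ 1 this is the Taylor remainder of the exponential series; for |x| > 1 each term is
dominated by a multiple of |x|³. The constant 4 is not optimised. -/
theorem norm_exp_mul_I_sub_le (x : ℝ) :
    ‖Complex.exp (x * Complex.I) - (1 + x * Complex.I - x ^ 2 / 2)‖ ≤ 4 * |x| ^ 3 := by
  have hn : ‖(x : ℂ) * Complex.I‖ = |x| := by simp
  rcases le_or_gt |x| 1 with h | h
  · have := Complex.exp_bound (x := x * Complex.I) (by rw [hn]; exact h) (n := 3) (by norm_num)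
    rw [hn] at this
    have e : ∑ m ∈ Finset.range 3, ((x : ℂ) * Complex.I) ^ m / (m.factorial : ℂ)
        = 1 + x * Complex.I - x ^ 2 / 2 := by
      simp [Finset.sum_range_succ, mul_pow]; ring
    rw [e] at this
    refine this.trans ?_
    norm_num [Nat.factorial]
    nlinarith [pow_nonneg (abs_nonneg x) 3]
  · have h1 : ‖Complex.exp (x * Complex.I)‖ = 1 := Complex.norm_exp_ofReal_mul_I x
    have h2 : ‖(1 : ℂ) + x * Complex.I - x ^ 2 / 2‖ ≤ 1 + |x| + |x| ^ 2 / 2 := by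
      refine (norm_sub_le _ _).trans (add_le_add ((norm_add_le _ _).trans ?_) ?_)
      · simp
      · simp
    refine (norm_sub_le _ _).trans ?_
    rw [h1]
    nlinarith [mul_pos (sub_pos.2 h) (sub_pos.2 h), pow_pos (zero_lt_one.trans h) 2,
      pow_pos (zero_lt_one.trans h) 3, mul_pos (sub_pos.2 h) (pow_pos (zero_lt_one.trans h) 2)]

theorem abs_exp_neg_sub_le {y : ℝ} (hy : 0 ≤ y) : |Real.exp (-y) - (1 - y)| ≤ y ^ 2 := by
  rcases le_or_gt y 1 with h | h
  · have := Real.abs_exp_sub_one_sub_id_le (x := -y) (by rwa [abs_neg, abs_of_nonneg hy])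
    rw [neg_sq] at this
    convert this using 2; ring
  · have h1 : Real.exp (-y) ≤ 1 := Real.exp_le_one_iff.2 (by linarith)
    have h2 := Real.exp_pos (-y)
    rw [abs_le]; constructor <;> nlinarith

/-- Both terms are compared with 1 − a²v/2: the characteristic function to third order in a, the
Gaussian factor to fourth. All lower moments are controlled through |y|^k ≤ 1 + y⁴, which is where 1
+ B comes from. -/
theorem norm_charFun_sub_gaussian_le {Ω : Type*} [MeasurableSpace Ω] (ν : Measure Ω)
    [IsProbabilityMeasure ν] {g : Ω → ℝ} (hg : Measurable g) {v B : ℝ} (hB : 0 ≤ B)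
    (h0 : ∫ u, g u ∂ν = 0) (h2 : ∫ u, g u ^ 2 ∂ν = v)
    (h4 : ∫⁻ u, ENNReal.ofReal (g u ^ 4) ∂ν ≤ ENNReal.ofReal B) (a : ℝ) :
    ‖∫ u, Complex.exp ((a * g u : ℝ) * Complex.I) ∂ν - (Real.exp (-(a ^ 2 * v / 2)) : ℂ)‖
      ≤ 4 * |a| ^ 3 * (1 + B) + a ^ 4 * (1 + B) ^ 2 := by
  have i4 : Integrable (fun u => g u ^ 4) ν := by
    refine ⟨(hg.pow_const 4).aestronglyMeasurable, ?_⟩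
    rw [hasFiniteIntegral_iff_ofReal (ae_of_all _ fun ω => by positivity)]
    exact h4.trans_lt ENNReal.ofReal_lt_top
  have b4 : ∫ u, g u ^ 4 ∂ν ≤ B := by
    rw [← ENNReal.ofReal_le_ofReal_iff hB,
      ofReal_integral_eq_lintegral_ofReal i4 (ae_of_all _ fun ω => by positivity)]
    exact h4
  have i14 : Integrable (fun u => 1 + g u ^ 4) ν := (integrable_const _).add i4
  have b14 : ∫ u, (1 + g u ^ 4) ∂ν ≤ 1 + B := by
    rw [integral_add (integrable_const _) i4]; simpa using b4
  have dom : ∀ (k : ℕ), k ≤ 4 → ∀ y : ℝ, |y| ^ k ≤ 1 + y ^ 4 := fun k hk y => by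
    have e : y ^ 4 = |y| ^ 4 := by rw [← abs_pow, abs_of_nonneg]; positivity
    rw [e]
    rcases le_or_gt |y| 1 with h | h
    · have := pow_le_one₀ (n := k) (abs_nonneg y) h
      have := pow_nonneg (abs_nonneg y) 4
      linarith
    · have := pow_le_pow_right₀ h.le hk
      linarith
  have i1 : Integrable g ν := i14.mono hg.aestronglyMeasurable (ae_of_all _ fun u => by
    have := dom 1 (by norm_num) (g u)
    rw [Real.norm_eq_abs, Real.norm_eq_abs]; rw [pow_one] at this
    exact this.trans (le_abs_self _))
  have i2 : Integrable (fun u => g u ^ 2) ν :=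
    i14.mono (hg.pow_const 2).aestronglyMeasurable (ae_of_all _ fun u => by
      have := dom 2 (by norm_num) (g u)
      rw [Real.norm_eq_abs, Real.norm_eq_abs, abs_pow]
      exact this.trans (le_abs_self _))
  have hv0 : 0 ≤ v := by rw [← h2]; exact integral_nonneg fun u => sq_nonneg _
  have hvB : v ≤ 1 + B := by
    rw [← h2]
    refine (integral_mono i2 i14 fun u => ?_).trans b14
    have := dom 2 (by norm_num) (g u)
    rwa [sq_abs] at this
  have ie : Integrable (fun u => Complex.exp ((a * g u : ℝ) * Complex.I)) ν := by
    refine Integrable.of_bound (C := 1) ?_ (ae_of_all _ fun u => ?_)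
    · have : Measurable fun u => Complex.exp ((a * g u : ℝ) * Complex.I) := by fun_prop
      exact this.aestronglyMeasurable
    · rw [Complex.norm_exp_ofReal_mul_I]
  have ip : Integrable (fun u => (1 : ℂ) + ((a * g u : ℝ) : ℂ) * Complex.I
      - ((a * g u : ℝ) : ℂ) ^ 2 / 2) ν := by
    refine ((integrable_const _).add ?_).sub ?_
    · exact ((i1.const_mul a).ofReal).mul_const _
    · have : Integrable (fun u => (((a * g u) ^ 2 : ℝ) : ℂ) / 2) ν := by
        have h := ((i2.const_mul (a ^ 2)).ofReal (𝕜 := ℂ)).div_const 2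
        simpa [mul_pow] using h
      simpa using this
  have vp : ∫ u, ((1 : ℂ) + ((a * g u : ℝ) : ℂ) * Complex.I
      - ((a * g u : ℝ) : ℂ) ^ 2 / 2) ∂ν = ((1 - a ^ 2 * v / 2 : ℝ) : ℂ) := by
    have e1 : ∫ u, ((a * g u : ℝ) : ℂ) * Complex.I ∂ν = 0 := by
      rw [integral_mul_const, integral_complex_ofReal, integral_const_mul, h0]; simp
    have e2 : ∫ u, ((a * g u : ℝ) : ℂ) ^ 2 / 2 ∂ν = ((a ^ 2 * v / 2 : ℝ) : ℂ) := by
      rw [← h2, ← integral_const_mul, ← integral_div, ← integral_complex_ofReal]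
      refine integral_congr_ae (ae_of_all _ fun u => ?_)
      push_cast; ring
    have j1 : Integrable (fun u => ((a * g u : ℝ) : ℂ) * Complex.I) ν :=
      ((i1.const_mul a).ofReal).mul_const _
    have j2 : Integrable (fun u => ((a * g u : ℝ) : ℂ) ^ 2 / 2) ν := by
      have h := ((i2.const_mul (a ^ 2)).ofReal (𝕜 := ℂ)).div_const 2
      simpa [mul_pow] using h
    have j01 : Integrable (fun u => (1 : ℂ) + ((a * g u : ℝ) : ℂ) * Complex.I) ν :=
      (integrable_const _).add j1
    rw [integral_sub j01 j2, integral_add (integrable_const _) j1, e1, e2]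
    simp
  have step1 : ‖∫ u, Complex.exp ((a * g u : ℝ) * Complex.I) ∂ν - ((1 - a ^ 2 * v / 2 : ℝ) : ℂ)‖
      ≤ 4 * |a| ^ 3 * (1 + B) := by
    rw [← vp, ← integral_sub ie ip]
    calc _ ≤ ∫ u, 4 * |a| ^ 3 * (1 + g u ^ 4) ∂ν := by
          refine norm_integral_le_of_norm_le (i14.const_mul _) (ae_of_all _ fun u => ?_)
          refine (norm_exp_mul_I_sub_le _).trans ?_
          rw [abs_mul, mul_pow, ← mul_assoc]
          exact mul_le_mul_of_nonneg_left (dom 3 (by norm_num) _) (by positivity)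
      _ ≤ _ := by
          rw [integral_const_mul]
          exact mul_le_mul_of_nonneg_left b14 (by positivity)
  have step2 : ‖((1 - a ^ 2 * v / 2 : ℝ) : ℂ) - (Real.exp (-(a ^ 2 * v / 2)) : ℂ)‖
      ≤ a ^ 4 * (1 + B) ^ 2 := by
    rw [← Complex.ofReal_sub, Complex.norm_real, norm_sub_rev, Real.norm_eq_abs]
    refine (abs_exp_neg_sub_le (by positivity)).trans ?_
    have : v ^ 2 ≤ (1 + B) ^ 2 := pow_le_pow_left₀ hv0 hvB 2
    have h4 : 0 ≤ a ^ 4 := by positivity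
    calc (a ^ 2 * v / 2) ^ 2 = a ^ 4 * v ^ 2 / 4 := by ring
      _ ≤ a ^ 4 * (1 + B) ^ 2 := by nlinarith [mul_le_mul_of_nonneg_left this h4, mul_nonneg h4 (sq_nonneg v)]
  calc _ ≤ _ := norm_sub_le_norm_sub_add_norm_sub _ _ _
    _ ≤ _ := add_le_add step1 step2

/-! ### Nearest neighbours on one side of the cutoff -/

/-- The rank, i.e. the number of strictly smaller elements, maps `s` bijectively onto {0, …, |s| −
1} when the key is injective, so exactly R elements have rank below R. -/
theorem card_filter_rank_lt {ι α : Type*} [LinearOrder α] (s : Finset ι)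
    (g : ι → α) (hg : Set.InjOn g s) (R : ℕ) (hR : R ≤ s.card) :
    (s.filter fun j => (s.filter fun l => g l < g j).card < R).card = R := by
  classical
  set rank : ι → ℕ := fun j => (s.filter fun l => g l < g j).card with hrank
  have hlt : ∀ i ∈ s, ∀ j ∈ s, g i < g j → rank i < rank j := fun i hi j _ hij => by
    refine Finset.card_lt_card ⟨fun l hl => ?_, fun hsub => ?_⟩
    · rw [Finset.mem_filter] at hl ⊢
      exact ⟨hl.1, hl.2.trans hij⟩
    · have := hsub (Finset.mem_filter.2 ⟨hi, hij⟩)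
      exact lt_irrefl _ (Finset.mem_filter.1 this).2
  have hinj : Set.InjOn rank s := fun i hi j hj hij => by
    rcases lt_trichotomy (g i) (g j) with h | h | h
    · exact absurd hij (hlt i hi j hj h).ne
    · exact hg hi hj h
    · exact absurd hij (hlt j hj i hi h).ne'
  have himg : s.image rank = Finset.range s.card := by
    refine Finset.eq_of_subset_of_card_le (fun m hm => ?_) ?_
    · obtain ⟨j, hj, rfl⟩ := Finset.mem_image.1 hm
      rw [Finset.mem_range]
      refine Finset.card_lt_card ⟨Finset.filter_subset _ _, fun hsub => ?_⟩
      exact lt_irrefl _ (Finset.mem_filter.1 (hsub hj)).2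
    · rw [Finset.card_range, Finset.card_image_of_injOn hinj]
  have hfi : (s.image rank).filter (fun m => m < R) = (s.filter fun j => rank j < R).image rank :=
    Finset.filter_image
  calc (s.filter fun j => rank j < R).card
      = ((s.filter fun j => rank j < R).image rank).card :=
        (Finset.card_image_of_injOn (hinj.mono (Finset.coe_subset.2 (Finset.filter_subset _ _)))).symm
    _ = (Finset.range R).card := by
        rw [← hfi, himg]
        congr 1
        ext m
        simp only [Finset.mem_filter, Finset.mem_range]
        omega
    _ = R := Finset.card_range R

namespace RDSetup

variable {D : RDSetup}

open Classical in
/-- Units other than `i` on the same side of the cutoff. -/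
noncomputable def sameSide {n : ℕ} (ω : D.Sample n) (i : Fin n) : Finset (Fin n) :=
  Finset.univ.filter fun j => j ≠ i ∧ (0 ≤ X ω j ↔ 0 ≤ X ω i)

open Classical in
theorem neighbors_eq {n : ℕ} (ω : D.Sample n) (i : Fin n) :
    neighbors ω i = (sameSide ω i).filter fun j =>
      ((sameSide ω i).filter fun l => |X ω l - X ω i| < |X ω j - X ω i| ∨
        (|X ω l - X ω i| = |X ω j - X ω i| ∧ l < j)).card < D.R := rfl

theorem mem_sameSide {n : ℕ} {ω : D.Sample n} {i j : Fin n} :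
    j ∈ sameSide ω i ↔ j ≠ i ∧ (0 ≤ X ω j ↔ 0 ≤ X ω i) := by
  simp [sameSide]

theorem neighbors_subset {n : ℕ} (ω : D.Sample n) (i : Fin n) :
    neighbors ω i ⊆ sameSide ω i := by
  rw [neighbors_eq]; exact Finset.filter_subset _ _

theorem card_neighbors {n : ℕ} (ω : D.Sample n) (i : Fin n) (h : D.R ≤ (sameSide ω i).card) :
    (neighbors ω i).card = D.R := by
  classical
  -- Breaking ties by index amounts to ordering by the lexicographic key (distance, index), which is
  -- injective.
  have key := card_filter_rank_lt (sameSide ω i)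
    (fun j => (toLex (|X ω j - X ω i|, j) : ℝ ×ₗ Fin n))
    (fun a _ b _ hab => by simpa using congrArg (fun p => (ofLex p).2) hab) D.R h
  rw [neighbors_eq]
  simp only [Prod.Lex.toLex_lt_toLex] at key
  convert key

theorem abs_sub_eq_of_sameSide {x y : ℝ} (h : 0 ≤ x ↔ 0 ≤ y) : |x - y| = |(|x| - |y|)| := by
  by_cases hx : 0 ≤ x
  · rw [abs_of_nonneg hx, abs_of_nonneg (h.1 hx)]
  · have hy : ¬ 0 ≤ y := fun hy => hx (h.2 hy)
    push Not at hx hy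
    rw [abs_of_neg hx, abs_of_neg hy, ← abs_neg]
    congr 1; ring

/-- On a given side of the cutoff, at most `R` units within distance `b` of the cutoff have a
neighbour further away than `b`. -/
theorem card_le_of_far_neighbor {n : ℕ} (ω : D.Sample n) (b : ℝ) (p : Prop) (A : Finset (Fin n))
    (hA : ∀ i ∈ A, (0 ≤ X ω i ↔ p) ∧ |X ω i| ≤ b ∧ ∃ j ∈ neighbors ω i, b < |X ω j|) :
    A.card ≤ D.R := by
  classical
  rcases A.eq_empty_or_nonempty with rfl | hne
  · simp
  -- Take the member of `A` closest to the cutoff and its far neighbour j. Every other member lies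
  -- between i and j in distance from the cutoff, hence is closer to i than j is and counts towards
  -- the rank of j. That rank is below R, so `A` has at most R elements.
  obtain ⟨i, hi, hmin⟩ := A.exists_min_image (fun i => |X ω i|) hne
  obtain ⟨hip, hib, j, hj, hjb⟩ := hA i hi
  rw [neighbors_eq, Finset.mem_filter, mem_sameSide] at hj
  obtain ⟨⟨hji, hjs⟩, hrank⟩ := hj
  have hsub : A.erase i ⊆ (sameSide ω i).filter fun l => |X ω l - X ω i| < |X ω j - X ω i| ∨
        (|X ω l - X ω i| = |X ω j - X ω i| ∧ l < j) := fun l hl => by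
    obtain ⟨hli, hlA⟩ := Finset.mem_erase.1 hl
    obtain ⟨hlp, hlb, -⟩ := hA l hlA
    have hls : 0 ≤ X ω l ↔ 0 ≤ X ω i := hlp.trans hip.symm
    refine Finset.mem_filter.2 ⟨mem_sameSide.2 ⟨hli, hls⟩, Or.inl ?_⟩
    rw [abs_sub_eq_of_sameSide hls, abs_sub_eq_of_sameSide hjs,
      abs_of_nonneg (show 0 ≤ |X ω l| - |X ω i| from sub_nonneg.2 (hmin l hlA)),
      abs_of_nonneg (show 0 ≤ |X ω j| - |X ω i| by linarith)]
    linarith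
  have := Finset.card_le_card hsub
  rw [Finset.card_erase_of_mem hi] at this
  omega

/-! ### Local linear weights -/

/-- Cramer's rule for the 2 × 2 design matrix. For a singular design both sides are 0, by the
conventions for the matrix inverse and for division by zero. -/
theorem sideWeight_one_zero (k : ℝ → ℝ) {n : ℕ} (x : Fin n → ℝ) (i : Fin n) :
    sideWeight 1 0 k x i = k (x i) * ((∑ j, k (x j) * x j ^ 2) - (∑ j, k (x j) * x j) * x i) /
      ((∑ j, k (x j)) * (∑ j, k (x j) * x j ^ 2) - (∑ j, k (x j) * x j) ^ 2) := by
  set Q : Matrix (Fin 2) (Fin 2) ℝ :=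
    ∑ j, k (x j) • Matrix.vecMulVec (polyVec 1 (x j)) (polyVec 1 (x j)) with hQ
  have h00 : Q 0 0 = ∑ j, k (x j) := by
    simp [hQ, Matrix.sum_apply, Matrix.vecMulVec_apply, polyVec]
  have h01 : Q 0 1 = ∑ j, k (x j) * x j := by
    simp [hQ, Matrix.sum_apply, Matrix.vecMulVec_apply, polyVec]
  have h10 : Q 1 0 = ∑ j, k (x j) * x j := by
    simp [hQ, Matrix.sum_apply, Matrix.vecMulVec_apply, polyVec]
  have h11 : Q 1 1 = ∑ j, k (x j) * x j ^ 2 := by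
    simp [hQ, Matrix.sum_apply, Matrix.vecMulVec_apply, polyVec, sq]
  have hdet : Q.det = (∑ j, k (x j)) * (∑ j, k (x j) * x j ^ 2) - (∑ j, k (x j) * x j) ^ 2 := by
    rw [Matrix.det_fin_two, h00, h01, h10, h11]; ring
  have hw : sideWeight 1 0 k x i = (Q⁻¹.mulVec (k (x i) • polyVec 1 (x i))) 0 := rfl
  rw [hw, Matrix.inv_def, Ring.inverse_eq_inv', hdet, Matrix.adjugate_fin_two, h00, h01, h10, h11]
  simp [Matrix.mulVec, dotProduct, Fin.sum_univ_two, polyVec]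
  ring

end RDSetup

/-! ### Concentration of local sums -/

/-- Bounded measurable functions that vanish outside `[-1, 1]`. -/
structure IsLocalFun (φ : ℝ → ℝ) : Prop where
  measurable : Measurable φ
  bounded : ∃ b, ∀ u, |φ u| ≤ b
  zero : ∀ u, 1 < |u| → φ u = 0

namespace IsLocalFun

variable {φ ψ : ℝ → ℝ}

theorem mul_pow (hφ : IsLocalFun φ) (k : ℕ) : IsLocalFun fun u => φ u * u ^ k where
  measurable := hφ.measurable.mul (measurable_id.pow_const k)
  bounded := by
    obtain ⟨b, hb⟩ := hφ.bounded
    refine ⟨b, fun u => ?_⟩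
    rcases le_or_gt |u| 1 with h | h
    · rw [abs_mul, abs_pow]
      exact (mul_le_of_le_one_right (abs_nonneg _) (pow_le_one₀ (abs_nonneg u) h)).trans (hb u)
    · rw [hφ.zero u h, zero_mul, abs_zero]; exact (abs_nonneg _).trans (hb 0)
  zero := fun u hu => by rw [hφ.zero u hu, zero_mul]

theorem sq (hφ : IsLocalFun φ) : IsLocalFun fun u => φ u ^ 2 where
  measurable := hφ.measurable.pow_const 2
  bounded := by
    obtain ⟨b, hb⟩ := hφ.bounded
    exact ⟨b ^ 2, fun u => by rw [abs_pow]; exact pow_le_pow_left₀ (abs_nonneg _) (hb u) 2⟩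
  zero := fun u hu => by rw [hφ.zero u hu]; simp

theorem integrable (hφ : IsLocalFun φ) : Integrable φ := by
  obtain ⟨b, hb⟩ := hφ.bounded
  have : φ = Set.indicator (Set.Icc (-1) 1) φ := by
    funext u
    by_cases hu : u ∈ Set.Icc (-1 : ℝ) 1
    · rw [Set.indicator_of_mem hu]
    · rw [Set.indicator_of_notMem hu]
      refine hφ.zero u ?_
      by_contra h
      exact hu (abs_le.1 (not_lt.1 h))
  rw [this, integrable_indicator_iff measurableSet_Icc]
  exact Measure.integrableOn_of_bounded (M := b) (by simp) hφ.measurable.aestronglyMeasurable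
    (ae_of_all _ hb)

/-- With a = ∫ φ and b = ∫ φ u, the determinant equals a · ∫ φ(u)(u − b/a)² du, a weighted variance.
It is positive because removing the single point b/a leaves the Lebesgue measure of the support of φ
unchanged. -/
theorem moment_det_pos (hφ : IsLocalFun φ) (h0 : ∀ u, 0 ≤ φ u) (hpos : 0 < ∫ u, φ u) :
    0 < (∫ u, φ u) * (∫ u, φ u * u ^ 2) - (∫ u, φ u * u ^ 1) ^ 2 := by
  set a := ∫ u, φ u with ha
  set b := ∫ u, φ u * u ^ 1 with hb
  set c := ∫ u, φ u * u ^ 2 with hc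
  have i0 := hφ.integrable
  have i1 := (hφ.mul_pow 1).integrable
  have i2 := (hφ.mul_pow 2).integrable
  have hint : Integrable fun u => φ u * (u - b / a) ^ 2 := by
    have := (i2.sub (i1.const_mul (2 * (b / a)))).add (i0.const_mul ((b / a) ^ 2))
    refine this.congr (ae_of_all _ fun u => ?_)
    simp only [Pi.add_apply, Pi.sub_apply]; ring
  have hval : ∫ u, φ u * (u - b / a) ^ 2 = c - b ^ 2 / a := by
    have : ∀ u, φ u * (u - b / a) ^ 2
        = φ u * u ^ 2 - 2 * (b / a) * (φ u * u ^ 1) + (b / a) ^ 2 * φ u := fun u => by ring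
    simp_rw [this]
    have i12 : Integrable fun u => φ u * u ^ 2 - 2 * (b / a) * (φ u * u ^ 1) :=
      i2.sub (i1.const_mul _)
    rw [integral_add i12 (i0.const_mul _), integral_sub i2 (i1.const_mul _), integral_const_mul, integral_const_mul, ← ha, ← hb, ← hc]
    field_simp; ring
  have hp : 0 < ∫ u, φ u * (u - b / a) ^ 2 := by
    rw [integral_pos_iff_support_of_nonneg (fun u => mul_nonneg (h0 u) (sq_nonneg _)) hint]
    rw [integral_pos_iff_support_of_nonneg h0 i0] at hpos
    have hsub : Function.support φ \ {b / a} ⊆ Function.support fun u => φ u * (u - b / a) ^ 2 :=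
      fun u hu => mul_ne_zero hu.1 (pow_ne_zero 2 (sub_ne_zero.2 hu.2))
    refine lt_of_lt_of_le ?_ (measure_mono hsub)
    rwa [measure_sdiff_null (by simp)]
  rw [hval] at hp
  have := mul_pos hpos hp
  have e : a * (c - b ^ 2 / a) = a * c - b ^ 2 := by field_simp
  rwa [e] at this

end IsLocalFun

namespace RDSetup

variable {D : RDSetup}

/-- Sums of a function of the scaled running variables. -/
noncomputable def locSum (φ : ℝ → ℝ) {n : ℕ} (c : Fin n → ℝ) (ω : D.Sample n) : ℝ :=
  ∑ i, c i * φ (X ω i / D.h n)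

theorem map_fst_lawW (n : ℕ) : (D.lawW n).map Prod.fst = D.lawX := by
  have := Measure.fst_compProd D.lawX (D.cond n)
  exact this

theorem integral_lawW_fst (n : ℕ) {g : ℝ → ℝ} (hg : Measurable g) :
    ∫ w, g w.1 ∂(D.lawW n) = ∫ x, g x ∂D.lawX := by
  rw [← map_fst_lawW (D := D) n, integral_map measurable_fst.aemeasurable hg.aestronglyMeasurable]

theorem lintegral_lawW_fst (n : ℕ) {g : ℝ → ENNReal} (hg : Measurable g) :
    ∫⁻ w, g w.1 ∂(D.lawW n) = ∫⁻ x, g x ∂D.lawX := by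
  rw [← map_fst_lawW (D := D) n, lintegral_map hg measurable_fst]

/-- Second moment of a centred weighted sum over the units with weights that depend on the folds
only. -/
theorem lintegral_sq_centred_sum_le {n : ℕ} (c : (Fin n → Fin D.S) → Fin n → ℝ)
    (hc : ∀ f i, |c f i| ≤ 1) {g : ℝ → ℝ} (hg : Measurable g) {b : ℝ} (hb : ∀ x, |g x| ≤ b) :
    ∫⁻ ω, ENNReal.ofReal ((∑ i, c ω.1 i * (g (X ω i) - ∫ x, g x ∂D.lawX)) ^ 2) ∂(D.P n)
      ≤ ENNReal.ofReal (n * ∫ x, g x ^ 2 ∂D.lawX) := by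
  set m := ∫ x, g x ∂D.lawX with hm
  have ig : Integrable g D.lawX := Integrable.of_bound hg.aestronglyMeasurable b (ae_of_all _ hb)
  have ig2 : Integrable (fun x => g x ^ 2) D.lawX :=
    Integrable.of_bound (hg.pow_const 2).aestronglyMeasurable (b ^ 2) (ae_of_all _ fun x => by
      rw [Real.norm_eq_abs, abs_pow]; exact pow_le_pow_left₀ (abs_nonneg _) (hb x) 2)
  have hgm : Measurable fun x => g x - m := hg.sub_const m
  have hvar : ∫⁻ x, ENNReal.ofReal ((g x - m) ^ 2) ∂D.lawX
      ≤ ENNReal.ofReal (∫ x, g x ^ 2 ∂D.lawX) := by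
    have i2 : Integrable (fun x => (g x - m) ^ 2) D.lawX := by
      have := (ig2.sub (ig.const_mul (2 * m))).add (integrable_const (m ^ 2))
      refine this.congr (ae_of_all _ fun x => ?_)
      simp only [Pi.add_apply, Pi.sub_apply]; ring
    rw [← ofReal_integral_eq_lintegral_ofReal i2 (ae_of_all _ fun x => sq_nonneg _)]
    refine ENNReal.ofReal_le_ofReal ?_
    have : ∀ x, (g x - m) ^ 2 = g x ^ 2 - 2 * m * g x + m ^ 2 := fun x => by ring
    simp_rw [this]
    have i12 : Integrable (fun x => g x ^ 2 - 2 * m * g x) D.lawX := ig2.sub (ig.const_mul _)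
    rw [integral_add i12 (integrable_const _), integral_sub ig2 (ig.const_mul _), integral_const_mul, ← hm]
    simp only [integral_const, probReal_univ, one_smul]
    nlinarith [sq_nonneg m]
  have hmeas : Measurable fun ω : D.Sample n =>
      ENNReal.ofReal ((∑ i, c ω.1 i * (g (X ω i) - m)) ^ 2) := by
    refine ((Finset.measurable_sum _ fun i _ => Measurable.mul ?_ ?_).pow_const 2).ennreal_ofReal
    · exact (measurable_of_finite fun f : Fin n → Fin D.S => c f i).comp measurable_fst
    · exact hgm.comp (measurable_X i)
  unfold P
  rw [lintegral_prod _ hmeas.aemeasurable]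
  calc _ ≤ ∫⁻ _ : Fin n → Fin D.S, ENNReal.ofReal (n * ∫ x, g x ^ 2 ∂D.lawX) ∂D.foldLaw n := ?_
    _ = _ := by simp
  -- Once the fold assignment is fixed the coefficients are constants and the summands are
  -- independent.
  refine lintegral_mono fun f => ?_
  have hY : ∀ i : Fin n, Measurable fun w : Fin n → RDObs (D.d n) => c f i * (g (w i).1 - m) :=
    fun i => (hgm.comp (measurable_fst.comp (measurable_pi_apply i))).const_mul _
  have hind : iIndepFun (fun (i : Fin n) (w : Fin n → RDObs (D.d n)) => c f i * (g (w i).1 - m))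
      (Measure.pi fun _ : Fin n => D.lawW n) :=
    iIndepFun_pi (X := fun i (y : RDObs (D.d n)) => c f i * (g y.1 - m))
      fun i => ((hgm.comp measurable_fst).const_mul _).aemeasurable
  have hmean : ∀ i : Fin n, ∫ w, c f i * (g (w i).1 - m) ∂(Measure.pi fun _ : Fin n => D.lawW n)
      = 0 := fun i => by
    have hmp := measurePreserving_eval (fun _ : Fin n => D.lawW n) i
    have e1 : ∫ w, (g (w i).1 - m) ∂(Measure.pi fun _ : Fin n => D.lawW n)
        = ∫ y, (g y.1 - m) ∂D.lawW n := by
      conv_rhs => rw [← hmp.map_eq]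
      have hsm : AEStronglyMeasurable (fun y : RDObs (D.d n) => g y.1 - m)
          (Measure.map (Function.eval i) (Measure.pi fun _ : Fin n => D.lawW n)) :=
        (hgm.comp measurable_fst).aestronglyMeasurable
      rw [integral_map hmp.measurable.aemeasurable hsm]
    rw [integral_const_mul, e1, integral_lawW_fst n hgm, integral_sub ig (integrable_const _), ← hm]
    simp
  refine (lintegral_sum_sq_le_of_orthogonal _ Finset.univ
    (fun (i : Fin n) (w : Fin n → RDObs (D.d n)) => c f i * (g (w i).1 - m))
    (fun i _ => hY i) fun i _ j _ hij => ?_).trans ?_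
  · rw [(hind.indepFun hij).integral_fun_mul_eq_mul_integral (hY i).aestronglyMeasurable
      (hY j).aestronglyMeasurable, hmean i, zero_mul]
  · have : ∀ i ∈ (Finset.univ : Finset (Fin n)), ∫⁻ w, ENNReal.ofReal ((c f i * (g (w i).1 - m)) ^ 2)
        ∂(Measure.pi fun _ : Fin n => D.lawW n) ≤ ENNReal.ofReal (∫ x, g x ^ 2 ∂D.lawX) :=
      fun i _ => by
      have hmp := measurePreserving_eval (fun _ : Fin n => D.lawW n) i
      have hm2 : Measurable fun x => ENNReal.ofReal ((g x - m) ^ 2) :=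
        (hgm.pow_const 2).ennreal_ofReal
      calc _ ≤ ∫⁻ w, ENNReal.ofReal ((g (w i).1 - m) ^ 2)
            ∂(Measure.pi fun _ : Fin n => D.lawW n) := by
            refine lintegral_mono fun w => ENNReal.ofReal_le_ofReal ?_
            rw [_root_.mul_pow]
            refine mul_le_of_le_one_left (sq_nonneg _) ?_
            rw [← sq_abs]
            exact pow_le_one₀ (abs_nonneg _) (hc f i)
        _ = ∫⁻ y, ENNReal.ofReal ((g y.1 - m) ^ 2) ∂D.lawW n :=
            hmp.lintegral_comp (f := fun y : RDObs (D.d n) => ENNReal.ofReal ((g y.1 - m) ^ 2))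
              (hm2.comp measurable_fst)
        _ = _ := lintegral_lawW_fst n hm2
        _ ≤ _ := hvar
    refine (Finset.sum_le_sum this).trans ?_
    rw [Finset.sum_const, Finset.card_univ, Fintype.card_fin, nsmul_eq_mul,
      ENNReal.ofReal_mul (by positivity), ENNReal.ofReal_natCast]

/-- The running variable has a positive density near the cutoff that is continuous at it. -/
theorem DesignRegularity.exists_density_limit (hD : D.DesignRegularity) :
    ∃ f₀ δ : ℝ, 0 < f₀ ∧ 0 < δ ∧ Set.Ioo (-δ) δ ⊆ D.suppX ∧ D.lawX {0} = 0 ∧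
      ∀ φ : ℝ → ℝ, IsLocalFun φ →
        Tendsto (fun n => (D.h n)⁻¹ * ∫ x, φ (x / D.h n) ∂D.lawX) atTop (𝓝 (f₀ * ∫ u, φ u)) := by
  obtain ⟨f, hf, hf0, hlaw, δ, c, hδ, hc, hcont, hlow⟩ := hD.density
  have h0mem : (0 : ℝ) ∈ Set.Ioo (-δ) δ := ⟨by linarith, hδ⟩
  refine ⟨f 0, δ, hc.trans_le (hlow 0 h0mem), hδ, ?_, ?_, ?_⟩
  · intro x hx
    unfold suppX
    rw [Measure.mem_support_iff_forall]
    intro U hU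
    have hV : U ∩ Set.Ioo (-δ) δ ∈ 𝓝 x := inter_mem hU (isOpen_Ioo.mem_nhds hx)
    obtain ⟨V, hVsub, hVo, hxV⟩ := mem_nhds_iff.1 hV
    have hVpos : 0 < (volume : Measure ℝ) V := hVo.measure_pos _ ⟨x, hxV⟩
    refine lt_of_lt_of_le ?_ (measure_mono (hVsub.trans Set.inter_subset_left))
    rw [hlaw, withDensity_apply _ hVo.measurableSet]
    calc (0 : ENNReal) < ENNReal.ofReal c * volume V :=
          ENNReal.mul_pos (by simpa using hc) hVpos.ne'
      _ = ∫⁻ _ in V, ENNReal.ofReal c := by simp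
      _ ≤ _ := setLIntegral_mono (by fun_prop) fun y hy =>
          ENNReal.ofReal_le_ofReal (hlow y (hVsub hy).2)
  · rw [hlaw]
    exact withDensity_absolutelyContinuous _ _ (by simp)
  · intro φ hφ
    have e : ∀ n, (D.h n)⁻¹ * ∫ x, φ (x / D.h n) ∂D.lawX = ∫ u, φ u * f (D.h n * u) := fun n => by
      have hh := hD.h_pos n
      have e1 : ∫ x, φ (x / D.h n) ∂D.lawX = ∫ x, f x * φ (x / D.h n) := by
        rw [hlaw, integral_withDensity_eq_integral_toReal_smul (by fun_prop)
          (ae_of_all _ fun _ => ENNReal.ofReal_lt_top)]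
        refine integral_congr_ae (ae_of_all _ fun x => ?_)
        simp [ENNReal.toReal_ofReal (hf0 x)]
      have e2 := Measure.integral_comp_div (fun u => φ u * f (D.h n * u)) (D.h n)
      rw [e1, abs_of_pos hh] at *
      rw [smul_eq_mul] at e2
      have e3 : ∫ x, f x * φ (x / D.h n) = ∫ x, φ (x / D.h n) * f (D.h n * (x / D.h n)) := by
        refine integral_congr_ae (ae_of_all _ fun x => ?_)
        simp only
        rw [mul_div_cancel₀ _ hh.ne', mul_comm]
      rw [e3, e2, ← mul_assoc, inv_mul_cancel₀ hh.ne', one_mul]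
    simp_rw [e]
    obtain ⟨ρ, hρ, hρb⟩ := Metric.continuousAt_iff.1 (hcont.continuousAt
      (isOpen_Ioo.mem_nhds h0mem)) 1 one_pos
    have hlim : f 0 * ∫ u, φ u = ∫ u, φ u * f 0 := by rw [integral_mul_const, mul_comm]
    rw [hlim]
    -- After the substitution u = x/h only the values of the density on [−h, h] matter, since φ
    -- vanishes off [−1, 1]. Eventually they are below |f 0| + 1 by continuity at 0.
    refine tendsto_integral_filter_of_dominated_convergence (fun u => |φ u| * (|f 0| + 1)) ?_ ?_ ?_ ?_
    · exact Eventually.of_forall fun n =>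
        (hφ.measurable.mul (hf.comp (measurable_id.const_mul _))).aestronglyMeasurable
    · filter_upwards [hD.h_tendsto.eventually (gt_mem_nhds hρ)] with n hn
      refine ae_of_all _ fun u => ?_
      rw [norm_mul, Real.norm_eq_abs, Real.norm_eq_abs]
      rcases le_or_gt |u| 1 with hu | hu
      · refine mul_le_mul_of_nonneg_left ?_ (abs_nonneg _)
        have h1 : dist (D.h n * u) 0 < ρ := by
          rw [dist_zero_right, Real.norm_eq_abs, abs_mul, abs_of_pos (hD.h_pos n)]
          exact (mul_le_of_le_one_right (hD.h_pos n).le hu).trans_lt hn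
        have h2 := hρb h1
        rw [Real.dist_eq] at h2
        have h3 := abs_sub_abs_le_abs_sub (f (D.h n * u)) (f 0)
        linarith
      · rw [hφ.zero u hu]; simp
    · exact hφ.integrable.abs.mul_const _
    · refine ae_of_all _ fun u => Tendsto.const_mul _ ?_
      have h1 : Tendsto (fun n => D.h n * u) atTop (𝓝 0) := by
        simpa using hD.h_tendsto.mul_const u
      exact (hcont.continuousAt (isOpen_Ioo.mem_nhds h0mem)).tendsto.comp h1

/-- The variance of the sum is at most n E φ(X/h)², which is O(nh); any normalisation with a_n² nh →
0 therefore suffices. -/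
theorem DesignRegularity.isLittleOP_centred (hD : D.DesignRegularity) {φ : ℝ → ℝ}
    (hφ : IsLocalFun φ) (c : ∀ n, (Fin n → Fin D.S) → Fin n → ℝ) (hc : ∀ n f i, |c n f i| ≤ 1)
    {a : ℕ → ℝ} (ha : Tendsto (fun n => a n ^ 2 * (n * D.h n)) atTop (𝓝 0)) :
    D.IsLittleOP fun n ω => a n * ∑ i, c n ω.1 i *
      (φ (X ω i / D.h n) - ∫ x, φ (x / D.h n) ∂D.lawX) := by
  obtain ⟨f₀, δ, -, -, -, -, hlim⟩ := hD.exists_density_limit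
  obtain ⟨b, hb⟩ := hφ.bounded
  have hφn : ∀ n, Measurable fun x => φ (x / D.h n) := fun n =>
    hφ.measurable.comp (measurable_id.div_const _)
  refine IsLittleOP.of_lintegral_sq (β := fun n => a n ^ 2 * (n * D.h n) *
    ((D.h n)⁻¹ * ∫ x, φ (x / D.h n) ^ 2 ∂D.lawX)) (fun n => ?_) ?_ ?_
  · refine (Finset.measurable_sum _ fun i _ => Measurable.mul ?_ ?_).const_mul _
    · exact (measurable_of_finite fun f : Fin n → Fin D.S => c n f i).comp measurable_fst
    · exact ((hφn n).comp (measurable_X i)).sub_const _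
  · simpa using ha.mul (hlim _ hφ.sq)
  · refine Eventually.of_forall fun n => ?_
    have h1 := lintegral_sq_centred_sum_le (D := D) (c n) (hc n) (hφn n) (b := b) fun x => hb _
    have e : ∀ ω : D.Sample n, ENNReal.ofReal ((a n * ∑ i, c n ω.1 i *
        (φ (X ω i / D.h n) - ∫ x, φ (x / D.h n) ∂D.lawX)) ^ 2) = ENNReal.ofReal (a n ^ 2) *
        ENNReal.ofReal ((∑ i, c n ω.1 i *
        (φ (X ω i / D.h n) - ∫ x, φ (x / D.h n) ∂D.lawX)) ^ 2) := fun ω => by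
      rw [_root_.mul_pow, ENNReal.ofReal_mul (sq_nonneg _)]
    simp_rw [e]
    rw [lintegral_const_mul' _ _ ENNReal.ofReal_ne_top]
    have hh := (hD.h_pos n).ne'
    have e2 : a n ^ 2 * (n * D.h n) * ((D.h n)⁻¹ * ∫ x, φ (x / D.h n) ^ 2 ∂D.lawX)
        = a n ^ 2 * (n * ∫ x, φ (x / D.h n) ^ 2 ∂D.lawX) := by field_simp
    rw [e2, ENNReal.ofReal_mul (sq_nonneg _)]
    gcongr

theorem DesignRegularity.inv_nh_tendsto (hD : D.DesignRegularity) :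
    Tendsto (fun n : ℕ => ((n : ℝ) * D.h n)⁻¹) atTop (𝓝 0) :=
  tendsto_inv_atTop_zero.comp hD.nh_tendsto

/-- Law of large numbers at the local scale: the fluctuation is handled with a_n = 1/(nh), and the
mean converges by continuity of the density at the cutoff. -/
theorem DesignRegularity.isLittleOP_locSum_sub (hD : D.DesignRegularity) :
    ∃ f₀ : ℝ, 0 < f₀ ∧ ∀ φ : ℝ → ℝ, IsLocalFun φ →
      D.IsLittleOP fun n ω => ((n : ℝ) * D.h n)⁻¹ * locSum φ 1 ω - f₀ * ∫ u, φ u := by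
  obtain ⟨f₀, δ, hf₀, -, -, -, hlim⟩ := hD.exists_density_limit
  refine ⟨f₀, hf₀, fun φ hφ => ?_⟩
  have h1 := hD.isLittleOP_centred hφ (fun n _ _ => 1) (by simp)
    (a := fun n => ((n : ℝ) * D.h n)⁻¹) (by
      refine hD.inv_nh_tendsto.congr' ?_
      filter_upwards [hD.nh_tendsto.eventually_gt_atTop 0] with n hn
      field_simp)
  have h2 : Tendsto (fun n => (D.h n)⁻¹ * ∫ x, φ (x / D.h n) ∂D.lawX - f₀ * ∫ u, φ u) atTop (𝓝 0) := by
    simpa using (hlim φ hφ).sub_const (f₀ * ∫ u, φ u)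
  refine (h1.add (IsLittleOP.of_tendsto h2)).mono (WHP.of_eventually ?_)
  filter_upwards [hD.nh_tendsto.eventually_gt_atTop 0] with n hn ω
  have hh := (hD.h_pos n).ne'
  have hn' : (n : ℝ) ≠ 0 := fun h => by rw [h] at hn; simp at hn
  refine le_of_eq ?_
  congr 1
  simp only [locSum, Pi.one_apply, one_mul, Finset.sum_sub_distrib, Finset.sum_const,
    Finset.card_univ, Fintype.card_fin, nsmul_eq_mul]
  field_simp
  ring

/-- Sums with fold-dependent weights that add up to zero. -/
theorem DesignRegularity.isLittleOP_locSum_of_sum_eq_zero (hD : D.DesignRegularity) {φ : ℝ → ℝ}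
    (hφ : IsLocalFun φ) (c : ∀ n, (Fin n → Fin D.S) → Fin n → ℝ) (hc : ∀ n f i, |c n f i| ≤ 1)
    (hc0 : ∀ n f, ∑ i, c n f i = 0) {r : ℕ → ℝ} (hr : Tendsto r atTop (𝓝 0)) :
    D.IsLittleOP fun n ω => r n * √((n : ℝ) * D.h n) *
      (((n : ℝ) * D.h n)⁻¹ * locSum φ (c n ω.1) ω) := by
  have h1 := hD.isLittleOP_centred hφ c hc
    (a := fun n => r n * √((n : ℝ) * D.h n) * ((n : ℝ) * D.h n)⁻¹) (by
      have : Tendsto (fun n => r n ^ 2) atTop (𝓝 0) := by simpa using hr.pow 2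
      refine this.congr' ?_
      filter_upwards [hD.nh_tendsto.eventually_gt_atTop 0] with n hn
      rw [_root_.mul_pow, _root_.mul_pow, Real.sq_sqrt hn.le, inv_pow]
      have := hn.ne'
      generalize (n : ℝ) * D.h n = N at this
      field_simp)
  -- Because the coefficients add up to zero, centring φ leaves the sum unchanged, so its
  -- non-vanishing mean never appears.
  refine h1.mono (WHP.of_eventually (Eventually.of_forall fun n ω => ?_))
  refine le_of_eq ?_
  congr 1
  simp only [locSum, mul_sub, Finset.sum_sub_distrib, ← Finset.sum_mul, hc0]
  ring

end RDSetup

/-! ### Scaled local linear weights and regular designs -/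

namespace RDSetup

open Classical in
/-- The part of the kernel on one side of the cutoff. -/
noncomputable def kernelSide (D : RDSetup) (plus : Bool) (u : ℝ) : ℝ :=
  if (0 ≤ u ↔ plus = true) then D.K u else 0

variable {D : RDSetup}

theorem kernelSide_nonneg (hD : D.DesignRegularity) (b : Bool) (u : ℝ) :
    0 ≤ kernelSide D b u := by
  unfold kernelSide; split_ifs
  · exact hD.K_nonneg u
  · exact le_rfl

theorem isLocalFun_kernelSide (hD : D.DesignRegularity) (b : Bool) :
    IsLocalFun (kernelSide D b) where
  measurable := by
    unfold kernelSide
    refine Measurable.ite ?_ hD.K_measurable measurable_const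
    have e : {u : ℝ | 0 ≤ u ↔ b = true} = if b = true then Set.Ici 0 else Set.Iio 0 := by
      ext u; cases b <;> simp
    rw [e]
    split_ifs
    exacts [measurableSet_Ici, measurableSet_Iio]
  bounded := by
    obtain ⟨c, hc⟩ := hD.K_bounded
    refine ⟨c, fun u => ?_⟩
    rw [abs_of_nonneg (kernelSide_nonneg hD b u)]
    unfold kernelSide; split_ifs
    · exact hc u
    · exact (hD.K_nonneg u).trans (hc u)
  zero := fun u hu => by unfold kernelSide; rw [hD.K_zero u hu, ite_self]

/-- By symmetry of the kernel, and since {0} is a null set, the two halves have equal mass, hence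
1/2 each. -/
theorem kernelSide_integral_pos (hD : D.DesignRegularity) (b : Bool) :
    0 < ∫ u, kernelSide D b u := by
  have hsum : ∀ u, D.K u = kernelSide D true u + kernelSide D false u := fun u => by
    unfold kernelSide; by_cases h : 0 ≤ u <;> simp [h]
  have it := (isLocalFun_kernelSide hD true).integrable
  have iff' := (isLocalFun_kernelSide hD false).integrable
  have h1 : ∫ u, kernelSide D true u + kernelSide D false u = 1 := by
    rw [← hD.K_integral]; exact integral_congr_ae (ae_of_all _ fun u => (hsum u).symm)
  rw [integral_add it iff'] at h1
  have h2 : ∫ u, kernelSide D true u = ∫ u, kernelSide D false u := by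
    rw [← integral_neg_eq_self (fun u => kernelSide D false u)]
    refine integral_congr_ae ?_
    have h0 : ∀ᵐ u : ℝ, u ≠ 0 := by simp [ae_iff]
    filter_upwards [h0] with u hu
    unfold kernelSide
    rcases lt_or_gt_of_ne hu with h | h
    · simp [h, h.le]
    · simp [h.le, h, hD.K_symm]
  cases b <;> linarith

/-- Scaled empirical moments `(n h)⁻¹ ∑ φ(X_i / h) (X_i / h) ^ k`. -/
noncomputable def scaledMoment (φ : ℝ → ℝ) (k : ℕ) {n : ℕ} (ω : D.Sample n) : ℝ :=
  ((n : ℝ) * D.h n)⁻¹ * locSum (fun u => φ u * u ^ k) 1 ω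

/-- Determinant of the scaled design matrix. -/
noncomputable def momentDet (φ : ℝ → ℝ) {n : ℕ} (ω : D.Sample n) : ℝ :=
  scaledMoment φ 0 ω * scaledMoment φ 2 ω - scaledMoment φ 1 ω ^ 2

/-- Local linear weight of a unit, in scaled form. -/
noncomputable def scaledWeight (φ : ℝ → ℝ) {n : ℕ} (ω : D.Sample n) (i : Fin n) : ℝ :=
  ((n : ℝ) * D.h n)⁻¹ * φ (X ω i / D.h n) *
    (scaledMoment φ 2 ω - scaledMoment φ 1 ω * (X ω i / D.h n)) / momentDet φ ω

/-- Writing the moments in terms of X/h makes all powers of h cancel by homogeneity. If the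
determinant vanishes, both sides are 0 through division by zero. -/
theorem sideWeight_eq_scaledWeight (φ : ℝ → ℝ) {n : ℕ} (hn : 0 < (n : ℝ) * D.h n)
    (hh : 0 < D.h n) (ω : D.Sample n) (i : Fin n) :
    sideWeight 1 0 (fun x => φ (x / D.h n) / D.h n) (X ω) i = scaledWeight φ ω i := by
  have hn0 : (n : ℝ) ≠ 0 := fun h => by rw [h, zero_mul] at hn; exact lt_irrefl _ hn
  have hh0 := hh.ne'
  have key : ∀ k : ℕ, ∑ j, φ (X ω j / D.h n) / D.h n * X ω j ^ k
      = n * D.h n ^ k * scaledMoment φ k ω := fun k => by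
    unfold scaledMoment locSum
    rw [Finset.mul_sum, Finset.mul_sum]
    refine Finset.sum_congr rfl fun j _ => ?_
    simp only [Pi.one_apply, div_pow]
    field_simp
  have k0 := key 0
  have k1 := key 1
  have k2 := key 2
  simp only [pow_zero, mul_one] at k0
  simp only [pow_one] at k1
  rw [sideWeight_one_zero, k0, k1, k2]
  unfold scaledWeight momentDet
  by_cases hdet : scaledMoment φ 0 ω * scaledMoment φ 2 ω - scaledMoment φ 1 ω ^ 2 = 0
  · rw [hdet, div_zero]
    have : n * scaledMoment φ 0 ω * (n * D.h n ^ 2 * scaledMoment φ 2 ω)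
        - (n * D.h n * scaledMoment φ 1 ω) ^ 2 = 0 := by
      linear_combination (n : ℝ) ^ 2 * D.h n ^ 2 * hdet
    rw [this, div_zero]
  · have : n * scaledMoment φ 0 ω * (n * D.h n ^ 2 * scaledMoment φ 2 ω)
        - (n * D.h n * scaledMoment φ 1 ω) ^ 2 = n ^ 2 * D.h n ^ 2 *
          (scaledMoment φ 0 ω * scaledMoment φ 2 ω - scaledMoment φ 1 ω ^ 2) := by ring
    rw [this]
    field_simp

theorem weight_eq (hD : D.DesignRegularity) {n : ℕ} (hn : 0 < (n : ℝ) * D.h n)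
    (ω : D.Sample n) (i : Fin n) :
    weight 1 0 ω i = scaledWeight (kernelSide D true) ω i - scaledWeight (kernelSide D false) ω i := by
  have hh := hD.h_pos n
  rw [← sideWeight_eq_scaledWeight _ hn hh, ← sideWeight_eq_scaledWeight _ hn hh]
  have hp : D.KPlus n = fun x => kernelSide D true (x / D.h n) / D.h n := by
    funext x
    unfold KPlus kernelSide
    by_cases hx : 0 ≤ x
    · have : 0 ≤ x / D.h n := div_nonneg hx hh.le
      simp [hx, this]
    · have : ¬ 0 ≤ x / D.h n := not_le.2 (div_neg_of_neg_of_pos (not_le.1 hx) hh)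
      simp only [hx, this]; simp
  have hm : D.KMinus n = fun x => kernelSide D false (x / D.h n) / D.h n := by
    funext x
    unfold KMinus kernelSide
    by_cases hx : 0 ≤ x
    · have : 0 ≤ x / D.h n := div_nonneg hx hh.le
      simp [hx.not_gt, this]
    · have : ¬ 0 ≤ x / D.h n := not_le.2 (div_neg_of_neg_of_pos (not_le.1 hx) hh)
      simp only [not_le.1 hx, this]; simp
  unfold weight
  rw [hp, hm]

/-- Reduces weighted sums with arbitrary coefficients to local sums. Unit coefficients give the
reproduction of constants and lines; fold-dependent ones give the balance of the weights across
folds. -/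
theorem sum_scaledWeight (φ : ℝ → ℝ) {n : ℕ} (ω : D.Sample n) (c : Fin n → ℝ) (m : ℕ) :
    ∑ i, c i * scaledWeight φ ω i * (X ω i / D.h n) ^ m
      = (scaledMoment φ 2 ω * (((n : ℝ) * D.h n)⁻¹ * locSum (fun u => φ u * u ^ m) c ω)
        - scaledMoment φ 1 ω * (((n : ℝ) * D.h n)⁻¹ * locSum (fun u => φ u * u ^ (m + 1)) c ω))
          / momentDet φ ω := by
  unfold locSum
  rw [Finset.mul_sum, Finset.mul_sum, Finset.mul_sum, Finset.mul_sum, ← Finset.sum_sub_distrib,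
    Finset.sum_div]
  refine Finset.sum_congr rfl fun i _ => ?_
  unfold scaledWeight
  simp only [pow_succ]
  ring

theorem sum_scaledWeight_one (φ : ℝ → ℝ) {n : ℕ} (ω : D.Sample n) (h : momentDet φ ω ≠ 0) :
    ∑ i, scaledWeight φ ω i = 1 := by
  have := sum_scaledWeight φ ω 1 0
  simp only [Pi.one_apply, one_mul, pow_zero, mul_one] at this
  rw [this]
  have e0 : ((n : ℝ) * D.h n)⁻¹ * locSum (fun u => φ u) 1 ω = scaledMoment φ 0 ω := by
    simp [scaledMoment]
  have e1 : ((n : ℝ) * D.h n)⁻¹ * locSum (fun u => φ u * u ^ (0 + 1)) 1 ω = scaledMoment φ 1 ω := rfl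
  rw [e0, e1, div_eq_one_iff_eq h, momentDet]; ring

theorem sum_scaledWeight_mul (φ : ℝ → ℝ) {n : ℕ} (ω : D.Sample n) :
    ∑ i, scaledWeight φ ω i * (X ω i / D.h n) = 0 := by
  have := sum_scaledWeight φ ω 1 1
  simp only [Pi.one_apply, one_mul] at this
  rw [show ∑ i, scaledWeight φ ω i * (X ω i / D.h n)
    = ∑ i, scaledWeight φ ω i * (X ω i / D.h n) ^ 1 by simp, this]
  have e0 : ((n : ℝ) * D.h n)⁻¹ * locSum (fun u => φ u * u ^ 1) 1 ω = scaledMoment φ 1 ω := rfl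
  have e1 : ((n : ℝ) * D.h n)⁻¹ * locSum (fun u => φ u * u ^ (1 + 1)) 1 ω = scaledMoment φ 2 ω := rfl
  rw [e0, e1, mul_comm, sub_self, zero_div]

/-- The scaled design matrix is bounded and bounded away from singularity. -/
def SideOK (φ : ℝ → ℝ) (m d : ℝ) {n : ℕ} (ω : D.Sample n) : Prop :=
  |scaledMoment φ 1 ω| ≤ m ∧ |scaledMoment φ 2 ω| ≤ m ∧ d ≤ momentDet φ ω

/-- The empirical moments converge to f₀ ∫ φ u^k. The limiting determinant is f₀² times the positive
one of `IsLocalFun.moment_det_pos`, so by continuity the empirical determinant exceeds half of it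
with high probability. -/
theorem exists_sideOK (hD : D.DesignRegularity) (b : Bool) :
    ∃ m d : ℝ, 0 < d ∧ 0 < m ∧ D.WHP fun _ ω => SideOK (kernelSide D b) m d ω := by
  obtain ⟨f₀, hf₀, hlim⟩ := hD.isLittleOP_locSum_sub
  set φ := kernelSide D b with hφdef
  have hφ := isLocalFun_kernelSide hD b
  have hdet := hφ.moment_det_pos (kernelSide_nonneg hD b) (kernelSide_integral_pos hD b)
  set κ : ℕ → ℝ := fun k => f₀ * ∫ u, φ u * u ^ k with hκ
  have hd : 0 < κ 0 * κ 2 - κ 1 ^ 2 := by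
    have : κ 0 * κ 2 - κ 1 ^ 2 = f₀ ^ 2 * ((∫ u, φ u) * (∫ u, φ u * u ^ 2)
        - (∫ u, φ u * u ^ 1) ^ 2) := by simp only [hκ, pow_zero, mul_one]; ring
    rw [this]; positivity
  have hc : Continuous fun p : ℝ × ℝ × ℝ => p.1 * p.2.2 - p.2.1 ^ 2 := by fun_prop
  have hev : ∀ᶠ p : ℝ × ℝ × ℝ in 𝓝 (κ 0, κ 1, κ 2),
      (κ 0 * κ 2 - κ 1 ^ 2) / 2 < p.1 * p.2.2 - p.2.1 ^ 2 :=
    (hc.tendsto (κ 0, κ 1, κ 2)).eventually (lt_mem_nhds (by simp only; linarith))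
  obtain ⟨ρ, hρ, hball⟩ := Metric.eventually_nhds_iff.1 hev
  have hw : ∀ k, D.WHP fun n ω => |scaledMoment φ k ω - κ k| < min ρ 1 := fun k =>
    (hlim _ (hφ.mul_pow k)).whp (lt_min hρ one_pos)
  refine ⟨|κ 1| + |κ 2| + 1, (κ 0 * κ 2 - κ 1 ^ 2) / 2, by linarith, by positivity,
    ((hw 0).and ((hw 1).and (hw 2))).mono (Eventually.of_forall fun n ω hω => ?_)⟩
  obtain ⟨h0, h1, h2⟩ := hω
  have b1 := abs_sub_abs_le_abs_sub (scaledMoment φ 1 ω) (κ 1)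
  have b2 := abs_sub_abs_le_abs_sub (scaledMoment φ 2 ω) (κ 2)
  have a1 := abs_nonneg (κ 1)
  have a2 := abs_nonneg (κ 2)
  rw [lt_min_iff] at h0 h1 h2
  refine ⟨by linarith, by linarith, ?_⟩
  have := hball (y := (scaledMoment φ 0 ω, scaledMoment φ 1 ω, scaledMoment φ 2 ω)) (by
    rw [Prod.dist_eq, Prod.dist_eq]
    simp only [Real.dist_eq]
    exact max_lt h0.1 (max_lt h1.1 h2.1))
  exact this.le

theorem scaledWeight_zero_of_gt {φ : ℝ → ℝ} (hφ : IsLocalFun φ) {n : ℕ} (hh : 0 < D.h n)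
    (ω : D.Sample n) (i : Fin n) (hi : D.h n < |X ω i|) : scaledWeight φ ω i = 0 := by
  have : 1 < |X ω i / D.h n| := by rwa [abs_div, abs_of_pos hh, one_lt_div hh]
  simp [scaledWeight, hφ.zero _ this]

theorem abs_scaledWeight_le {φ : ℝ → ℝ} (hφ : IsLocalFun φ) {b : ℝ} (hb : ∀ u, |φ u| ≤ b)
    {n : ℕ} (hh : 0 < D.h n) {ω : D.Sample n} {m d : ℝ} (hm : 0 ≤ m) (hd : 0 < d)
    (hok : SideOK φ m d ω) (i : Fin n) :
    |scaledWeight φ ω i| ≤ b * (2 * m) / d / ((n : ℝ) * D.h n) := by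
  have hb0 : 0 ≤ b := (abs_nonneg _).trans (hb 0)
  rcases le_or_gt |X ω i| (D.h n) with hi | hi
  · have hu : |X ω i / D.h n| ≤ 1 := by rwa [abs_div, abs_of_pos hh, div_le_one hh]
    unfold scaledWeight
    rw [abs_div, abs_mul, abs_mul, abs_inv, abs_of_nonneg (show 0 ≤ (n : ℝ) * D.h n by positivity),
      abs_of_pos (hd.trans_le hok.2.2)]
    have h2 : |scaledMoment φ 2 ω - scaledMoment φ 1 ω * (X ω i / D.h n)| ≤ 2 * m := by
      refine (abs_sub _ _).trans ?_
      rw [abs_mul]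
      have := mul_le_mul hok.1 hu (abs_nonneg _) hm
      linarith [hok.2.1]
    calc _ ≤ ((n : ℝ) * D.h n)⁻¹ * b * (2 * m) / d := by
          have := hb (X ω i / D.h n)
          have h3 := hok.2.2
          gcongr
      _ = _ := by rw [div_eq_mul_inv _ ((n : ℝ) * D.h n)]; ring
  · rw [scaledWeight_zero_of_gt hφ hh ω i hi, abs_zero]; positivity

open Classical in
/-- A realisation of the running variables for which the local linear weights are well behaved. -/
structure GoodDesign (A : ℝ) {n : ℕ} (ω : D.Sample n) : Prop where
  ne_zero : ∀ i, X ω i ≠ 0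
  abs_le : ∀ i, |weight 1 0 ω i| ≤ A / ((n : ℝ) * D.h n)
  eq_zero : ∀ i, D.h n < |X ω i| → weight 1 0 ω i = 0
  count : (∑ i, if |X ω i| ≤ D.h n then (1 : ℝ) else 0) ≤ A * ((n : ℝ) * D.h n)
  sum_plus : (∑ i, if 0 ≤ X ω i then weight 1 0 ω i else 0) = 1
  sum_plus_mul : (∑ i, if 0 ≤ X ω i then weight 1 0 ω i * X ω i else 0) = 0
  sum_minus : (∑ i, if 0 ≤ X ω i then 0 else weight 1 0 ω i) = -1
  sum_minus_mul : (∑ i, if 0 ≤ X ω i then 0 else weight 1 0 ω i * X ω i) = 0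

theorem scaledWeight_side {n : ℕ} (hh : 0 < D.h n) (ω : D.Sample n) (i : Fin n) (b : Bool)
    (hb : ¬ (0 ≤ X ω i ↔ b = true)) : scaledWeight (kernelSide D b) ω i = 0 := by
  have : ¬ (0 ≤ X ω i / D.h n ↔ b = true) := by
    rwa [show (0 ≤ X ω i / D.h n) ↔ 0 ≤ X ω i by rw [le_div_iff₀ hh, zero_mul]]
  simp [scaledWeight, kernelSide, this]

theorem ae_X_ne_zero (hD : D.DesignRegularity) (n : ℕ) :
    ∀ᵐ ω ∂(D.P n), ∀ i, X ω i ≠ 0 := by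
  obtain ⟨-, -, -, -, -, h0, -⟩ := hD.exists_density_limit
  rw [ae_all_iff]
  intro i
  have h1 : ∀ᵐ w ∂(Measure.pi fun _ : Fin n => D.lawW n), (w i).1 ≠ 0 := by
    refine (measurePreserving_eval (fun _ : Fin n => D.lawW n) i).quasiMeasurePreserving.ae
      (p := fun y => y.1 ≠ 0) ?_
    have h2 : ∀ᵐ x ∂((D.lawW n).map Prod.fst), x ≠ 0 := by
      rw [map_fst_lawW, ae_iff]; simpa using h0
    exact ae_of_ae_map measurable_fst.aemeasurable h2
  unfold P
  exact Measure.quasiMeasurePreserving_snd.ae h1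

theorem exists_goodDesign (hD : D.DesignRegularity) :
    ∃ A : ℝ, 0 < A ∧ D.WHP fun _ ω => GoodDesign A ω := by
  obtain ⟨m₁, d₁, hd₁, hm₁, h₁⟩ := exists_sideOK hD true
  obtain ⟨m₂, d₂, hd₂, hm₂, h₂⟩ := exists_sideOK hD false
  obtain ⟨f₀, hf₀, hlim⟩ := hD.isLittleOP_locSum_sub
  have hφ₁ := isLocalFun_kernelSide hD true
  have hφ₂ := isLocalFun_kernelSide hD false
  obtain ⟨b₁, hb₁⟩ := hφ₁.bounded
  obtain ⟨b₂, hb₂⟩ := hφ₂.bounded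
  have hb₁0 : 0 ≤ b₁ := (abs_nonneg _).trans (hb₁ 0)
  have hb₂0 : 0 ≤ b₂ := (abs_nonneg _).trans (hb₂ 0)
  classical
  set ind : ℝ → ℝ := fun u => if |u| ≤ 1 then 1 else 0 with hind
  have hindl : IsLocalFun ind :=
    { measurable := Measurable.ite (measurableSet_le measurable_norm measurable_const)
        measurable_const measurable_const
      bounded := ⟨1, fun u => by simp only [hind]; split_ifs <;> simp⟩
      zero := fun u hu => by simp [hind, not_le.2 hu] }
  have hcount := (hlim ind hindl).whp one_pos
  set c₀ := f₀ * ∫ u, ind u with hc₀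
  -- A single constant serves all bounds: the first two summands control the weights on either side,
  -- and |c₀| + 1 controls the number of units in the window.
  refine ⟨b₁ * (2 * m₁) / d₁ + b₂ * (2 * m₂) / d₂ + |c₀| + 1, by positivity,
    ((h₁.and h₂).and (hcount.and (WHP.of_ae (Eventually.of_forall fun n => ae_X_ne_zero hD n)))).mono
      ?_⟩
  filter_upwards [hD.nh_tendsto.eventually_gt_atTop 0] with n hn ω hω
  obtain ⟨⟨ok₁, ok₂⟩, hcnt, hne⟩ := hω
  have hh := hD.h_pos n
  have hw := weight_eq hD hn ω
  have w₁ := fun i => abs_scaledWeight_le hφ₁ hb₁ hh hm₁.le hd₁ ok₁ i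
  have w₂ := fun i => abs_scaledWeight_le hφ₂ hb₂ hh hm₂.le hd₂ ok₂ i
  have hdet₁ : momentDet (kernelSide D true) ω ≠ 0 := (hd₁.trans_le ok₁.2.2).ne'
  have hdet₂ : momentDet (kernelSide D false) ω ≠ 0 := (hd₂.trans_le ok₂.2.2).ne'
  have hs₁ : ∀ i, (if 0 ≤ X ω i then weight 1 0 ω i else 0) = scaledWeight (kernelSide D true) ω i :=
    fun i => by
    split_ifs with hi
    · rw [hw, scaledWeight_side hh ω i false (by simp [hi]), sub_zero]
    · rw [scaledWeight_side hh ω i true (by simpa using hi)]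
  have hs₂ : ∀ i, (if 0 ≤ X ω i then 0 else weight 1 0 ω i) = -scaledWeight (kernelSide D false) ω i :=
    fun i => by
    split_ifs with hi
    · rw [scaledWeight_side hh ω i false (by simp [hi]), neg_zero]
    · rw [hw, scaledWeight_side hh ω i true (by simpa using hi), zero_sub]
  have hx : ∀ (φ : ℝ → ℝ) i, scaledWeight φ ω i * X ω i
      = D.h n * (scaledWeight φ ω i * (X ω i / D.h n)) := fun φ i => by field_simp
  refine ⟨hne, fun i => ?_, fun i hi => ?_, ?_, ?_, ?_, ?_, ?_⟩
  · rw [hw, add_div, add_div, add_div]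
    refine (abs_sub _ _).trans ?_
    have : 0 ≤ |c₀| / ((n : ℝ) * D.h n) := by positivity
    have : 0 ≤ 1 / ((n : ℝ) * D.h n) := by positivity
    linarith [w₁ i, w₂ i]
  · rw [hw, scaledWeight_zero_of_gt hφ₁ hh ω i hi, scaledWeight_zero_of_gt hφ₂ hh ω i hi, sub_zero]
  · have e : (∑ i, if |X ω i| ≤ D.h n then (1 : ℝ) else 0) = locSum ind 1 ω := by
      unfold locSum
      refine Finset.sum_congr rfl fun i _ => ?_
      have : |X ω i / D.h n| ≤ 1 ↔ |X ω i| ≤ D.h n := by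
        rw [abs_div, abs_of_pos hh, div_le_one hh]
      simp [hind, this]
    rw [e]
    have h3 : ((n : ℝ) * D.h n)⁻¹ * locSum ind 1 ω ≤ |c₀| + 1 := by
      have := (abs_lt.1 hcnt).2
      linarith [le_abs_self c₀]
    rw [inv_mul_le_iff₀ hn] at h3
    refine h3.trans ?_
    rw [mul_comm]
    refine mul_le_mul_of_nonneg_right ?_ hn.le
    have : 0 ≤ b₁ * (2 * m₁) / d₁ := by positivity
    have : 0 ≤ b₂ * (2 * m₂) / d₂ := by positivity
    linarith
  · simp_rw [hs₁]; exact sum_scaledWeight_one _ _ hdet₁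
  · have : ∀ i, (if 0 ≤ X ω i then weight 1 0 ω i * X ω i else 0)
        = D.h n * (scaledWeight (kernelSide D true) ω i * (X ω i / D.h n)) := fun i => by
      rw [← hx, ← hs₁]; split_ifs <;> simp
    simp_rw [this]
    rw [← Finset.mul_sum, sum_scaledWeight_mul, mul_zero]
  · simp_rw [hs₂]; rw [Finset.sum_neg_distrib, sum_scaledWeight_one _ _ hdet₂]
  · have : ∀ i, (if 0 ≤ X ω i then 0 else weight 1 0 ω i * X ω i)
        = -D.h n * (scaledWeight (kernelSide D false) ω i * (X ω i / D.h n)) := fun i => by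
      rw [neg_mul, ← hx, ← neg_mul, ← hs₂]; split_ifs <;> simp
    simp_rw [this]
    rw [← Finset.mul_sum, sum_scaledWeight_mul, mul_zero]

open Classical in
/-- The weights of the units in one fold add up to nearly the same on both sides of the cutoff. -/
theorem isLittleOP_fold_sum (hD : D.DesignRegularity) (s : Fin D.S) {m : ℕ} (hm : m = 0 ∨ m = 1)
    {r : ℕ → ℝ} (hr : Tendsto r atTop (𝓝 0)) :
    D.IsLittleOP fun n ω => r n * √((n : ℝ) * D.h n) *
      ∑ i, (if fold ω i = s then weight 1 0 ω i * (X ω i / D.h n) ^ m else 0) := by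
  obtain ⟨m₁, d₁, hd₁, hm₁, h₁⟩ := exists_sideOK hD true
  obtain ⟨m₂, d₂, hd₂, hm₂, h₂⟩ := exists_sideOK hD false
  have hφ₁ := isLocalFun_kernelSide hD true
  have hφ₂ := isLocalFun_kernelSide hD false
  -- Subtracting the fold's share from its indicator yields coefficients that sum to zero, to which
  -- the preceding concentration result applies. The subtracted part is the share times the
  -- full-sample sum, which vanishes because the two sides contribute equally: 1 each for m = 0 and
  -- 0 each for m = 1.
  set share : ∀ n, (Fin n → Fin D.S) → ℝ := fun n f =>
    (∑ i : Fin n, if f i = s then (1 : ℝ) else 0) / n with hshare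
  set c : ∀ n, (Fin n → Fin D.S) → Fin n → ℝ := fun n f i =>
    (if f i = s then (1 : ℝ) else 0) - share n f with hcdef
  have hsh : ∀ n f, 0 ≤ share n f ∧ share n f ≤ 1 := fun n f => by
    have h0 : 0 ≤ ∑ i : Fin n, (if f i = s then (1 : ℝ) else 0) :=
      Finset.sum_nonneg fun i _ => by split_ifs <;> simp
    have h1 : ∑ i : Fin n, (if f i = s then (1 : ℝ) else 0) ≤ n := by
      refine (Finset.sum_le_sum (g := fun _ => (1 : ℝ)) fun i _ => by split_ifs <;> simp).trans ?_
      simp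
    exact ⟨div_nonneg h0 (Nat.cast_nonneg n), div_le_one_of_le₀ h1 (Nat.cast_nonneg n)⟩
  have hc : ∀ n f i, |c n f i| ≤ 1 := fun n f i => by
    obtain ⟨h0, h1⟩ := hsh n f
    simp only [hcdef]
    rw [abs_le]; split_ifs <;> constructor <;> linarith
  have hc0 : ∀ n f, ∑ i, c n f i = 0 := fun n f => by
    simp only [hcdef, Finset.sum_sub_distrib, Finset.sum_const, Finset.card_univ, Fintype.card_fin,
      nsmul_eq_mul, hshare]
    rcases Nat.eq_zero_or_pos n with rfl | hn
    · simp
    · have : (n : ℝ) ≠ 0 := by positivity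
      field_simp; simp
  have hT : ∀ {φ : ℝ → ℝ}, IsLocalFun φ → ∀ k, D.IsLittleOP fun n ω => r n * √((n : ℝ) * D.h n) *
      (((n : ℝ) * D.h n)⁻¹ * locSum (fun u => φ u * u ^ k) (c n ω.1) ω) := fun hφ k =>
    hD.isLittleOP_locSum_of_sum_eq_zero (hφ.mul_pow k) c hc hc0 hr
  have hB : ∀ {φ : ℝ → ℝ} {M d : ℝ}, IsLocalFun φ → 0 < M → 0 < d →
      (D.WHP fun _ ω => SideOK φ M d ω) → D.IsLittleOP fun n ω => r n * √((n : ℝ) * D.h n) *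
        ∑ i, c n ω.1 i * scaledWeight φ ω i * (X ω i / D.h n) ^ m := by
    intro φ M d hφ hM hd hok
    rw [isLittleOP_iff_whp]
    intro ε hε
    have hε' : 0 < ε / (2 * M / d) := by positivity
    refine (hok.and (((hT hφ m).whp hε').and ((hT hφ (m + 1)).whp hε'))).mono
      (Eventually.of_forall fun n ω hω => ?_)
    obtain ⟨⟨o1, o2, o3⟩, ha, hb⟩ := hω
    rw [sum_scaledWeight]
    set a := ((n : ℝ) * D.h n)⁻¹ * locSum (fun u => φ u * u ^ m) (c n ω.1) ω
    set b := ((n : ℝ) * D.h n)⁻¹ * locSum (fun u => φ u * u ^ (m + 1)) (c n ω.1) ω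
    set ρ := r n * √((n : ℝ) * D.h n)
    have e : ρ * ((scaledMoment φ 2 ω * a - scaledMoment φ 1 ω * b) / momentDet φ ω)
        = (scaledMoment φ 2 ω * (ρ * a) - scaledMoment φ 1 ω * (ρ * b)) / momentDet φ ω := by ring
    have hdp := hd.trans_le o3
    rw [e, abs_div, abs_of_pos hdp, div_lt_iff₀ hdp]
    have h3 : |scaledMoment φ 2 ω * (ρ * a) - scaledMoment φ 1 ω * (ρ * b)|
        ≤ M * |ρ * a| + M * |ρ * b| := by
      refine (abs_sub _ _).trans ?_
      rw [abs_mul, abs_mul (scaledMoment φ 1 ω)]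
      gcongr
    have h4 : M * |ρ * a| + M * |ρ * b| < ε * d := by
      rw [lt_div_iff₀ (by positivity)] at ha hb
      have ha' : |ρ * a| * (2 * M) < ε * d := by
        have := mul_lt_mul_of_pos_right ha hd
        rwa [mul_assoc, div_mul_cancel₀ _ hd.ne'] at this
      have hb' : |ρ * b| * (2 * M) < ε * d := by
        have := mul_lt_mul_of_pos_right hb hd
        rwa [mul_assoc, div_mul_cancel₀ _ hd.ne'] at this
      linarith
    have h5 : ε * d ≤ ε * momentDet φ ω := mul_le_mul_of_nonneg_left o3 hε.le
    linarith
  have hdiff := (hB hφ₁ hm₁ hd₁ h₁).add ((hB hφ₂ hm₂ hd₂ h₂).const_mul (-1))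
  refine hdiff.mono ((h₁.and h₂).mono ?_)
  filter_upwards [hD.nh_tendsto.eventually_gt_atTop 0] with n hn ω hω
  refine le_of_eq ?_
  congr 1
  have hdet₁ : momentDet (kernelSide D true) ω ≠ 0 := (hd₁.trans_le hω.1.2.2).ne'
  have hdet₂ : momentDet (kernelSide D false) ω ≠ 0 := (hd₂.trans_le hω.2.2.2).ne'
  have hsum : ∑ i, scaledWeight (kernelSide D true) ω i * (X ω i / D.h n) ^ m
      = ∑ i, scaledWeight (kernelSide D false) ω i * (X ω i / D.h n) ^ m := by
    rcases hm with rfl | rfl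
    · simp only [pow_zero, mul_one]
      rw [sum_scaledWeight_one _ _ hdet₁, sum_scaledWeight_one _ _ hdet₂]
    · simp only [pow_one]
      rw [sum_scaledWeight_mul, sum_scaledWeight_mul]
  have e : ∀ i, (if fold ω i = s then weight 1 0 ω i * (X ω i / D.h n) ^ m else 0)
      = (c n ω.1 i * scaledWeight (kernelSide D true) ω i * (X ω i / D.h n) ^ m
        - c n ω.1 i * scaledWeight (kernelSide D false) ω i * (X ω i / D.h n) ^ m)
        + share n ω.1 * (scaledWeight (kernelSide D true) ω i * (X ω i / D.h n) ^ m
          - scaledWeight (kernelSide D false) ω i * (X ω i / D.h n) ^ m) := fun i => by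
    rw [weight_eq hD hn]
    by_cases hfs : ω.1 i = s
    · rw [if_pos (show fold ω i = s from hfs)]; simp only [hcdef, if_pos hfs]; ring
    · rw [if_neg (show ¬ fold ω i = s from hfs)]; simp only [hcdef, if_neg hfs]; ring
  simp_rw [e]
  rw [Finset.sum_add_distrib, ← Finset.mul_sum, Finset.sum_sub_distrib, Finset.sum_sub_distrib,
    hsum]
  ring

end RDSetup

/-! ### Conditional moments and the characteristic function of a residual sum -/

namespace RDSetup

variable {D : RDSetup}

theorem measurable_adj {n : ℕ} {η : D.Cov n → ℝ} (hη : Measurable η) : Measurable (D.adj η) := by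
  unfold adj; fun_prop

theorem measurable_condMean {n : ℕ} {f : ℝ × D.Cov n → ℝ} (hf : Measurable f) :
    Measurable (D.condMean n f) := by
  unfold condMean
  exact (StronglyMeasurable.integral_kernel (κ := D.cond n) hf.stronglyMeasurable).measurable

theorem measurable_meanM {n : ℕ} {η : D.Cov n → ℝ} (hη : Measurable η) :
    Measurable (D.meanM η) := measurable_condMean (measurable_adj hη)

theorem measurable_varM {n : ℕ} {η : D.Cov n → ℝ} (hη : Measurable η) :
    Measurable (D.varM η) := by
  unfold varM variance evariance
  refine Measurable.ennreal_toReal ?_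
  have h : Measurable fun p : ℝ × (ℝ × D.Cov n) =>
      ‖D.adj η p.2 - ∫ u, D.adj η u ∂(D.cond n p.1)‖ₑ ^ 2 := by
    refine (Measurable.enorm ?_).pow_const 2
    exact ((measurable_adj hη).comp measurable_snd).sub ((measurable_meanM hη).comp measurable_fst)
  exact Measurable.lintegral_kernel_prod_right (f := fun x u =>
    ‖D.adj η u - ∫ u, D.adj η u ∂(D.cond n x)‖ₑ ^ 2) h

/-- `M_i(η) - E[M_i(η) | X_i]`. -/
noncomputable def resid {n : ℕ} (η : D.Cov n → ℝ) (ω : D.Sample n) (i : Fin n) : ℝ :=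
  M η ω i - D.meanM η (X ω i)

theorem resid_resample_self {n : ℕ} (η : D.Cov n → ℝ) (ω : D.Sample n) (i : Fin n)
    (v : ℝ × D.Cov n) : resid η (resample ω i v) i = D.adj η v - D.meanM η (X ω i) := by
  simp [resid]

theorem resid_resample_ne {n : ℕ} (η : D.Cov n → ℝ) (ω : D.Sample n) {i j : Fin n} (h : j ≠ i)
    (v : ℝ × D.Cov n) : resid η (resample ω i v) j = resid η ω j := by
  simp [resid, M_resample_ne η ω h]

theorem measurable_resid {n : ℕ} {η : D.Cov n → ℝ} (hη : Measurable η) (i : Fin n) :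
    Measurable fun ω : D.Sample n => resid η ω i := by
  unfold resid M
  refine ((measurable_adj hη).comp ?_).sub ((measurable_meanM hη).comp (measurable_X i))
  fun_prop

/-- Conditional moment bounds for `M(η)` at the point `x`. -/
structure MomentsAt {n : ℕ} (η : D.Cov n → ℝ) (B : ℝ) (x : ℝ) : Prop where
  integrable : Integrable (D.adj η) (D.cond n x)
  fourth : ∫⁻ u, ENNReal.ofReal ((D.adj η u - D.meanM η x) ^ 4) ∂(D.cond n x) ≤ ENNReal.ofReal B

theorem MomentsAt.integral_sub {n : ℕ} {η : D.Cov n → ℝ} {B x : ℝ} (h : MomentsAt η B x) :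
    ∫ u, (D.adj η u - D.meanM η x) ∂(D.cond n x) = 0 := by
  rw [MeasureTheory.integral_sub h.integrable (integrable_const _)]
  simp [meanM, condMean]

theorem integral_sq_eq_varM {n : ℕ} {η : D.Cov n → ℝ} (hη : Measurable η) (x : ℝ) :
    ∫ u, (D.adj η u - D.meanM η x) ^ 2 ∂(D.cond n x) = D.varM η x := by
  unfold varM
  rw [variance_eq_integral (measurable_adj hη).aemeasurable]
  rfl

theorem sq_le_one_add_pow_four (y : ℝ) : y ^ 2 ≤ 1 + y ^ 4 := by
  nlinarith [sq_nonneg (y ^ 2 - 1), sq_nonneg y]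

theorem MomentsAt.integrable_fourth {n : ℕ} {η : D.Cov n → ℝ} (hη : Measurable η) {B x : ℝ}
    (h : MomentsAt η B x) :
    Integrable (fun u => (D.adj η u - D.meanM η x) ^ 4) (D.cond n x) := by
  refine ⟨(((measurable_adj hη).sub_const _).pow_const 4).aestronglyMeasurable, ?_⟩
  rw [hasFiniteIntegral_iff_ofReal (ae_of_all _ fun ω => by positivity)]
  exact h.fourth.trans_lt ENNReal.ofReal_lt_top

theorem MomentsAt.integral_fourth_le {n : ℕ} {η : D.Cov n → ℝ} (hη : Measurable η) {B x : ℝ}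
    (hB : 0 ≤ B) (h : MomentsAt η B x) :
    ∫ u, (D.adj η u - D.meanM η x) ^ 4 ∂(D.cond n x) ≤ B := by
  rw [← ENNReal.ofReal_le_ofReal_iff hB, ofReal_integral_eq_lintegral_ofReal
    (h.integrable_fourth hη) (ae_of_all _ fun ω => by positivity)]
  exact h.fourth

theorem MomentsAt.integrable_sq {n : ℕ} {η : D.Cov n → ℝ} (hη : Measurable η) {B x : ℝ}
    (h : MomentsAt η B x) :
    Integrable (fun u => (D.adj η u - D.meanM η x) ^ 2) (D.cond n x) := by
  have i14 : Integrable (fun u => 1 + (D.adj η u - D.meanM η x) ^ 4) (D.cond n x) :=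
    (integrable_const _).add (h.integrable_fourth hη)
  refine i14.mono (((measurable_adj hη).sub_const _).pow_const 2).aestronglyMeasurable
    (ae_of_all _ fun u => ?_)
  rw [Real.norm_eq_abs, Real.norm_eq_abs, abs_of_nonneg (sq_nonneg _)]
  exact (sq_le_one_add_pow_four _).trans (le_abs_self _)

theorem MomentsAt.varM_le {n : ℕ} {η : D.Cov n → ℝ} (hη : Measurable η) {B x : ℝ}
    (hB : 0 ≤ B) (h : MomentsAt η B x) : D.varM η x ≤ 1 + B := by
  rw [← integral_sq_eq_varM hη]
  have i4 := h.integrable_fourth hη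
  calc _ ≤ ∫ u, (1 + (D.adj η u - D.meanM η x) ^ 4) ∂(D.cond n x) :=
        integral_mono (h.integrable_sq hη) ((integrable_const _).add i4)
          fun u => sq_le_one_add_pow_four _
    _ ≤ 1 + B := by
        rw [integral_add (integrable_const _) i4]
        simpa using h.integral_fourth_le hη hB

theorem varM_nonneg {n : ℕ} (η : D.Cov n → ℝ) (x : ℝ) : 0 ≤ D.varM η x := variance_nonneg _ _

theorem MomentsAt.lintegral_sq_le {n : ℕ} {η : D.Cov n → ℝ} (hη : Measurable η) {B x : ℝ}
    (hB : 0 ≤ B) (h : MomentsAt η B x) :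
    ∫⁻ u, ENNReal.ofReal ((D.adj η u - D.meanM η x) ^ 2) ∂(D.cond n x)
      ≤ ENNReal.ofReal (1 + B) := by
  rw [← ofReal_integral_eq_lintegral_ofReal (h.integrable_sq hη) (ae_of_all _ fun u => sq_nonneg _),
    integral_sq_eq_varM hη]
  exact ENNReal.ofReal_le_ofReal (h.varM_le hη hB)

/-- The characteristic function of a sum of conditionally independent residuals, with weights that
depend on the running variables (and folds) only, is close to that of the corresponding mixture of
centred normal laws. -/
theorem norm_charFun_sum_sub_le {n : ℕ} {η : D.Cov n → ℝ} (hη : Measurable η) {B : ℝ} (hB : 0 ≤ B)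
    (a : D.Sample n → Fin n → ℝ) (ha : ∀ i, Measurable fun ω => a ω i)
    (hinv : ∀ ω j v, a (resample ω j v) = a ω)
    (hmom : ∀ ω i, a ω i ≠ 0 → MomentsAt η B (X ω i)) {κ c : ℝ} (hκ : ∀ ω i, |a ω i| ≤ κ)
    (hκ0 : 0 ≤ κ) (hc : ∀ ω, ∑ i, a ω i ^ 2 ≤ c) (t : ℝ) :
    ‖∫ ω, Complex.exp ((t * ∑ i, a ω i * resid η ω i : ℝ) * Complex.I) ∂(D.P n)
        - ∫ ω, ((Real.exp (-(t ^ 2 * (∑ i, a ω i ^ 2 * D.varM η (X ω i)) / 2)) : ℝ) : ℂ) ∂(D.P n)‖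
      ≤ 4 * |t| ^ 3 * (κ * c) * (1 + B) + t ^ 4 * (κ ^ 2 * c) * (1 + B) ^ 2 := by
  classical
  set ψ : Fin n → D.Sample n → ℂ := fun i ω =>
    Complex.exp ((t * a ω i * resid η ω i : ℝ) * Complex.I) with hψ
  set γ : Fin n → D.Sample n → ℂ := fun i ω =>
    ((Real.exp (-((t * a ω i) ^ 2 * D.varM η (X ω i) / 2)) : ℝ) : ℂ) with hγ
  have mψ : ∀ i, Measurable (ψ i) := fun i => by
    have := (((ha i).const_mul t).mul (measurable_resid hη i))
    exact Complex.measurable_exp.comp ((Complex.measurable_ofReal.comp this).mul_const _)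
  have mγ : ∀ i, Measurable (γ i) := fun i => by
    have h1 : Measurable fun ω : D.Sample n => D.varM η (X ω i) :=
      (measurable_varM hη).comp (measurable_X i)
    have h2 := (((((ha i).const_mul t).pow_const 2).mul h1).div_const 2).neg
    exact Complex.measurable_ofReal.comp (Real.measurable_exp.comp h2)
  have nψ : ∀ i ω, ‖ψ i ω‖ ≤ 1 := fun i ω => (Complex.norm_exp_ofReal_mul_I _).le
  have nγ : ∀ i ω, ‖γ i ω‖ ≤ 1 := fun i ω => by
    simp only [hγ, Complex.norm_real, Real.norm_eq_abs, Real.abs_exp]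
    refine Real.exp_le_one_iff.2 ?_
    have := varM_nonneg (D := D) η (X ω i)
    have : 0 ≤ (t * a ω i) ^ 2 * D.varM η (X ω i) / 2 := by positivity
    linarith
  set b : Fin n → D.Sample n → ℝ := fun i ω =>
    4 * |t * a ω i| ^ 3 * (1 + B) + (t * a ω i) ^ 4 * (1 + B) ^ 2 with hb
  have mb : ∀ i, Measurable (b i) := fun i => by
    have h1 := (ha i).const_mul t
    have h2 : Measurable fun ω => |t * a ω i| := h1.abs
    exact (((h2.pow_const 3).const_mul 4).mul_const _).add ((h1.pow_const 4).mul_const _)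
  have ib : ∀ i, Integrable (b i) (D.P n) := fun i => by
    refine Integrable.of_bound (mb i).aestronglyMeasurable
      (4 * (|t| * κ) ^ 3 * (1 + B) + (|t| * κ) ^ 4 * (1 + B) ^ 2) (ae_of_all _ fun ω => ?_)
    have h1 : |t * a ω i| ≤ |t| * κ := by
      rw [abs_mul]; exact mul_le_mul_of_nonneg_left (hκ ω i) (abs_nonneg _)
    have h2 : (t * a ω i) ^ 4 = |t * a ω i| ^ 4 := (Even.pow_abs (by decide) _).symm
    rw [Real.norm_eq_abs, abs_of_nonneg (by simp only [hb]; positivity)]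
    simp only [hb]
    rw [h2]
    gcongr
  -- Hybrid products as in Lindeberg's replacement argument: units in `s` carry the oscillating
  -- factor, all others the Gaussian one. Enlarging `s` by unit i changes a single factor, and
  -- redrawing that unit leaves the remaining product `G` fixed.
  set Φ : Finset (Fin n) → D.Sample n → ℂ := fun s ω =>
    ∏ i, if i ∈ s then ψ i ω else γ i ω with hΦ
  have step : ∀ s : Finset (Fin n), ∀ i ∉ s,
      ‖∫ ω, Φ (insert i s) ω ∂(D.P n) - ∫ ω, Φ s ω ∂(D.P n)‖ ≤ ∫ ω, b i ω ∂(D.P n) := by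
    intro s i hi
    set G : D.Sample n → ℂ := fun ω =>
      ∏ j ∈ Finset.univ.erase i, if j ∈ s then ψ j ω else γ j ω with hG
    have e1 : ∀ ω, Φ (insert i s) ω = G ω * ψ i ω := fun ω => by
      simp only [hΦ, hG]
      rw [← Finset.prod_erase_mul _ _ (Finset.mem_univ i), if_pos (Finset.mem_insert_self i s)]
      congr 1
      refine Finset.prod_congr rfl fun j hj => ?_
      simp [Finset.mem_insert, Finset.ne_of_mem_erase hj]
    have e2 : ∀ ω, Φ s ω = G ω * γ i ω := fun ω => by
      simp only [hΦ, hG]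
      rw [← Finset.prod_erase_mul _ _ (Finset.mem_univ i), if_neg hi]
    have mG : Measurable G := Finset.measurable_prod _ fun j _ => by
      by_cases hj : j ∈ s
      · simpa [hj] using mψ j
      · simpa [hj] using mγ j
    have nG : ∀ ω, ‖G ω‖ ≤ 1 := fun ω => by
      simp only [hG, norm_prod]
      refine Finset.prod_le_one (fun _ _ => norm_nonneg _) fun j _ => ?_
      split_ifs
      exacts [nψ j ω, nγ j ω]
    have Ginv : ∀ ω v, G (resample ω i v) = G ω := fun ω v => by
      simp only [hG]
      refine Finset.prod_congr rfl fun j hj => ?_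
      have hji := Finset.ne_of_mem_erase hj
      simp only [hψ, hγ, hinv, X_resample, resid_resample_ne η ω hji]
    have bnd : ∀ {u : D.Sample n → ℂ}, Measurable u → (∀ ω, ‖u ω‖ ≤ 1) →
        Integrable (fun ω => G ω * u ω) (D.P n) := fun {u} hu hu1 => by
      refine Integrable.of_bound (mG.mul hu).aestronglyMeasurable 1 (ae_of_all _ fun ω => ?_)
      rw [norm_mul]
      exact mul_le_one₀ (nG ω) (norm_nonneg _) (hu1 ω)
    have i1 := bnd (mψ i) (nψ i)
    have i2 := bnd (mγ i) (nγ i)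
    simp_rw [e1, e2]
    have i12 : Integrable (fun ω => G ω * ψ i ω - G ω * γ i ω) (D.P n) := i1.sub i2
    rw [← integral_sub i1 i2, integral_eq_resample i i12]
    refine norm_integral_le_of_norm_le (ib i) (ae_of_all _ fun ω => ?_)
    have e3 : ∀ v, G (resample ω i v) * ψ i (resample ω i v) - G (resample ω i v) * γ i (resample ω i v)
        = G ω * (Complex.exp ((t * a ω i * (D.adj η v - D.meanM η (X ω i)) : ℝ) * Complex.I)
          - γ i ω) := fun v => by
      rw [Ginv, mul_sub]
      simp only [hψ, hγ, hinv, X_resample, resid_resample_self]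
    simp_rw [e3]
    rw [integral_const_mul, norm_mul]
    refine (mul_le_of_le_one_left (norm_nonneg _) (nG ω)).trans ?_
    -- Moment bounds are available only where the weight is nonzero; where it is zero both factors
    -- equal 1.
    by_cases h0 : a ω i = 0
    · simp [h0, hγ, hb]
    · have hmo := hmom ω i h0
      have hg : Measurable fun u => D.adj η u - D.meanM η (X ω i) :=
        (measurable_adj hη).sub_const _
      have ie : Integrable (fun v => Complex.exp
          ((t * a ω i * (D.adj η v - D.meanM η (X ω i)) : ℝ) * Complex.I)) (D.cond n (X ω i)) := by
        refine Integrable.of_bound ?_ 1 (ae_of_all _ fun v => (Complex.norm_exp_ofReal_mul_I _).le)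
        exact (Complex.measurable_exp.comp ((Complex.measurable_ofReal.comp
          (hg.const_mul _)).mul_const _)).aestronglyMeasurable
      rw [integral_sub ie (integrable_const _)]
      simp only [integral_const, probReal_univ, one_smul]
      exact norm_charFun_sub_gaussian_le (D.cond n (X ω i)) hg hB hmo.integral_sub
        (integral_sq_eq_varM hη _) hmo.fourth (t * a ω i)
  have tele : ∀ s : Finset (Fin n), ‖∫ ω, Φ s ω ∂(D.P n) - ∫ ω, Φ ∅ ω ∂(D.P n)‖
      ≤ ∑ i ∈ s, ∫ ω, b i ω ∂(D.P n) := by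
    intro s
    induction s using Finset.induction_on with
    | empty => simp
    | insert i s hi ih =>
      rw [Finset.sum_insert hi]
      exact (norm_sub_le_norm_sub_add_norm_sub _ (∫ ω, Φ s ω ∂(D.P n)) _).trans
        (add_le_add (step s i hi) ih)
  have efull : ∀ ω, Φ Finset.univ ω
      = Complex.exp ((t * ∑ i, a ω i * resid η ω i : ℝ) * Complex.I) := fun ω => by
    simp only [hΦ, hψ, Finset.mem_univ, if_true]
    rw [← Complex.exp_sum, ← Finset.sum_mul]
    congr 2
    rw [← Complex.ofReal_sum, Finset.mul_sum]
    congr 1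
    exact Finset.sum_congr rfl fun i _ => by ring
  have eempty : ∀ ω, Φ ∅ ω
      = ((Real.exp (-(t ^ 2 * (∑ i, a ω i ^ 2 * D.varM η (X ω i)) / 2)) : ℝ) : ℂ) := fun ω => by
    simp only [hΦ, hγ, Finset.notMem_empty, if_false]
    rw [← Complex.ofReal_prod, ← Real.exp_sum]
    congr 2
    rw [Finset.sum_neg_distrib, ← Finset.sum_div, Finset.mul_sum]
    congr 2
    exact Finset.sum_congr rfl fun i _ => by ring
  have h := tele Finset.univ
  simp_rw [efull, eempty] at h
  refine h.trans ?_
  rw [← integral_finsetSum _ fun i _ => ib i]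
  have hle : ∀ ω, ∑ i, b i ω
      ≤ 4 * |t| ^ 3 * (κ * c) * (1 + B) + t ^ 4 * (κ ^ 2 * c) * (1 + B) ^ 2 := fun ω => by
    -- Third and fourth powers of the weights are reduced to squares by spending powers of the
    -- uniform bound κ.
    have h1 : ∀ i, b i ω ≤ (4 * |t| ^ 3 * κ * (1 + B) + t ^ 4 * κ ^ 2 * (1 + B) ^ 2) * a ω i ^ 2 :=
      fun i => by
      have ha1 := hκ ω i
      have ha0 := abs_nonneg (a ω i)
      have h3 : |a ω i| ^ 3 ≤ κ * a ω i ^ 2 := by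
        rw [← sq_abs (a ω i), pow_succ' _ 2]
        exact mul_le_mul_of_nonneg_right ha1 (sq_nonneg _)
      have h4 : a ω i ^ 4 ≤ κ ^ 2 * a ω i ^ 2 := by
        have : a ω i ^ 2 ≤ κ ^ 2 := by rw [← sq_abs]; exact pow_le_pow_left₀ ha0 ha1 2
        nlinarith [sq_nonneg (a ω i)]
      simp only [hb]
      rw [abs_mul, _root_.mul_pow, _root_.mul_pow]
      have ht4 : 0 ≤ t ^ 4 := by positivity
      calc _ ≤ 4 * (|t| ^ 3 * (κ * a ω i ^ 2)) * (1 + B)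
            + t ^ 4 * (κ ^ 2 * a ω i ^ 2) * (1 + B) ^ 2 := by gcongr
        _ = _ := by ring
    refine (Finset.sum_le_sum fun i _ => h1 i).trans ?_
    rw [← Finset.mul_sum]
    have ht4 : 0 ≤ t ^ 4 := by positivity
    calc _ ≤ (4 * |t| ^ 3 * κ * (1 + B) + t ^ 4 * κ ^ 2 * (1 + B) ^ 2) * c :=
          mul_le_mul_of_nonneg_left (hc ω) (by positivity)
      _ = _ := by ring
  calc _ ≤ ∫ _, (4 * |t| ^ 3 * (κ * c) * (1 + B) + t ^ 4 * (κ ^ 2 * c) * (1 + B) ^ 2) ∂(D.P n) :=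
        integral_mono (integrable_finsetSum _ fun i _ => ib i) (integrable_const _) hle
    _ = _ := by simp

end RDSetup

/-! ### Measurability and invariance of weights and neighbours -/

namespace RDSetup

variable {D : RDSetup}

theorem measurable_KPlus (hK : Measurable D.K) (n : ℕ) : Measurable (D.KPlus n) := by
  unfold KPlus
  exact Measurable.ite (measurableSet_le measurable_const measurable_id)
    ((hK.comp (measurable_id.div_const _)).div_const _) measurable_const

theorem measurable_KMinus (hK : Measurable D.K) (n : ℕ) : Measurable (D.KMinus n) := by
  unfold KMinus
  exact Measurable.ite (measurableSet_lt measurable_id measurable_const)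
    ((hK.comp (measurable_id.div_const _)).div_const _) measurable_const

theorem measurable_sideWeight {k : ℝ → ℝ} (hk : Measurable k) {n : ℕ} (i : Fin n) :
    Measurable fun ω : D.Sample n => sideWeight 1 0 k (X ω) i := by
  simp_rw [sideWeight_one_zero]
  have h1 : ∀ j : Fin n, Measurable fun ω : D.Sample n => k (X ω j) := fun j =>
    hk.comp (measurable_X j)
  fun_prop

theorem measurable_weight (hK : Measurable D.K) {n : ℕ} (i : Fin n) :
    Measurable fun ω : D.Sample n => weight 1 0 ω i := by
  unfold weight
  exact (measurable_sideWeight (measurable_KPlus hK n) i).sub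
    (measurable_sideWeight (measurable_KMinus hK n) i)

@[simp] theorem weight_resample {n : ℕ} (ω : D.Sample n) (j : Fin n) (v : ℝ × D.Cov n) :
    weight 1 0 (resample ω j v) = weight 1 0 ω := by
  funext i; simp [weight]

@[simp] theorem neighbors_resample {n : ℕ} (ω : D.Sample n) (j : Fin n) (v : ℝ × D.Cov n) :
    neighbors (resample ω j v) = neighbors ω := by
  funext i; simp only [neighbors, X_resample]

theorem goodDesign_resample {A : ℝ} {n : ℕ} (ω : D.Sample n) (j : Fin n) (v : ℝ × D.Cov n) :
    GoodDesign A (resample ω j v) ↔ GoodDesign A ω := by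
  constructor
  · rintro ⟨h1, h2, h3, h4, h5, h6, h7, h8⟩
    simp only [X_resample, weight_resample] at h1 h2 h3 h4 h5 h6 h7 h8
    exact ⟨h1, h2, h3, h4, h5, h6, h7, h8⟩
  · rintro ⟨h1, h2, h3, h4, h5, h6, h7, h8⟩
    constructor <;> simp only [X_resample, weight_resample] <;> assumption

theorem measurableSet_goodDesign (hK : Measurable D.K) (A : ℝ) (n : ℕ) :
    MeasurableSet {ω : D.Sample n | GoodDesign A ω} := by
  classical
  have hw := fun i : Fin n => measurable_weight (D := D) hK i
  have hX := fun i : Fin n => measurable_X (D := D) i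
  have hp : ∀ i : Fin n, MeasurableSet {ω : D.Sample n | 0 ≤ X ω i} := fun i =>
    measurableSet_le measurable_const (hX i)
  have e : {ω : D.Sample n | GoodDesign A ω} =
      (⋂ i, {ω | X ω i ≠ 0}) ∩ (⋂ i, {ω | |weight 1 0 ω i| ≤ A / ((n : ℝ) * D.h n)}) ∩
      (⋂ i, ({ω | D.h n < |X ω i|}ᶜ ∪ {ω | weight 1 0 ω i = 0})) ∩
      {ω | (∑ i, if |X ω i| ≤ D.h n then (1 : ℝ) else 0) ≤ A * ((n : ℝ) * D.h n)} ∩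
      {ω | (∑ i, if 0 ≤ X ω i then weight 1 0 ω i else 0) = 1} ∩
      {ω | (∑ i, if 0 ≤ X ω i then weight 1 0 ω i * X ω i else 0) = 0} ∩
      {ω | (∑ i, if 0 ≤ X ω i then 0 else weight 1 0 ω i) = -1} ∩
      {ω | (∑ i, if 0 ≤ X ω i then 0 else weight 1 0 ω i * X ω i) = 0} := by
    ext ω
    simp only [Set.mem_inter_iff, Set.mem_iInter, Set.mem_ofPred_eq, Set.mem_union,
      Set.mem_compl_iff]
    constructor
    · rintro ⟨h1, h2, h3, h4, h5, h6, h7, h8⟩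
      refine ⟨⟨⟨⟨⟨⟨⟨h1, h2⟩, fun i => ?_⟩, ?_⟩, ?_⟩, ?_⟩, ?_⟩, ?_⟩
      · have := h3 i; tauto
      exacts [h4, h5, h6, h7, h8]
    · rintro ⟨⟨⟨⟨⟨⟨⟨h1, h2⟩, h3⟩, h4⟩, h5⟩, h6⟩, h7⟩, h8⟩
      refine ⟨h1, h2, fun i hi => ?_, ?_, ?_, ?_, ?_, ?_⟩
      · have := h3 i; tauto
      exacts [h4, h5, h6, h7, h8]
  rw [e]
  refine (((((((MeasurableSet.iInter fun i => ?_).inter (MeasurableSet.iInter fun i => ?_)).inter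
    (MeasurableSet.iInter fun i => ?_)).inter ?_).inter ?_).inter ?_).inter ?_).inter ?_
  · exact (hX i) (measurableSet_singleton 0).compl
  · exact measurableSet_le (hw i).abs measurable_const
  · exact (measurableSet_lt measurable_const (hX i).abs).compl.union
      (measurableSet_eq_fun (hw i) measurable_const)
  · exact measurableSet_le (Finset.measurable_sum _ fun i _ => Measurable.ite
      (measurableSet_le (hX i).abs measurable_const) measurable_const measurable_const)
      measurable_const
  · exact measurableSet_eq_fun (Finset.measurable_sum _ fun i _ => Measurable.ite (hp i) (hw i)
      measurable_const) measurable_const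
  · exact measurableSet_eq_fun (Finset.measurable_sum _ fun i _ => Measurable.ite (hp i)
      ((hw i).mul (hX i)) measurable_const) measurable_const
  · exact measurableSet_eq_fun (Finset.measurable_sum _ fun i _ => Measurable.ite (hp i)
      measurable_const (hw i)) measurable_const
  · exact measurableSet_eq_fun (Finset.measurable_sum _ fun i _ => Measurable.ite (hp i)
      measurable_const ((hw i).mul (hX i))) measurable_const

theorem measurableSet_mem_neighbors {n : ℕ} (i j : Fin n) :
    MeasurableSet {ω : D.Sample n | j ∈ neighbors ω i} := by
  classical
  have hX := fun i : Fin n => measurable_X (D := D) i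
  have hp : ∀ i : Fin n, MeasurableSet {ω : D.Sample n | 0 ≤ X ω i} := fun i =>
    measurableSet_le measurable_const (hX i)
  have hside : ∀ l : Fin n, MeasurableSet {ω : D.Sample n | l ∈ sameSide ω i} := fun l => by
    have : {ω : D.Sample n | l ∈ sameSide ω i} = {ω | l ≠ i} ∩
        (({ω | 0 ≤ X ω l} ∩ {ω | 0 ≤ X ω i}) ∪ ({ω | 0 ≤ X ω l}ᶜ ∩ {ω | 0 ≤ X ω i}ᶜ)) := by
      ext ω
      simp only [mem_sameSide, Set.mem_ofPred_eq, Set.mem_inter_iff, Set.mem_union,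
        Set.mem_compl_iff]
      tauto
    rw [this]
    exact (MeasurableSet.const _).inter (((hp l).inter (hp i)).union
      ((hp l).compl.inter (hp i).compl))
  have hd : ∀ l : Fin n, Measurable fun ω : D.Sample n => |X ω l - X ω i| := fun l =>
    ((hX l).sub (hX i)).abs
  have hlt : ∀ l : Fin n, MeasurableSet {ω : D.Sample n | |X ω l - X ω i| < |X ω j - X ω i| ∨
      (|X ω l - X ω i| = |X ω j - X ω i| ∧ l < j)} := fun l =>
    (measurableSet_lt (hd l) (hd j)).union
      ((measurableSet_eq_fun (hd l) (hd j)).inter (MeasurableSet.const _))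
  have hcard : Measurable fun ω : D.Sample n =>
      ∑ l, if (l ∈ sameSide ω i ∧ (|X ω l - X ω i| < |X ω j - X ω i| ∨
        (|X ω l - X ω i| = |X ω j - X ω i| ∧ l < j))) then (1 : ℕ) else 0 :=
    Finset.measurable_sum _ fun l _ => Measurable.ite ((hside l).inter (hlt l)) measurable_const
      measurable_const
  have e : {ω : D.Sample n | j ∈ neighbors ω i} = {ω | j ∈ sameSide ω i} ∩
      {ω | (∑ l, if (l ∈ sameSide ω i ∧ (|X ω l - X ω i| < |X ω j - X ω i| ∨
        (|X ω l - X ω i| = |X ω j - X ω i| ∧ l < j))) then (1 : ℕ) else 0) < D.R} := by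
    ext ω
    rw [Set.mem_ofPred_eq, neighbors_eq, Finset.mem_filter, Set.mem_inter_iff, Set.mem_ofPred_eq,
      Set.mem_ofPred_eq, ← Finset.card_filter]
    have : (Finset.univ.filter fun l => l ∈ sameSide ω i ∧ (|X ω l - X ω i| < |X ω j - X ω i| ∨
        (|X ω l - X ω i| = |X ω j - X ω i| ∧ l < j)))
        = (sameSide ω i).filter fun l => |X ω l - X ω i| < |X ω j - X ω i| ∨
        (|X ω l - X ω i| = |X ω j - X ω i| ∧ l < j) := by
      ext l; simp
    rw [this]
  rw [e]
  exact (hside j).inter (measurableSet_lt hcard measurable_const)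

/-! ### Consequences of a good design -/

section GoodDesign

variable {A : ℝ} {n : ℕ} {ω : D.Sample n}

theorem GoodDesign.abs_le_of_ne_zero (h : GoodDesign A ω) {i : Fin n} (hi : weight 1 0 ω i ≠ 0) :
    |X ω i| ≤ D.h n := by
  by_contra hc
  exact hi (h.eq_zero i (not_le.1 hc))

open Classical in
theorem GoodDesign.abs_pow_le (h : GoodDesign A ω) (k : ℕ) (hk : k ≠ 0) (i : Fin n) :
    |weight 1 0 ω i| ^ k ≤ (A / ((n : ℝ) * D.h n)) ^ k * if |X ω i| ≤ D.h n then 1 else 0 := by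
  split_ifs with hi
  · rw [mul_one]; exact pow_le_pow_left₀ (abs_nonneg _) (h.abs_le i) k
  · rw [h.eq_zero i (not_le.1 hi), abs_zero, zero_pow hk, mul_zero]

/-- At most A nh weights are nonzero, each of size at most A/(nh). -/
theorem GoodDesign.sum_abs_pow_le (hA : 0 ≤ A) (hn : 0 < (n : ℝ) * D.h n) (h : GoodDesign A ω)
    (k : ℕ) :
    ∑ i, |weight 1 0 ω i| ^ (k + 1) ≤ A ^ (k + 2) / ((n : ℝ) * D.h n) ^ k := by
  classical
  refine (Finset.sum_le_sum fun i _ => h.abs_pow_le (k + 1) (Nat.succ_ne_zero k) i).trans ?_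
  rw [← Finset.mul_sum]
  calc _ ≤ (A / ((n : ℝ) * D.h n)) ^ (k + 1) * (A * ((n : ℝ) * D.h n)) :=
        mul_le_mul_of_nonneg_left (by convert h.count) (by positivity)
    _ = _ := by
        have := hn.ne'
        generalize (n : ℝ) * D.h n = N at this
        rw [div_pow]; field_simp; ring

theorem GoodDesign.sum_sq_le (hA : 0 ≤ A) (hn : 0 < (n : ℝ) * D.h n) (h : GoodDesign A ω) :
    ∑ i, weight 1 0 ω i ^ 2 ≤ A ^ 3 / ((n : ℝ) * D.h n) := by
  simpa using h.sum_abs_pow_le hA hn 1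

/-- Cauchy–Schwarz: the weights to the right of the cutoff sum to 1 while at most A nh units lie in
the window. -/
theorem GoodDesign.sum_sq_ge (hA : 0 < A) (hn : 0 < (n : ℝ) * D.h n) (h : GoodDesign A ω) :
    1 / (A * ((n : ℝ) * D.h n)) ≤ ∑ i, weight 1 0 ω i ^ 2 := by
  classical
  have h1 := Finset.sum_mul_sq_le_sq_mul_sq Finset.univ
    (fun i => if |X ω i| ≤ D.h n then (1 : ℝ) else 0)
    (fun i => if 0 ≤ X ω i then weight 1 0 ω i else 0)
  have e : ∑ i, (if |X ω i| ≤ D.h n then (1 : ℝ) else 0) * (if 0 ≤ X ω i then weight 1 0 ω i else 0)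
      = 1 := by
    refine Eq.trans ?_ h.sum_plus
    refine Finset.sum_congr rfl fun i _ => ?_
    by_cases hi : |X ω i| ≤ D.h n
    · simp [hi]
    · simp [h.eq_zero i (not_le.1 hi)]
  rw [e, one_pow] at h1
  have h2 : ∑ i, (if |X ω i| ≤ D.h n then (1 : ℝ) else 0) ^ 2 ≤ A * ((n : ℝ) * D.h n) := by
    refine le_trans (le_of_eq ?_) h.count
    refine Finset.sum_congr rfl fun i _ => ?_
    split_ifs <;> simp
  have h3 : ∑ i, (if 0 ≤ X ω i then weight 1 0 ω i else 0) ^ 2 ≤ ∑ i, weight 1 0 ω i ^ 2 := by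
    refine Finset.sum_le_sum fun i _ => ?_
    split_ifs
    · exact le_rfl
    · rw [zero_pow two_ne_zero]; exact sq_nonneg _
  have hpos : 0 < A * ((n : ℝ) * D.h n) := mul_pos hA hn
  rw [div_le_iff₀ hpos]
  calc (1 : ℝ) ≤ _ := h1
    _ ≤ A * ((n : ℝ) * D.h n) * ∑ i, weight 1 0 ω i ^ 2 :=
        mul_le_mul h2 h3 (Finset.sum_nonneg fun i _ => sq_nonneg _) hpos.le
    _ = _ := mul_comm _ _

open Classical in
/-- There are at least `n h / A` units within distance `h` on each side of the cutoff. -/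
theorem GoodDesign.card_side_ge (hA : 0 < A) (hn : 0 < (n : ℝ) * D.h n) (h : GoodDesign A ω)
    (p : Prop) : (n : ℝ) * D.h n / A ≤
      (Finset.univ.filter fun i => |X ω i| ≤ D.h n ∧ (0 ≤ X ω i ↔ p)).card := by
  -- The weights of one side sum to 1 in absolute value and none exceeds A/(nh), so at least nh/A of
  -- them are nonzero.
  have key : ∀ g : Fin n → ℝ, |∑ i, g i| = 1 →
      (∀ i, g i ≠ 0 → |X ω i| ≤ D.h n ∧ (0 ≤ X ω i ↔ p)) → (∀ i, |g i| ≤ A / ((n : ℝ) * D.h n)) →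
      (n : ℝ) * D.h n / A ≤
        (Finset.univ.filter fun i => |X ω i| ≤ D.h n ∧ (0 ≤ X ω i ↔ p)).card := by
    intro g h1 h2 h3
    have h4 : (1 : ℝ) ≤ ∑ i, if (|X ω i| ≤ D.h n ∧ (0 ≤ X ω i ↔ p)) then A / ((n : ℝ) * D.h n)
        else 0 := by
      rw [← h1]
      refine (Finset.abs_sum_le_sum_abs _ _).trans (Finset.sum_le_sum fun i _ => ?_)
      split_ifs with hi
      · exact h3 i
      · rw [not_imp_comm.1 (h2 i) hi, abs_zero]
    rw [← Finset.sum_filter, Finset.sum_const, nsmul_eq_mul, ← mul_div_assoc, le_div_iff₀ hn] at h4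
    rw [div_le_iff₀ hA]; linarith
  have habs : ∀ i, |weight 1 0 ω i| ≤ A / ((n : ℝ) * D.h n) := h.abs_le
  have h0 : 0 ≤ A / ((n : ℝ) * D.h n) := by positivity
  by_cases hp : p
  · refine key (fun i => if 0 ≤ X ω i then weight 1 0 ω i else 0) (by rw [h.sum_plus, abs_one])
      (fun i hi => ?_) fun i => ?_
    · by_cases hx : 0 ≤ X ω i
      · rw [if_pos hx] at hi; exact ⟨h.abs_le_of_ne_zero hi, by simp [hx, hp]⟩
      · exact absurd (if_neg hx) hi
    · split_ifs
      · exact habs i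
      · simpa using h0
  · refine key (fun i => if 0 ≤ X ω i then 0 else weight 1 0 ω i) (by rw [h.sum_minus]; simp)
      (fun i hi => ?_) fun i => ?_
    · by_cases hx : 0 ≤ X ω i
      · exact absurd (if_pos hx) hi
      · rw [if_neg hx] at hi; exact ⟨h.abs_le_of_ne_zero hi, by simp [hx, hp]⟩
    · split_ifs
      · simpa using h0
      · exact habs i

end GoodDesign

end RDSetup

/-! ### Central limit theorem for the infeasible estimator -/

namespace RDSetup

variable {D : RDSetup}

/-- Regularity of the adjusted outcome in the estimation window at a given sample size. -/
structure RegularAt {n : ℕ} (η : D.Cov n → ℝ) (B C L : ℝ) : Prop where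
  moments : ∀ x, |x| ≤ D.h n → x ≠ 0 → MomentsAt η B x
  var_lower : ∀ x, |x| ≤ D.h n → x ≠ 0 → 1 / C ≤ D.varM η x
  mean_lip : ∀ x y, |x| ≤ D.h n → |y| ≤ D.h n → x ≠ 0 → y ≠ 0 → (0 ≤ x ↔ 0 ≤ y) →
    |D.meanM η x - D.meanM η y| ≤ L * |x - y|

theorem DesignRegularity.eventually_mem_suppX (hD : D.DesignRegularity) :
    ∀ᶠ n in atTop, ∀ x, |x| ≤ D.h n → x ∈ D.suppX := by
  obtain ⟨-, δ, -, hδ, hsub, -, -⟩ := hD.exists_density_limit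
  filter_upwards [hD.h_tendsto.eventually (gt_mem_nhds hδ)] with n hn x hx
  exact hsub (abs_lt.1 (hx.trans_lt hn))

/-- Once the window lies inside the support, the assumptions hold at every nonzero point of it. The
constant is `max B 0` because later bounds need it nonnegative, while `ENNReal.ofReal` puts no sign
condition on `B`. -/
theorem eventually_regularAt (hD : D.DesignRegularity) {T : ∀ n, Set (D.Cov n → ℝ)}
    {etaBar : ∀ n, D.Cov n → ℝ} {Xtilde : ℕ → Set ℝ} {C L q B : ℝ}
    (hmem : ∀ n, etaBar n ∈ T n)
    (houtcome : D.OutcomeRegularity etaBar C L q)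
    (hXtilde_sub : ∀ n, D.suppXh n ⊆ Xtilde n)
    (hmoment : D.FourthMoments T (fun n => Xtilde n ∩ D.suppX) B)
    (hmean : ∀ n, D.SidewiseLipschitz L (D.meanM (etaBar n))) :
    ∀ᶠ n in atTop, RegularAt (etaBar n) (max B 0) C L := by
  filter_upwards [hD.eventually_mem_suppX] with n hn
  refine ⟨fun x hx hx0 => ⟨houtcome.integrable n x ⟨hn x hx, hx0⟩, ?_⟩,
    fun x hx hx0 => houtcome.variance_lower n x ⟨hn x hx, hx0⟩, fun x y hx hy hx0 hy0 hxy => ?_⟩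
  · refine (hmoment n _ (hmem n) x ⟨hXtilde_sub n ⟨hn x hx, abs_le.1 hx⟩, hn x hx⟩).trans ?_
    exact ENNReal.ofReal_le_ofReal (le_max_left _ _)
  · by_cases h : 0 ≤ x
    · exact (hmean n).1 x ⟨hn x hx, lt_of_le_of_ne h hx0.symm⟩ y
        ⟨hn y hy, lt_of_le_of_ne (hxy.1 h) hy0.symm⟩
    · exact (hmean n).2 x ⟨hn x hx, not_le.1 h⟩ y ⟨hn y hy, not_le.1 fun h' => h (hxy.2 h')⟩

/-- Conditional variance of the infeasible estimator `∑ w_i M_i(η)`. -/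
noncomputable def seSq {n : ℕ} (η : D.Cov n → ℝ) (ω : D.Sample n) : ℝ :=
  ∑ i, weight 1 0 ω i ^ 2 * D.varM η (X ω i)

theorem seSq_ge {A B C L : ℝ} {n : ℕ} {η : D.Cov n → ℝ} (hr : RegularAt η B C L) {ω : D.Sample n} (h : GoodDesign A ω) :
    1 / C * ∑ i, weight 1 0 ω i ^ 2 ≤ seSq η ω := by
  unfold seSq
  rw [Finset.mul_sum]
  refine Finset.sum_le_sum fun i _ => ?_
  by_cases hw : weight 1 0 ω i = 0
  · simp [hw]
  · rw [mul_comm]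
    exact mul_le_mul_of_nonneg_left (hr.var_lower _ (h.abs_le_of_ne_zero hw) (h.ne_zero i))
      (sq_nonneg _)

/-- Fixes the scale (nh)^{-1/2} against which bias, first-stage error and standard-error remainder
must be negligible. -/
theorem seSq_lower {A B C L : ℝ} (hA : 0 < A) (hC : 0 < C) {n : ℕ} (hn : 0 < (n : ℝ) * D.h n)
    {η : D.Cov n → ℝ} (hr : RegularAt η B C L) {ω : D.Sample n} (h : GoodDesign A ω) :
    1 / (C * A) / ((n : ℝ) * D.h n) ≤ seSq η ω := by
  refine le_trans ?_ (seSq_ge hr h)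
  have := h.sum_sq_ge hA hn
  calc _ = 1 / C * (1 / (A * ((n : ℝ) * D.h n))) := by
        rw [div_div, one_div_mul_one_div, mul_assoc]
    _ ≤ _ := by gcongr

open Classical in
/-- Weights of the studentized estimator, set to zero for irregular designs. -/
noncomputable def studWeight (A : ℝ) {n : ℕ} (η : D.Cov n → ℝ) (ω : D.Sample n) (i : Fin n) : ℝ :=
  if GoodDesign A ω then weight 1 0 ω i / √(seSq η ω) else 0

/-- The studentized infeasible estimation error. -/
noncomputable def studentized (A : ℝ) {n : ℕ} (η : D.Cov n → ℝ) (ω : D.Sample n) : ℝ :=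
  ∑ i, studWeight A η ω i * resid η ω i

theorem measurable_seSq (hK : Measurable D.K) {n : ℕ} {η : D.Cov n → ℝ} (hη : Measurable η) :
    Measurable fun ω : D.Sample n => seSq η ω := by
  unfold seSq
  exact Finset.measurable_sum _ fun i _ => ((measurable_weight hK i).pow_const 2).mul
    ((measurable_varM hη).comp (measurable_X i))

theorem measurable_studWeight (hK : Measurable D.K) (A : ℝ) {n : ℕ} {η : D.Cov n → ℝ}
    (hη : Measurable η) (i : Fin n) : Measurable fun ω : D.Sample n => studWeight A η ω i := by
  unfold studWeight
  exact Measurable.ite (measurableSet_goodDesign hK A n)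
    ((measurable_weight hK i).div (measurable_seSq hK hη).sqrt) measurable_const

theorem measurable_studentized (hK : Measurable D.K) (A : ℝ) {n : ℕ} {η : D.Cov n → ℝ}
    (hη : Measurable η) : Measurable fun ω : D.Sample n => studentized A η ω := by
  unfold studentized
  exact Finset.measurable_sum _ fun i _ => (measurable_studWeight hK A hη i).mul
    (measurable_resid hη i)

/-- On a good design the studentized weights have conditional variance exactly 1, squares summing to
at most C, and maximum O((nh)^{-1/2}). The replacement bound therefore vanishes, and the Gaussian
mixture is exp(−t²/2) except on irregular designs, whose probability tends to zero. -/
theorem tendsto_charFun_studentized (hD : D.DesignRegularity) {etaBar : ∀ n, D.Cov n → ℝ}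
    (hη : ∀ n, Measurable (etaBar n)) {A B C L : ℝ} (hA : 0 < A) (hB : 0 ≤ B) (hC : 0 < C)
    (hgood : D.WHP fun _ ω => GoodDesign A ω)
    (hreg : ∀ᶠ n in atTop, RegularAt (etaBar n) B C L) (t : ℝ) :
    Tendsto (fun n => ∫ ω, Complex.exp ((t * studentized A (etaBar n) ω : ℝ) * Complex.I) ∂(D.P n))
      atTop (𝓝 ((Real.exp (-(t ^ 2 / 2)) : ℝ) : ℂ)) := by
  classical
  -- The largest studentized weight: A/(nh) divided by the lower bound (CA nh)^{-1/2} for the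
  -- conditional standard deviation.
  set κ : ℕ → ℝ := fun n => A * √(C * A) * √(((n : ℝ) * D.h n)⁻¹) with hκ
  have hκlim : Tendsto κ atTop (𝓝 0) := by
    have h1 : Tendsto (fun n : ℕ => √(((n : ℝ) * D.h n)⁻¹)) atTop (𝓝 0) := by
      simpa using hD.inv_nh_tendsto.sqrt
    have h2 := h1.const_mul (A * √(C * A))
    rwa [mul_zero] at h2
  set β : ℕ → ℝ := fun n => 4 * |t| ^ 3 * (κ n * C) * (1 + B) + t ^ 4 * (κ n ^ 2 * C) * (1 + B) ^ 2
    with hβ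
  have hβlim : Tendsto β atTop (𝓝 0) := by
    have h1 : Tendsto (fun n => 4 * |t| ^ 3 * (κ n * C) * (1 + B)) atTop
        (𝓝 (4 * |t| ^ 3 * (0 * C) * (1 + B))) := ((hκlim.mul_const C).const_mul _).mul_const _
    have h2 : Tendsto (fun n => t ^ 4 * (κ n ^ 2 * C) * (1 + B) ^ 2) atTop
        (𝓝 (t ^ 4 * (0 ^ 2 * C) * (1 + B) ^ 2)) :=
      (((hκlim.pow 2).mul_const C).const_mul _).mul_const _
    simpa using h1.add h2
  have hPlim : Tendsto (fun n => (D.P n).real {ω : D.Sample n | ¬ GoodDesign A ω}) atTop (𝓝 0) := by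
    have := (ENNReal.tendsto_toReal ENNReal.zero_ne_top).comp hgood
    simpa [Measure.real, Function.comp_def] using this
  rw [tendsto_iff_norm_sub_tendsto_zero]
  have hsum := hβlim.add hPlim
  rw [add_zero] at hsum
  refine squeeze_zero' (Eventually.of_forall fun n => norm_nonneg _) ?_ hsum
  filter_upwards [hreg, hD.nh_tendsto.eventually_gt_atTop 0] with n hr hn
  have hsqrt : ∀ ω : D.Sample n, GoodDesign A ω → 0 < seSq (etaBar n) ω := fun ω hg =>
    lt_of_lt_of_le (by positivity) (seSq_lower hA hC hn hr hg)
  have hvar : ∀ ω : D.Sample n, ∑ i, studWeight A (etaBar n) ω i ^ 2 * D.varM (etaBar n) (X ω i)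
      = if GoodDesign A ω then 1 else 0 := fun ω => by
    unfold studWeight
    split_ifs with hg
    · have hp := hsqrt ω hg
      simp_rw [div_pow, Real.sq_sqrt hp.le, div_mul_eq_mul_div]
      rw [← Finset.sum_div]
      exact div_self hp.ne'
    · simp
  have h1 := norm_charFun_sum_sub_le (hη n) hB (studWeight A (etaBar n))
    (measurable_studWeight hD.K_measurable A (hη n))
    (fun ω j v => by
      funext i
      simp only [studWeight, goodDesign_resample, weight_resample, seSq, X_resample])
    (fun ω i hi => by
      unfold studWeight at hi
      split_ifs at hi with hg
      · exact hr.moments _ (hg.abs_le_of_ne_zero fun h => hi (by rw [h, zero_div])) (hg.ne_zero i)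
      · exact absurd rfl hi)
    (κ := κ n) (c := C) (fun ω i => by
      unfold studWeight
      split_ifs with hg
      · have hp := hsqrt ω hg
        rw [abs_div, abs_of_nonneg (Real.sqrt_nonneg _), div_le_iff₀ (Real.sqrt_pos.2 hp)]
        have h2 : √(1 / (C * A) / ((n : ℝ) * D.h n)) ≤ √(seSq (etaBar n) ω) :=
          Real.sqrt_le_sqrt (seSq_lower hA hC hn hr hg)
        refine (hg.abs_le i).trans ?_
        have hκ0 : 0 ≤ κ n := by simp only [hκ]; positivity
        refine le_trans (le_of_eq ?_) (mul_le_mul_of_nonneg_left h2 hκ0)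
        simp only [hκ]
        have e1 : √(1 / (C * A) / ((n : ℝ) * D.h n)) = (√(C * A))⁻¹ * √(((n : ℝ) * D.h n)⁻¹) := by
          rw [div_eq_mul_inv, Real.sqrt_mul (by positivity), one_div, Real.sqrt_inv (C * A)]
        have e2 : √(((n : ℝ) * D.h n)⁻¹) * √(((n : ℝ) * D.h n)⁻¹) = ((n : ℝ) * D.h n)⁻¹ :=
          Real.mul_self_sqrt (by positivity)
        have e3 : √(C * A) ≠ 0 := (Real.sqrt_pos.2 (mul_pos hC hA)).ne'
        rw [e1]
        calc A / ((n : ℝ) * D.h n) = A * (√(C * A) * (√(C * A))⁻¹) *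
              (√(((n : ℝ) * D.h n)⁻¹) * √(((n : ℝ) * D.h n)⁻¹)) := by
              rw [e2, mul_inv_cancel₀ e3, mul_one]; rfl
          _ = _ := by ring
      · rw [abs_zero]; simp only [hκ]; positivity)
    (by simp only [hκ]; positivity) (fun ω => by
      unfold studWeight
      split_ifs with hg
      · have hp := hsqrt ω hg
        simp_rw [div_pow, Real.sq_sqrt hp.le]
        rw [← Finset.sum_div, div_le_iff₀ hp]
        have := seSq_ge hr hg
        rw [one_div, inv_mul_le_iff₀ hC] at this
        exact this
      · simp [hC.le]) t
  simp_rw [hvar] at h1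
  have h2 : ‖∫ ω : D.Sample n, ((Real.exp (-(t ^ 2 * (if GoodDesign A ω then (1 : ℝ) else 0) / 2)) : ℝ) : ℂ)
        ∂(D.P n) - ((Real.exp (-(t ^ 2 / 2)) : ℝ) : ℂ)‖
      ≤ (D.P n).real {ω : D.Sample n | ¬ GoodDesign A ω} := by
    have hms := measurableSet_goodDesign (D := D) hD.K_measurable A n
    have hc : ((Real.exp (-(t ^ 2 / 2)) : ℝ) : ℂ)
        = ∫ _ : D.Sample n, ((Real.exp (-(t ^ 2 / 2)) : ℝ) : ℂ) ∂(D.P n) := by simp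
    have hm : Measurable fun ω : D.Sample n =>
        ((Real.exp (-(t ^ 2 * (if GoodDesign A ω then (1 : ℝ) else 0) / 2)) : ℝ) : ℂ) := by
      have h0 : Measurable fun ω : D.Sample n => if GoodDesign A ω then (1 : ℝ) else 0 :=
        Measurable.ite hms measurable_const measurable_const
      fun_prop
    have hexp1 : Real.exp (-(t ^ 2 / 2)) ≤ 1 := Real.exp_le_one_iff.2 (by
      have := sq_nonneg t; linarith)
    have hexp0 := Real.exp_pos (-(t ^ 2 / 2))
    have hi : Integrable (fun ω : D.Sample n =>
        ((Real.exp (-(t ^ 2 * (if GoodDesign A ω then (1 : ℝ) else 0) / 2)) : ℝ) : ℂ)) (D.P n) := by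
      refine Integrable.of_bound hm.aestronglyMeasurable 1 (ae_of_all _ fun ω => ?_)
      rw [Complex.norm_real, Real.norm_eq_abs, Real.abs_exp, Real.exp_le_one_iff]
      split_ifs <;> nlinarith [sq_nonneg t]
    rw [hc, ← integral_sub hi (integrable_const _)]
    calc _ ≤ ∫ ω, ({ω : D.Sample n | ¬ GoodDesign A ω}.indicator (1 : D.Sample n → ℝ)) ω ∂(D.P n) := by
          refine norm_integral_le_of_norm_le ((integrable_const _).indicator hms.compl)
            (ae_of_all _ fun ω => ?_)
          by_cases hg : GoodDesign A ω
          · simp [hg]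
          · rw [Set.indicator_of_mem (by exact hg)]
            simp only [hg, if_false, mul_zero, zero_div, neg_zero, Real.exp_zero, Pi.one_apply]
            rw [← Complex.ofReal_sub, Complex.norm_real, Real.norm_eq_abs, abs_le]
            constructor <;> linarith
      _ = _ := integral_indicator_one hms.compl
  exact (norm_sub_le_norm_sub_add_norm_sub _ _ _).trans (add_le_add h1 h2)

/-- Central limit theorem for the studentized infeasible estimation error. -/
theorem eventually_studentized_lt (hD : D.DesignRegularity) {etaBar : ∀ n, D.Cov n → ℝ}
    (hη : ∀ n, Measurable (etaBar n)) {A B C L : ℝ} (hA : 0 < A) (hB : 0 ≤ B) (hC : 0 < C)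
    (hgood : D.WHP fun _ ω => GoodDesign A ω)
    (hreg : ∀ᶠ n in atTop, RegularAt (etaBar n) B C L) {z b : ℝ} (hb0 : 0 ≤ b)
    (hb : b < (gaussianReal 0 1).real (Set.Ioo (-z) z)) :
    ∀ᶠ n in atTop, b < (D.P n).real {ω | |studentized A (etaBar n) ω| < z} := by
  have hm := fun n => measurable_studentized (D := D) hD.K_measurable A (hη n)
  let μ : ℕ → ProbabilityMeasure ℝ := fun n =>
    ⟨(D.P n).map fun ω => studentized A (etaBar n) ω,
      Measure.isProbabilityMeasure_map (hm n).aemeasurable⟩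
  let g : ProbabilityMeasure ℝ := ⟨gaussianReal 0 1, inferInstance⟩
  have hlim : Tendsto μ atTop (𝓝 g) := by
    refine ProbabilityMeasure.tendsto_of_tendsto_charFun fun t => ?_
    have e1 : ∀ n, charFun (μ n : Measure ℝ) t
        = ∫ ω, Complex.exp ((t * studentized A (etaBar n) ω : ℝ) * Complex.I) ∂(D.P n) := fun n => by
      rw [charFun_apply_real]
      change ∫ x, Complex.exp (t * x * Complex.I)
        ∂((D.P n).map fun ω => studentized A (etaBar n) ω) = _
      rw [integral_map (hm n).aemeasurable]
      · simp
      · exact Measurable.aestronglyMeasurable (by fun_prop)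
    have e2 : charFun (g : Measure ℝ) t = ((Real.exp (-(t ^ 2 / 2)) : ℝ) : ℂ) := by
      change charFun (gaussianReal 0 1) t = _
      rw [charFun_gaussianReal]
      push_cast
      congr 1
      simp
    simp_rw [e1]
    rw [e2]
    exact tendsto_charFun_studentized hD hη hA hB hC hgood hreg t
  -- For open sets the portmanteau theorem bounds the liminf from below, which is the direction
  -- needed for coverage.
  have hport := ProbabilityMeasure.le_liminf_measure_open_of_tendsto hlim
    (isOpen_Ioo (a := -z) (b := z))
  have hb' : ENNReal.ofReal b < (gaussianReal 0 1) (Set.Ioo (-z) z) := by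
    rw [← ofReal_measureReal]
    exact (ENNReal.ofReal_lt_ofReal_iff_of_nonneg hb0).2 hb
  have hev := eventually_lt_of_lt_liminf (hb'.trans_le hport)
  filter_upwards [hev] with n hn
  have e : (μ n : Measure ℝ) (Set.Ioo (-z) z)
      = D.P n {ω | |studentized A (etaBar n) ω| < z} := by
    change (D.P n).map (fun ω => studentized A (etaBar n) ω) (Set.Ioo (-z) z) = _
    rw [Measure.map_apply (hm n) measurableSet_Ioo]
    congr 1
    ext ω
    simp [abs_lt]
  rw [e] at hn
  rwa [← ofReal_measureReal, ENNReal.ofReal_lt_ofReal_iff_of_nonneg hb0] at hn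

end RDSetup

/-! ### The first-stage error -/

theorem exists_linear_approx_left {f : ℝ → ℝ} {h c : ℝ} (hh : 0 < h) (hc : 0 ≤ c)
    (hf : ∀ x ∈ Set.Ico (-h) 0, DifferentiableAt ℝ f x)
    (hf' : ∀ x ∈ Set.Ico (-h) 0, DifferentiableAt ℝ (deriv f) x)
    (hb : ∀ x ∈ Set.Ico (-h) 0, |deriv (deriv f) x| ≤ c) :
    ∃ a b, Tendsto f (𝓝[<] 0) (𝓝 a) ∧ Tendsto (deriv f) (𝓝[<] 0) (𝓝 b) ∧
      ∀ x ∈ Set.Ico (-h) 0, |f x - a - b * x| ≤ c * x ^ 2 := by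
  have hmem : ∀ x ∈ Set.Ioc 0 h, -x ∈ Set.Ico (-h) 0 := fun x hx =>
    ⟨neg_le_neg hx.2, neg_lt_zero.2 hx.1⟩
  have d1 : deriv (fun x => f (-x)) = fun x => -deriv f (-x) := by
    funext x; exact deriv_comp_neg f x
  have d2 : ∀ x, deriv (fun x => -deriv f (-x)) x = deriv (deriv f) (-x) := fun x => by
    have : (fun x => -deriv f (-x)) = -fun x => deriv f (-x) := rfl
    rw [this, deriv.neg, deriv_comp_neg, neg_neg]
  have hneg : Tendsto (fun x : ℝ => -x) (𝓝[<] 0) (𝓝[>] 0) := by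
    have := tendsto_neg_nhdsLT (a := (0 : ℝ)); rwa [neg_zero] at this
  obtain ⟨a, b, h1, h2, h3⟩ := exists_linear_approx (f := fun x => f (-x)) hh hc
    (fun x hx => (differentiableAt_comp_neg).2 (hf _ (hmem x hx)))
    (fun x hx => by
      rw [d1]; exact ((differentiableAt_comp_neg (f := deriv f)).2 (hf' _ (hmem x hx))).neg)
    (fun x hx => by rw [d1, d2]; exact hb _ (hmem x hx))
  refine ⟨a, -b, by simpa [Function.comp_def] using h1.comp hneg, ?_, fun x hx => ?_⟩
  · have := (h2.comp hneg).neg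
    simpa [Function.comp_def, d1] using this
  · have := h3 (-x) ⟨neg_pos.2 hx.2, by linarith [hx.1]⟩
    rw [neg_neg, neg_sq] at this
    rwa [show f x - a - -b * x = f x - a - b * -x by ring]

theorem integrable_of_lintegral_sq {Ω : Type*} [MeasurableSpace Ω] {ν : Measure Ω}
    [IsProbabilityMeasure ν] {g : Ω → ℝ} (hg : Measurable g) {ρ : ℝ}
    (h : ∫⁻ u, ENNReal.ofReal (g u ^ 2) ∂ν ≤ ENNReal.ofReal ρ) : MemLp g 2 ν := by
  rw [memLp_two_iff_integrable_sq hg.aestronglyMeasurable]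
  refine ⟨(hg.pow_const 2).aestronglyMeasurable, ?_⟩
  rw [hasFiniteIntegral_iff_ofReal (ae_of_all _ fun ω => sq_nonneg _)]
  exact h.trans_lt ENNReal.ofReal_lt_top

theorem lintegral_sub_integral_sq_le {Ω : Type*} [MeasurableSpace Ω] {ν : Measure Ω}
    [IsProbabilityMeasure ν] {g : Ω → ℝ} (hg : Measurable g) {ρ : ℝ}
    (h : ∫⁻ u, ENNReal.ofReal (g u ^ 2) ∂ν ≤ ENNReal.ofReal ρ) :
    ∫⁻ u, ENNReal.ofReal ((g u - ∫ u', g u' ∂ν) ^ 2) ∂ν ≤ ENNReal.ofReal ρ := by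
  have hL := integrable_of_lintegral_sq hg h
  have hL' : MemLp (fun u => g u - ∫ u', g u' ∂ν) 2 ν := hL.sub (memLp_const _)
  rw [← ofReal_integral_eq_lintegral_ofReal hL.integrable_sq (ae_of_all _ fun _ => sq_nonneg _)]
    at h
  rw [← ofReal_integral_eq_lintegral_ofReal hL'.integrable_sq (ae_of_all _ fun _ => sq_nonneg _)]
  refine le_trans (ENNReal.ofReal_le_ofReal ?_) h
  rw [← variance_eq_integral hg.aemeasurable]
  exact variance_le_expectation_sq hg.aestronglyMeasurable

theorem abs_integral_le_sqrt {Ω : Type*} [MeasurableSpace Ω] {ν : Measure Ω}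
    [IsProbabilityMeasure ν] {g : Ω → ℝ} (hg : Measurable g) {ρ : ℝ} (hρ : 0 ≤ ρ)
    (h : ∫⁻ u, ENNReal.ofReal (g u ^ 2) ∂ν ≤ ENNReal.ofReal ρ) : |∫ u, g u ∂ν| ≤ √ρ := by
  have hL := integrable_of_lintegral_sq hg h
  rw [← ofReal_integral_eq_lintegral_ofReal hL.integrable_sq (ae_of_all _ fun _ => sq_nonneg _),
    ENNReal.ofReal_le_ofReal_iff hρ] at h
  have h1 := variance_nonneg g ν
  rw [variance_eq_sub hL] at h1
  refine Real.abs_le_sqrt ?_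
  simp only [Pi.pow_apply] at h1
  linarith

namespace RDSetup

variable {D : RDSetup}

/-- The fold assignment takes finitely many values, and for each of them the estimation sample is a
fixed set of units, where measurability is assumed. -/
theorem measurable_etaHatCF {n : ℕ} (σ : (Fin n → Fin D.S) → Fin D.S) :
    Measurable fun p : D.Sample n × D.Cov n => etaHatCF p.1 (σ p.1.1) p.2 := by
  have h : Measurable fun q : (Fin n → Fin D.S) × ((Fin n → RDObs (D.d n)) × D.Cov n) =>
      etaHatCF ((q.1, q.2.1) : D.Sample n) (σ q.1) q.2.2 := by
    refine measurable_from_prod_countable_right fun f => ?_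
    have hm := D.measurable_etaHat n
      (Finset.univ.filter fun i => fold ((f, default) : D.Sample n) i ≠ σ f)
    exact hm.comp (f := fun q : (Fin n → RDObs (D.d n)) × D.Cov n =>
      ((fun j : {x // x ∈ Finset.univ.filter fun i => fold ((f, default) : D.Sample n) i ≠ σ f} =>
        q.1 j), q.2)) (by fun_prop)
  exact h.comp (f := fun p : D.Sample n × D.Cov n => (p.1.1, (p.1.2, p.2))) (by fun_prop)

/-- This is where cross-fitting enters: unit j is not in the sample from which the estimate for its
own fold is computed. -/
theorem etaHatCF_resample {n : ℕ} (ω : D.Sample n) (j : Fin n) (v : ℝ × D.Cov n) :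
    etaHatCF (resample ω j v) (fold ω j) = etaHatCF ω (fold ω j) := by
  change D.etaHat n (Finset.univ.filter fun i => fold ω i ≠ fold ω j) _
    = D.etaHat n (Finset.univ.filter fun i => fold ω i ≠ fold ω j) _
  congr 1
  funext i
  refine resample_snd_ne ω (fun h => ?_) v
  have := (Finset.mem_filter.1 i.2).2
  rw [h] at this
  exact this rfl

open Classical in
/-- First-stage estimation error for unit `i` as a function of the covariates, set to zero if its
conditional second moment given `X_i` exceeds `ρ`. -/
noncomputable def truncErr {n : ℕ} (ρ : ℝ) (η : D.Cov n → ℝ) (ω : D.Sample n) (i : Fin n)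
    (z : D.Cov n) : ℝ :=
  if ∫⁻ u, ENNReal.ofReal ((etaHatCF ω (fold ω i) u.2 - η u.2) ^ 2) ∂(D.cond n (X ω i))
    ≤ ENNReal.ofReal ρ then etaHatCF ω (fold ω i) z - η z else 0

theorem truncErr_resample {n : ℕ} (ρ : ℝ) (η : D.Cov n → ℝ) (ω : D.Sample n) {i j : Fin n}
    (h : fold ω i = fold ω j) (v : ℝ × D.Cov n) :
    truncErr ρ η (resample ω j v) i = truncErr ρ η ω i := by
  funext z
  simp only [truncErr, fold_resample, h, etaHatCF_resample, X_resample]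

theorem measurable_truncErr {n : ℕ} (ρ : ℝ) {η : D.Cov n → ℝ} (hη : Measurable η) (i : Fin n) :
    Measurable fun p : D.Sample n × D.Cov n => truncErr ρ η p.1 i p.2 := by
  have h0 : Measurable fun p : D.Sample n × D.Cov n =>
      etaHatCF p.1 (fold p.1 i) p.2 - η p.2 :=
    (measurable_etaHatCF fun f => f i).sub (hη.comp measurable_snd)
  have h1 : Measurable fun p : D.Sample n × (ℝ × D.Cov n) =>
      ENNReal.ofReal ((etaHatCF p.1 (fold p.1 i) p.2.2 - η p.2.2) ^ 2) :=
    ((h0.comp (f := fun p : D.Sample n × (ℝ × D.Cov n) => (p.1, p.2.2)) (by fun_prop)).pow_const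
      2).ennreal_ofReal
  have h2 : Measurable fun ω : D.Sample n => ∫⁻ u,
      ENNReal.ofReal ((etaHatCF ω (fold ω i) u.2 - η u.2) ^ 2) ∂(D.cond n (X ω i)) :=
    Measurable.lintegral_kernel_prod_right (κ := condAt n i) h1
  unfold truncErr
  exact Measurable.ite (measurableSet_le (h2.comp measurable_fst) measurable_const) h0
    measurable_const

theorem measurable_truncErr_apply {n : ℕ} (ρ : ℝ) {η : D.Cov n → ℝ} (hη : Measurable η)
    (ω : D.Sample n) (i : Fin n) : Measurable (truncErr ρ η ω i) :=
  (measurable_truncErr ρ hη i).comp measurable_prodMk_left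

theorem measurable_Z {n : ℕ} (i : Fin n) : Measurable fun ω : D.Sample n => Z ω i := by
  unfold Z; fun_prop

theorem Z_resample_self {n : ℕ} (ω : D.Sample n) (i : Fin n) (v : ℝ × D.Cov n) :
    Z (resample ω i v) i = v.2 := by simp [Z, resample_snd_self]

theorem Z_resample_ne {n : ℕ} (ω : D.Sample n) {i j : Fin n} (h : j ≠ i) (v : ℝ × D.Cov n) :
    Z (resample ω i v) j = Z ω j := by simp [Z, resample_snd_ne ω h]

theorem lintegral_truncErr_sq_le {n : ℕ} {ρ : ℝ} (η : D.Cov n → ℝ) (ω : D.Sample n)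
    (i : Fin n) :
    ∫⁻ u, ENNReal.ofReal (truncErr ρ η ω i u.2 ^ 2) ∂(D.cond n (X ω i)) ≤ ENNReal.ofReal ρ := by
  unfold truncErr
  split_ifs with h
  · exact h
  · simp

/-- Conditional mean of the truncated first-stage error. -/
noncomputable def truncMean {n : ℕ} (ρ : ℝ) (η : D.Cov n → ℝ) (ω : D.Sample n) (i : Fin n) : ℝ :=
  ∫ u, truncErr ρ η ω i u.2 ∂(D.cond n (X ω i))

theorem measurable_truncMean {n : ℕ} (ρ : ℝ) {η : D.Cov n → ℝ} (hη : Measurable η) (i : Fin n) :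
    Measurable fun ω : D.Sample n => truncMean ρ η ω i := by
  have h : Measurable fun p : D.Sample n × (ℝ × D.Cov n) => truncErr ρ η p.1 i p.2.2 :=
    (measurable_truncErr ρ hη i).comp (f := fun p : D.Sample n × (ℝ × D.Cov n) => (p.1, p.2.2))
      (by fun_prop)
  exact (StronglyMeasurable.integral_kernel_prod_right (κ := condAt (D := D) n i)
    (f := fun ω u => truncErr ρ η ω i u.2) h.stronglyMeasurable).measurable

/-- Second moment of the centred first-stage errors of the units in one fold, for weights that
depend on the folds and running variables only. -/
theorem lintegral_sq_fold_error_le {n : ℕ} {ρ : ℝ} {η : D.Cov n → ℝ}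
    (hη : Measurable η) (s : Fin D.S) (b : D.Sample n → Fin n → ℝ)
    (hb : ∀ i, Measurable fun ω => b ω i) (hinv : ∀ ω j v, b (resample ω j v) = b ω)
    (hs : ∀ ω i, b ω i ≠ 0 → fold ω i = s) {c : ℝ} (hc : ∀ ω, ∑ i, b ω i ^ 2 ≤ c) :
    ∫⁻ ω, ENNReal.ofReal ((∑ i, b ω i * (truncErr ρ η ω i (Z ω i) - truncMean ρ η ω i)) ^ 2)
      ∂(D.P n) ≤ ENNReal.ofReal c * ENNReal.ofReal ρ := by
  set Y : Fin n → D.Sample n → ℝ := fun i ω =>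
    b ω i * (truncErr ρ η ω i (Z ω i) - truncMean ρ η ω i) with hY
  have mY : ∀ i, Measurable (Y i) := fun i => by
    refine (hb i).mul (Measurable.sub ?_ (measurable_truncMean ρ hη i))
    exact (measurable_truncErr ρ hη i).comp (f := fun ω : D.Sample n => (ω, Z ω i))
      (measurable_id.prodMk (measurable_Z i))
  have hself : ∀ i ω v, Y i (resample ω i v)
      = b ω i * (truncErr ρ η ω i v.2 - truncMean ρ η ω i) := fun i ω v => by
    simp only [hY, hinv, truncErr_resample ρ η ω rfl, Z_resample_self, truncMean, X_resample]
  have hmt : ∀ ω i, Measurable fun u : ℝ × D.Cov n => truncErr ρ η ω i u.2 := fun ω i =>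
    (measurable_truncErr_apply ρ hη ω i).comp measurable_snd
  refine (lintegral_sum_sq_le_of_orthogonal _ Finset.univ Y (fun i _ => mY i)
    fun i _ j _ hij => ?_).trans ?_
  -- Units with nonzero weight share the fold `s`. Redrawing one of them thus alters neither η̂_s
  -- nor the other unit's factor, and its own centred error integrates to zero.
  · refine integral_eq_zero_of_resample i fun ω => ?_
    by_cases hi : b ω i = 0
    · simp [hself, hi]
    by_cases hj : b ω j = 0
    · simp [hY, hinv, hj]
    have hfold : fold ω j = fold ω i := (hs ω j hj).trans (hs ω i hi).symm
    have e : ∀ v, Y i (resample ω i v) * Y j (resample ω i v)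
        = (b ω i * Y j ω) * (truncErr ρ η ω i v.2 - truncMean ρ η ω i) := fun v => by
      rw [hself]
      simp only [hY, hinv, truncErr_resample ρ η ω hfold, Z_resample_ne ω hij.symm, truncMean,
        X_resample]
      ring
    simp_rw [e]
    rw [integral_const_mul]
    have hL := integrable_of_lintegral_sq (hmt ω i) (lintegral_truncErr_sq_le η ω i)
    rw [integral_sub (hL.integrable one_le_two) (integrable_const _)]
    simp [truncMean]
  · have h1 : ∀ i ∈ (Finset.univ : Finset (Fin n)), ∫⁻ ω, ENNReal.ofReal (Y i ω ^ 2) ∂(D.P n)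
        ≤ ∫⁻ ω, ENNReal.ofReal (b ω i ^ 2) * ENNReal.ofReal ρ ∂(D.P n) := fun i _ => by
      rw [lintegral_eq_resample i ((mY i).pow_const 2).ennreal_ofReal]
      refine lintegral_mono fun ω => ?_
      simp_rw [hself, _root_.mul_pow, ENNReal.ofReal_mul (sq_nonneg (b ω i))]
      rw [lintegral_const_mul' _ _ ENNReal.ofReal_ne_top]
      gcongr
      exact lintegral_sub_integral_sq_le (hmt ω i) (lintegral_truncErr_sq_le η ω i)
    refine (Finset.sum_le_sum h1).trans ?_
    rw [← lintegral_finsetSum _ fun i _ => ((hb i).pow_const 2).ennreal_ofReal.mul_const _]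
    calc _ ≤ ∫⁻ _, ENNReal.ofReal c * ENNReal.ofReal ρ ∂(D.P n) := lintegral_mono fun ω => by
            rw [← Finset.sum_mul, ← ENNReal.ofReal_sum_of_nonneg fun i _ => sq_nonneg _]
            gcongr
            exact hc ω
      _ = _ := by simp

/-- Membership in the class ℰ makes value and slope agree from both sides of the cutoff. The
expansions on the two sides therefore share one line, which the difference of the left and right
weights can cancel. -/
theorem continuousAt_of_admissible {n : ℕ} {η η' : D.Cov n → ℝ} (hη : η ∈ D.admissible n)
    (hη' : η' ∈ D.admissible n) :
    ContinuousAt (D.condMean n fun u => η u.2 - η' u.2) 0 ∧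
      ContinuousAt (deriv (D.condMean n fun u => η u.2 - η' u.2)) 0 := by
  obtain ⟨-, δ₁, hδ₁, i₁, c₁⟩ := hη
  obtain ⟨-, δ₂, hδ₂, i₂, c₂⟩ := hη'
  have hδ : 0 < min δ₁ δ₂ := lt_min hδ₁ hδ₂
  have s₁ : Set.Ioo (-(min δ₁ δ₂)) (min δ₁ δ₂) ⊆ Set.Ioo (-δ₁) δ₁ :=
    Set.Ioo_subset_Ioo (neg_le_neg (min_le_left _ _)) (min_le_left _ _)
  have s₂ : Set.Ioo (-(min δ₁ δ₂)) (min δ₁ δ₂) ⊆ Set.Ioo (-δ₂) δ₂ :=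
    Set.Ioo_subset_Ioo (neg_le_neg (min_le_right _ _)) (min_le_right _ _)
  have hc : ContDiffOn ℝ 2 (D.condMean n fun u => η u.2 - η' u.2)
      (Set.Ioo (-(min δ₁ δ₂)) (min δ₁ δ₂)) := by
    refine ((c₁.mono s₁).sub (c₂.mono s₂)).congr fun x hx => ?_
    exact integral_sub (i₁ x (s₁ hx)) (i₂ x (s₂ hx))
  have hn : Set.Ioo (-(min δ₁ δ₂)) (min δ₁ δ₂) ∈ 𝓝 (0 : ℝ) :=
    Ioo_mem_nhds (neg_lt_zero.2 hδ) hδ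
  exact ⟨hc.continuousOn.continuousAt hn,
    (hc.continuousOn_deriv_of_isOpen isOpen_Ioo (by norm_num)).continuousAt hn⟩

/-- Linear expansion of the conditional mean of the first-stage error around the cutoff. -/
theorem exists_linear_approx_condMean {n : ℕ} {η η' : D.Cov n → ℝ} (hη : η ∈ D.admissible n)
    (hη' : η' ∈ D.admissible n) {h ρ c₁ c₂ : ℝ} (hh : 0 < h) (hρ : 0 ≤ ρ)
    (h0 : ∫⁻ u, ENNReal.ofReal ((η u.2 - η' u.2) ^ 2) ∂(D.cond n 0) ≤ ENNReal.ofReal ρ)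
    (hd : ∀ x, |x| ≤ h → x ≠ 0 → DifferentiableAt ℝ (D.condMean n fun u => η u.2 - η' u.2) x ∧
      DifferentiableAt ℝ (deriv (D.condMean n fun u => η u.2 - η' u.2)) x ∧
      |deriv (D.condMean n fun u => η u.2 - η' u.2) x| ≤ c₁ ∧
      |deriv (deriv (D.condMean n fun u => η u.2 - η' u.2)) x| ≤ c₂) :
    ∃ a b, |a| ≤ √ρ ∧ |b| ≤ c₁ ∧ ∀ x, |x| ≤ h →
      |D.condMean n (fun u => η u.2 - η' u.2) x - a - b * x| ≤ c₂ * x ^ 2 := by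
  set m := D.condMean n fun u => η u.2 - η' u.2 with hm
  obtain ⟨hc, hc'⟩ := continuousAt_of_admissible hη hη'
  have hpos : ∀ x ∈ Set.Ioc 0 h, |x| ≤ h ∧ x ≠ 0 := fun x hx =>
    ⟨by rw [abs_of_pos hx.1]; exact hx.2, hx.1.ne'⟩
  have hneg : ∀ x ∈ Set.Ico (-h) 0, |x| ≤ h ∧ x ≠ 0 := fun x hx =>
    ⟨by rw [abs_of_neg hx.2]; linarith [hx.1], hx.2.ne⟩
  have hhm := hd h (by rw [abs_of_pos hh]) hh.ne'
  have hc₂ : 0 ≤ c₂ := (abs_nonneg _).trans hhm.2.2.2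
  obtain ⟨a, b, ha, hb, hab⟩ := exists_linear_approx hh hc₂
    (fun x hx => (hd x (hpos x hx).1 (hpos x hx).2).1)
    (fun x hx => (hd x (hpos x hx).1 (hpos x hx).2).2.1)
    (fun x hx => (hd x (hpos x hx).1 (hpos x hx).2).2.2.2)
  obtain ⟨a', b', ha', hb', hab'⟩ := exists_linear_approx_left hh hc₂
    (fun x hx => (hd x (hneg x hx).1 (hneg x hx).2).1)
    (fun x hx => (hd x (hneg x hx).1 (hneg x hx).2).2.1)
    (fun x hx => (hd x (hneg x hx).1 (hneg x hx).2).2.2.2)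
  -- Intercepts and slopes of the two one-sided expansions are identified with the value and
  -- derivative at 0.
  have ea := tendsto_nhds_unique ha (hc.mono_left nhdsWithin_le_nhds)
  have ea' := tendsto_nhds_unique ha' (hc.mono_left nhdsWithin_le_nhds)
  have eb := tendsto_nhds_unique hb (hc'.mono_left nhdsWithin_le_nhds)
  have eb' := tendsto_nhds_unique hb' (hc'.mono_left nhdsWithin_le_nhds)
  subst ea ea' eb eb'
  refine ⟨m 0, deriv m 0, ?_, ?_, fun x hx => ?_⟩
  · have hmeas : Measurable fun u : ℝ × D.Cov n => η u.2 - η' u.2 :=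
      (hη.1.comp measurable_snd).sub (hη'.1.comp measurable_snd)
    exact abs_integral_le_sqrt hmeas hρ h0
  · refine le_of_tendsto hb.abs ?_
    filter_upwards [Ioc_mem_nhdsGT hh] with x hx
    exact (hd x (hpos x hx).1 (hpos x hx).2).2.2.1
  · rcases lt_trichotomy x 0 with hx0 | hx0 | hx0
    · exact hab' x ⟨(abs_le.1 hx).1, hx0⟩
    · subst hx0; simp
    · exact hab x ⟨hx0, (abs_le.1 hx).2⟩

end RDSetup

namespace RDSetup

variable {D : RDSetup}

theorem IsLittleOP.abs {ξ : ∀ n, D.Sample n → ℝ} (hξ : D.IsLittleOP ξ) :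
    D.IsLittleOP fun n ω => |ξ n ω| :=
  hξ.mono (WHP.of_eventually (Eventually.of_forall fun _ _ => (abs_abs _).le))

theorem FirstStage.exists_rate {T : ∀ n, Set (D.Cov n → ℝ)} {etaBar : ∀ n, D.Cov n → ℝ}
    {A : ℕ → Set ℝ} (h : D.FirstStage T etaBar A) :
    ∃ ρ : ℕ → ℝ, (∀ n, 0 ≤ ρ n) ∧ Tendsto ρ atTop (𝓝 0) ∧ ∀ᶠ n in atTop, ∀ η ∈ T n, ∀ x ∈ A n,
      ∫⁻ u, ENNReal.ofReal ((η u.2 - etaBar n u.2) ^ 2) ∂(D.cond n x) ≤ ENNReal.ofReal (ρ n) := by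
  obtain ⟨r, hr, c, hc⟩ := h.rate
  refine ⟨fun n => |c| * r n ^ 2, fun n => by positivity, ?_, ?_⟩
  · simpa using (hr.pow 2).const_mul |c|
  · filter_upwards [hc] with n hn η hη x hx
    refine (hn η hη x hx).trans (ENNReal.ofReal_le_ofReal ?_)
    exact mul_le_mul_of_nonneg_right (le_abs_self c) (sq_nonneg _)

theorem FirstStage.whp_mem {T : ∀ n, Set (D.Cov n → ℝ)} {etaBar : ∀ n, D.Cov n → ℝ}
    {A : ℕ → Set ℝ} (h : D.FirstStage T etaBar A) :
    D.WHP fun n ω => ∀ s, etaHatCF ω s ∈ T n :=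
  WHP.forall_fin (p := fun s n ω => etaHatCF ω s ∈ T n) h.prob

theorem truncErr_eq {n : ℕ} {ρ : ℝ} {η : D.Cov n → ℝ} {ω : D.Sample n} {i : Fin n}
    (h : ∫⁻ u, ENNReal.ofReal ((etaHatCF ω (fold ω i) u.2 - η u.2) ^ 2) ∂(D.cond n (X ω i))
      ≤ ENNReal.ofReal ρ) :
    truncErr ρ η ω i = fun z => etaHatCF ω (fold ω i) z - η z := by
  funext z
  rw [truncErr, if_pos h]

theorem measurableSet_fold_eq {n : ℕ} (i : Fin n) (s : Fin D.S) :
    MeasurableSet {ω : D.Sample n | fold ω i = s} :=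
  measurable_fst (measurableSet_eq_fun (measurable_pi_apply i) measurable_const :
    MeasurableSet {f : Fin n → Fin D.S | f i = s})

open Classical in
/-- Replacing the first-stage estimate by its limit does not affect the estimator to first
order. -/
theorem isLittleOP_first_stage_error (hD : D.DesignRegularity) {T : ∀ n, Set (D.Cov n → ℝ)}
    {etaBar : ∀ n, D.Cov n → ℝ} (hfirst : D.FirstStage T etaBar D.suppXh)
    (hderiv : D.DerivativeRates T etaBar) {A : ℝ} (hA : 0 < A)
    (hgood : D.WHP fun _ ω => GoodDesign A ω)
    (hunder : Tendsto (fun n : ℕ => (n : ℝ) * D.h n ^ 5) atTop (𝓝 0)) :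
    D.IsLittleOP fun n ω => √((n : ℝ) * D.h n) *
      ∑ i, weight 1 0 ω i * (etaHatCF ω (fold ω i) (Z ω i) - etaBar n (Z ω i)) := by
  obtain ⟨ρ, hρ0, hρ, hrate⟩ := hfirst.exists_rate
  obtain ⟨v₁, v₂, hv₁, hv₂, c, hc⟩ := hderiv
  have hη : ∀ n, Measurable (etaBar n) := fun n => (hfirst.subset n (hfirst.mem n)).1
  -- Setting the weights to zero on irregular designs makes the bound on their sum of squares hold
  -- for every sample, as the second-moment estimate requires.
  set b : ∀ n, Fin D.S → D.Sample n → Fin n → ℝ := fun n s ω i =>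
    if GoodDesign A ω ∧ fold ω i = s then √((n : ℝ) * D.h n) * weight 1 0 ω i else 0 with hbdef
  have hfl : ∀ s : Fin D.S, D.IsLittleOP fun n ω => ∑ i, b n s ω i *
      (truncErr (ρ n) (etaBar n) ω i (Z ω i) - truncMean (ρ n) (etaBar n) ω i) := by
    intro s
    have hbm : ∀ n i, Measurable fun ω : D.Sample n => b n s ω i := fun n i =>
      Measurable.ite ((measurableSet_goodDesign hD.K_measurable A n).inter
        (measurableSet_fold_eq i s)) ((measurable_weight hD.K_measurable i).const_mul _)
        measurable_const
    refine IsLittleOP.of_lintegral_sq (β := fun n => A ^ 3 * ρ n) (fun n => ?_)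
      (by simpa using hρ.const_mul (A ^ 3)) ?_
    · refine Finset.measurable_sum _ fun i _ => (hbm n i).mul (Measurable.sub ?_
        (measurable_truncMean _ (hη n) i))
      exact (measurable_truncErr _ (hη n) i).comp (f := fun ω : D.Sample n => (ω, Z ω i))
        (measurable_id.prodMk (measurable_Z i))
    · filter_upwards [hD.nh_tendsto.eventually_gt_atTop 0] with n hn
      rw [ENNReal.ofReal_mul (by positivity)]
      refine lintegral_sq_fold_error_le (hη n) s (b n s) (hbm n) (fun ω j v => ?_)
        (fun ω i hi => ?_) (fun ω => ?_)
      · funext i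
        simp only [hbdef, goodDesign_resample, fold_resample, weight_resample]
      · by_contra h
        exact hi (if_neg fun h' => h h'.2)
      · by_cases hg : GoodDesign A ω
        · calc ∑ i, b n s ω i ^ 2 ≤ ∑ i, (n : ℝ) * D.h n * weight 1 0 ω i ^ 2 := by
                refine Finset.sum_le_sum fun i _ => ?_
                simp only [hbdef]
                split_ifs
                · rw [_root_.mul_pow, Real.sq_sqrt hn.le]
                · rw [zero_pow two_ne_zero]; positivity
            _ = (n : ℝ) * D.h n * ∑ i, weight 1 0 ω i ^ 2 := by rw [Finset.mul_sum]
            _ ≤ (n : ℝ) * D.h n * (A ^ 3 / ((n : ℝ) * D.h n)) :=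
                mul_le_mul_of_nonneg_left (hg.sum_sq_le hA.le hn) hn.le
            _ = A ^ 3 := mul_div_cancel₀ _ hn.ne'
        · simp [hbdef, hg]; positivity
  -- The rates are the bounds on the approximating line: its intercept is at most √ρ by the L² rate,
  -- and its slope, multiplied by h for the scaled variable, at most c |v₁| h.
  have hF0 := fun s : Fin D.S => isLittleOP_fold_sum hD s (Or.inl rfl) (r := fun n => √(ρ n))
    (by simpa using hρ.sqrt)
  have hF1 := fun s : Fin D.S => isLittleOP_fold_sum hD s (Or.inr rfl)
    (r := fun n => c * |v₁ n| * D.h n)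
    (by simpa using ((hv₁.abs.const_mul c).mul hD.h_tendsto))
  -- The quadratic remainder is of order √(nh) · h² = √(nh⁵); this is where undersmoothing is used.
  have hdet : Tendsto (fun n : ℕ => √((n : ℝ) * D.h n ^ 5) * (c * |v₂ n| * A ^ 2)) atTop (𝓝 0) := by
    simpa using hunder.sqrt.mul ((hv₂.abs.const_mul c).mul_const (A ^ 2))
  have hdom := IsLittleOP.sum Finset.univ fun s (_ : s ∈ (Finset.univ : Finset (Fin D.S))) =>
    (((hfl s).abs.add (hF0 s).abs).add (hF1 s).abs).add (IsLittleOP.of_tendsto hdet).abs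
  refine hdom.mono ((hgood.and hfirst.whp_mem).mono ?_)
  filter_upwards [hrate, hc, hD.eventually_mem_suppX, hD.nh_tendsto.eventually_gt_atTop 0]
    with n hraten hcn hsupp hn ω hω
  obtain ⟨hg, hT⟩ := hω
  have hh := hD.h_pos n
  have hX : ∀ x, |x| ≤ D.h n → x ∈ D.suppXh n := fun x hx => ⟨hsupp x hx, abs_le.1 hx⟩
  -- When the estimates lie in `T n`, the truncation is inactive throughout the window.
  have htr : ∀ i, |X ω i| ≤ D.h n → truncErr (ρ n) (etaBar n) ω i
      = fun z => etaHatCF ω (fold ω i) z - etaBar n z := fun i hi =>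
    truncErr_eq (hraten _ (hT _) _ (hX _ hi))
  have happrox : ∀ s : Fin D.S, ∃ a β, |a| ≤ √(ρ n) ∧ |β| ≤ c * |v₁ n| ∧ ∀ x, |x| ≤ D.h n →
      |D.condMean n (fun u => etaHatCF ω s u.2 - etaBar n u.2) x - a - β * x|
        ≤ c * |v₂ n| * x ^ 2 := fun s =>
    exists_linear_approx_condMean (hfirst.subset n (hT s)) (hfirst.subset n (hfirst.mem n)) hh
      (hρ0 n) (hraten _ (hT s) 0 (hX 0 (by simpa using hh.le))) fun x hx hx0 => by
        obtain ⟨h1, h2, h3, h4⟩ := hcn _ (hT s) x ⟨hX x hx, hx0⟩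
        exact ⟨h1.self_of_nhds, h2, h3, h4⟩
  choose a β ha hβ hab using happrox
  -- For each fold, the error is split into its part centred given X and its conditional mean.
  have hsplit : √((n : ℝ) * D.h n) *
      ∑ i, weight 1 0 ω i * (etaHatCF ω (fold ω i) (Z ω i) - etaBar n (Z ω i))
      = ∑ s : Fin D.S, (∑ i, b n s ω i *
        (truncErr (ρ n) (etaBar n) ω i (Z ω i) - truncMean (ρ n) (etaBar n) ω i)
        + √((n : ℝ) * D.h n) * ∑ i, if fold ω i = s then weight 1 0 ω i *
          D.condMean n (fun u => etaHatCF ω s u.2 - etaBar n u.2) (X ω i) else 0) := by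
    simp_rw [Finset.mul_sum]
    rw [Finset.sum_add_distrib, Finset.sum_comm (γ := Fin D.S),
      Finset.sum_comm (γ := Fin D.S) (f := fun s i => √((n : ℝ) * D.h n) *
        if fold ω i = s then weight 1 0 ω i *
          D.condMean n (fun u => etaHatCF ω s u.2 - etaBar n u.2) (X ω i) else 0),
      ← Finset.sum_add_distrib]
    refine Finset.sum_congr rfl fun i _ => ?_
    have e1 : ∑ s : Fin D.S, b n s ω i *
        (truncErr (ρ n) (etaBar n) ω i (Z ω i) - truncMean (ρ n) (etaBar n) ω i)
        = √((n : ℝ) * D.h n) * weight 1 0 ω i *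
        (truncErr (ρ n) (etaBar n) ω i (Z ω i) - truncMean (ρ n) (etaBar n) ω i) := by
      rw [Finset.sum_eq_single (fold ω i)]
      · simp [hbdef, hg]
      · intro s _ hs; simp [hbdef, hs.symm]
      · simp
    have e2 : ∑ s : Fin D.S, (√((n : ℝ) * D.h n) * if fold ω i = s then weight 1 0 ω i *
          D.condMean n (fun u => etaHatCF ω s u.2 - etaBar n u.2) (X ω i) else 0)
        = √((n : ℝ) * D.h n) * (weight 1 0 ω i *
          D.condMean n (fun u => etaHatCF ω (fold ω i) u.2 - etaBar n u.2) (X ω i)) := by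
      rw [Finset.sum_eq_single (fold ω i)]
      · simp
      · intro s _ hs; simp [hs.symm]
      · simp
    rw [e1, e2]
    by_cases hw : weight 1 0 ω i = 0
    · simp [hw]
    · have hx := hg.abs_le_of_ne_zero hw
      have e3 : truncMean (ρ n) (etaBar n) ω i
          = D.condMean n (fun u => etaHatCF ω (fold ω i) u.2 - etaBar n u.2) (X ω i) := by
        simp only [truncMean, condMean, htr i hx]
      rw [e3, htr i hx]
      ring
  rw [hsplit]
  refine (Finset.abs_sum_le_sum_abs _ _).trans (le_trans (Finset.sum_le_sum fun s _ => ?_)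
    (le_abs_self _))
  refine (abs_add_le _ _).trans ?_
  rw [add_assoc, add_assoc]
  refine add_le_add le_rfl ?_
  rw [abs_mul, abs_of_nonneg (Real.sqrt_nonneg _)]
  set F0 := ∑ i, (if fold ω i = s then weight 1 0 ω i * (X ω i / D.h n) ^ 0 else 0) with hF0d
  set F1 := ∑ i, (if fold ω i = s then weight 1 0 ω i * (X ω i / D.h n) ^ 1 else 0) with hF1d
  set Rm := ∑ i, (if fold ω i = s then weight 1 0 ω i *
    (D.condMean n (fun u => etaHatCF ω s u.2 - etaBar n u.2) (X ω i) - a s - β s * X ω i) else 0)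
    with hRm
  have e4 : (∑ i, if fold ω i = s then weight 1 0 ω i *
          D.condMean n (fun u => etaHatCF ω s u.2 - etaBar n u.2) (X ω i) else 0)
      = a s * F0 + β s * D.h n * F1 + Rm := by
    rw [hF0d, hF1d, hRm, Finset.mul_sum, Finset.mul_sum, ← Finset.sum_add_distrib,
      ← Finset.sum_add_distrib]
    refine Finset.sum_congr rfl fun i _ => ?_
    split_ifs
    · field_simp; ring
    · simp
  have hRb : |Rm| ≤ c * |v₂ n| * D.h n ^ 2 * A ^ 2 := by
    have h1 : ∀ i, |if fold ω i = s then weight 1 0 ω i *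
        (D.condMean n (fun u => etaHatCF ω s u.2 - etaBar n u.2) (X ω i) - a s - β s * X ω i)
        else 0| ≤ c * |v₂ n| * D.h n ^ 2 * |weight 1 0 ω i| := fun i => by
      have hc2 : 0 ≤ c * |v₂ n| := by
        have := (abs_nonneg _).trans (hcn _ (hT s) (D.h n) ⟨hX _ (by rw [abs_of_pos hh]),
          hh.ne'⟩).2.2.2
        exact this
      split_ifs
      · by_cases hw : weight 1 0 ω i = 0
        · simp [hw]
        · have hx := hg.abs_le_of_ne_zero hw
          rw [abs_mul, mul_comm]
          refine mul_le_mul_of_nonneg_right ((hab s _ hx).trans ?_) (abs_nonneg _)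
          refine mul_le_mul_of_nonneg_left ?_ hc2
          rw [← sq_abs]; exact pow_le_pow_left₀ (abs_nonneg _) hx 2
      · rw [abs_zero]; positivity
    refine (Finset.abs_sum_le_sum_abs _ _).trans ((Finset.sum_le_sum fun i _ => h1 i).trans ?_)
    rw [← Finset.mul_sum]
    have h2 := hg.sum_abs_pow_le hA.le hn 0
    simp only [zero_add, pow_one, pow_zero, div_one] at h2
    have hc2 : 0 ≤ c * |v₂ n| := (abs_nonneg _).trans (hcn _ (hT s) (D.h n)
      ⟨hX _ (by rw [abs_of_pos hh]), hh.ne'⟩).2.2.2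
    exact mul_le_mul_of_nonneg_left h2 (by positivity)
  have hs5 : √((n : ℝ) * D.h n ^ 5) = √((n : ℝ) * D.h n) * D.h n ^ 2 := by
    rw [show (n : ℝ) * D.h n ^ 5 = (n : ℝ) * D.h n * (D.h n ^ 2) ^ 2 by ring,
      Real.sqrt_mul hn.le, Real.sqrt_sq (by positivity)]
  rw [e4]
  have hN := Real.sqrt_nonneg ((n : ℝ) * D.h n)
  have g0 : |a s * F0| ≤ √(ρ n) * |F0| := by
    rw [abs_mul]; exact mul_le_mul_of_nonneg_right (ha s) (abs_nonneg _)
  have g1 : |β s * D.h n * F1| ≤ c * |v₁ n| * D.h n * |F1| := by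
    rw [abs_mul, abs_mul, abs_of_pos hh]
    exact mul_le_mul_of_nonneg_right (mul_le_mul_of_nonneg_right (hβ s) hh.le) (abs_nonneg _)
  have g2 : |a s * F0 + β s * D.h n * F1 + Rm|
      ≤ √(ρ n) * |F0| + c * |v₁ n| * D.h n * |F1| + c * |v₂ n| * D.h n ^ 2 * A ^ 2 :=
    (abs_add_le _ _).trans (add_le_add ((abs_add_le _ _).trans (add_le_add g0 g1)) hRb)
  refine (mul_le_mul_of_nonneg_left g2 hN).trans ?_
  have hcv : 0 ≤ c * |v₁ n| := (abs_nonneg _).trans (hβ s)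
  rw [abs_mul (√(ρ n) * √((n : ℝ) * D.h n)), abs_mul (c * |v₁ n| * D.h n * √((n : ℝ) * D.h n)),
    abs_of_nonneg (mul_nonneg (Real.sqrt_nonneg (ρ n)) hN),
    abs_of_nonneg (mul_nonneg (mul_nonneg hcv hh.le) hN), hs5]
  have := le_abs_self (√((n : ℝ) * D.h n) * D.h n ^ 2 * (c * |v₂ n| * A ^ 2))
  nlinarith [this]

end RDSetup

/-! ### Identification of τ and the smoothing bias -/

theorem ContDiffOn.differentiableAt_deriv_of_mem_nhds {f : ℝ → ℝ} {s : Set ℝ} {x : ℝ}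
    (hf : ContDiffOn ℝ 2 f s) (hs : s ∈ 𝓝 x) :
    DifferentiableAt ℝ f x ∧ DifferentiableAt ℝ (deriv f) x ∧
      iteratedDerivWithin 2 f s x = deriv (deriv f) x := by
  have h : ContDiffAt ℝ 2 f x := hf.contDiffAt hs
  refine ⟨h.differentiableAt (by norm_num), ?_, ?_⟩
  · obtain ⟨u, hu, hfu⟩ := h.contDiffOn (m := 2) le_rfl (by simp)
    obtain ⟨v, hvu, hvo, hxv⟩ := mem_nhds_iff.1 (by simpa using hu)
    have h2 : ContDiffOn ℝ 1 (deriv f) v :=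
      ((hfu.mono hvu).deriv_of_isOpen hvo (by norm_num))
    exact (h2.contDiffAt (hvo.mem_nhds hxv)).differentiableAt (by norm_num)
  · have h1 : s =ᶠ[𝓝 x] Set.univ := by
      filter_upwards [hs] with y hy
      exact propext ⟨fun _ => trivial, fun _ => hy⟩
    rw [iteratedDerivWithin, iteratedFDerivWithin_congr_set h1, ← iteratedDerivWithin,
      iteratedDerivWithin_univ, iteratedDeriv_succ, iteratedDeriv_one]

namespace RDSetup

variable {D : RDSetup}

/-- Linear expansions of `E[M(η) | X = x]` on either side of the cutoff, whose intercepts differ by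
the RD parameter. -/
theorem exists_linear_approx_meanM (hD : D.DesignRegularity) {etaBar : ∀ n, D.Cov n → ℝ}
    {C L q : ℝ} (houtcome : D.OutcomeRegularity etaBar C L q)
    (hadm : ∀ n, etaBar n ∈ D.admissible n) :
    ∃ δ : ℝ, 0 < δ ∧ ∀ n, ∃ a b a' b', D.tau n = a - a' ∧
      (∀ x ∈ Set.Ioc 0 δ, |D.meanM (etaBar n) x - a - b * x| ≤ C * x ^ 2) ∧
      (∀ x ∈ Set.Ico (-δ) 0, |D.meanM (etaBar n) x - a' - b' * x| ≤ C * x ^ 2) := by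
  obtain ⟨-, δ, -, hδ, hsub, -, -⟩ := hD.exists_density_limit
  refine ⟨δ / 2, half_pos hδ, fun n => ?_⟩
  have hmem : ∀ x, |x| ≤ δ / 2 → x ≠ 0 → D.suppX \ {0} ∈ 𝓝 x := fun x hx hx0 => by
    have hx' : x ∈ Set.Ioo (-δ) δ := abs_lt.1 (by linarith)
    filter_upwards [Ioo_mem_nhds hx'.1 hx'.2, isOpen_compl_singleton.mem_nhds hx0] with y hy hy0
    exact ⟨hsub hy, hy0⟩
  have hreg := fun x hx hx0 => (houtcome.contDiffOn n).differentiableAt_deriv_of_mem_nhds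
    (hmem x hx hx0)
  have hb : ∀ x, |x| ≤ δ / 2 → x ≠ 0 → |deriv (deriv (D.meanM (etaBar n))) x| ≤ C :=
    fun x hx hx0 => by
      rw [← (hreg x hx hx0).2.2]
      exact houtcome.second_deriv_le n x (mem_of_mem_nhds (hmem x hx hx0))
  have hpos : ∀ x ∈ Set.Ioc 0 (δ / 2), |x| ≤ δ / 2 ∧ x ≠ 0 := fun x hx =>
    ⟨by rw [abs_of_pos hx.1]; exact hx.2, hx.1.ne'⟩
  have hneg : ∀ x ∈ Set.Ico (-(δ / 2)) 0, |x| ≤ δ / 2 ∧ x ≠ 0 := fun x hx =>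
    ⟨by rw [abs_of_neg hx.2]; linarith [hx.1], hx.2.ne⟩
  obtain ⟨a, b, ha, -, hab⟩ := exists_linear_approx (half_pos hδ) houtcome.C_pos.le
    (fun x hx => (hreg x (hpos x hx).1 (hpos x hx).2).1)
    (fun x hx => (hreg x (hpos x hx).1 (hpos x hx).2).2.1)
    (fun x hx => hb x (hpos x hx).1 (hpos x hx).2)
  obtain ⟨a', b', ha', -, hab'⟩ := exists_linear_approx_left (half_pos hδ) houtcome.C_pos.le
    (fun x hx => (hreg x (hneg x hx).1 (hneg x hx).2).1)
    (fun x hx => (hreg x (hneg x hx).1 (hneg x hx).2).2.1)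
    (fun x hx => hb x (hneg x hx).1 (hneg x hx).2)
  refine ⟨a, b, a', b', ?_, hab, hab'⟩
  obtain ⟨-, δ₁, hδ₁, hi, hc⟩ := hadm n
  -- E[η̄(Z)|X = x] is continuous at the cutoff, so it cancels from the difference of one-sided
  -- limits; the jump of E[M(η̄)|X = x] is τ whatever the adjustment.
  set m : ℝ → ℝ := D.condMean n fun u => etaBar n u.2 with hm
  have hcont : ContinuousAt m 0 :=
    hc.continuousOn.continuousAt (Ioo_mem_nhds (neg_lt_zero.2 hδ₁) hδ₁)
  have hsum : ∀ᶠ x in 𝓝[≠] (0 : ℝ), D.meanM (etaBar n) x + m x = D.condMean n (fun u => u.1) x := by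
    have h1 : ∀ᶠ x in 𝓝[≠] (0 : ℝ), x ∈ Set.Ioo (-δ₁) δ₁ ∩ Set.Ioo (-δ) δ :=
      nhdsWithin_le_nhds (inter_mem (Ioo_mem_nhds (neg_lt_zero.2 hδ₁) hδ₁)
        (Ioo_mem_nhds (neg_lt_zero.2 hδ) hδ))
    filter_upwards [h1, self_mem_nhdsWithin] with x hx hx0
    have := integral_add (houtcome.integrable n x ⟨hsub hx.2, hx0⟩) (hi x hx.1)
    refine this.symm.trans (integral_congr_ae (ae_of_all _ fun u => ?_))
    simp [adj]
  have hR : Tendsto (D.condMean n fun u => u.1) (𝓝[>] 0) (𝓝 (a + m 0)) :=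
    (ha.add (hcont.tendsto.mono_left nhdsWithin_le_nhds)).congr'
      (nhdsWithin_mono _ (fun x hx => ne_of_gt hx) hsum)
  have hL : Tendsto (D.condMean n fun u => u.1) (𝓝[<] 0) (𝓝 (a' + m 0)) :=
    (ha'.add (hcont.tendsto.mono_left nhdsWithin_le_nhds)).congr'
      (nhdsWithin_mono _ (fun x hx => ne_of_lt hx) hsum)
  unfold tau
  rw [hR.limUnder_eq, hL.limUnder_eq]
  ring

/-- Bias of the infeasible local linear estimator. -/
theorem eventually_abs_bias_le (hD : D.DesignRegularity) {etaBar : ∀ n, D.Cov n → ℝ}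
    {C L q : ℝ} (houtcome : D.OutcomeRegularity etaBar C L q)
    (hadm : ∀ n, etaBar n ∈ D.admissible n) {A : ℝ} (hA : 0 < A) :
    ∀ᶠ n in atTop, ∀ ω : D.Sample n, GoodDesign A ω →
      |∑ i, weight 1 0 ω i * D.meanM (etaBar n) (X ω i) - D.tau n| ≤ C * D.h n ^ 2 * A ^ 2 := by
  obtain ⟨δ, hδ, hlin⟩ := exists_linear_approx_meanM hD houtcome hadm
  filter_upwards [hD.h_tendsto.eventually (gt_mem_nhds hδ),
    hD.nh_tendsto.eventually_gt_atTop 0] with n hn hnh ω hg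
  obtain ⟨a, b, a', b', htau, hab, hab'⟩ := hlin n
  -- Applied to the piecewise line, the weights return exactly a − a' = τ, so only the quadratic
  -- remainders are left.
  have e : ∑ i, weight 1 0 ω i * D.meanM (etaBar n) (X ω i) - D.tau n
      = ∑ i, weight 1 0 ω i * (D.meanM (etaBar n) (X ω i)
        - (if 0 ≤ X ω i then a + b * X ω i else a' + b' * X ω i)) := by
    have e1 : ∑ i, weight 1 0 ω i * (if 0 ≤ X ω i then a + b * X ω i else a' + b' * X ω i)
        = a * (∑ i, if 0 ≤ X ω i then weight 1 0 ω i else 0)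
          + b * (∑ i, if 0 ≤ X ω i then weight 1 0 ω i * X ω i else 0)
          + a' * (∑ i, if 0 ≤ X ω i then 0 else weight 1 0 ω i)
          + b' * (∑ i, if 0 ≤ X ω i then 0 else weight 1 0 ω i * X ω i) := by
      simp_rw [Finset.mul_sum, ← Finset.sum_add_distrib]
      refine Finset.sum_congr rfl fun i _ => ?_
      split_ifs <;> ring
    simp_rw [mul_sub]
    rw [Finset.sum_sub_distrib, e1, hg.sum_plus, hg.sum_plus_mul, hg.sum_minus, hg.sum_minus_mul,
      htau]
    ring
  rw [e]
  have h1 : ∀ i, |weight 1 0 ω i * (D.meanM (etaBar n) (X ω i)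
      - (if 0 ≤ X ω i then a + b * X ω i else a' + b' * X ω i))|
      ≤ C * D.h n ^ 2 * |weight 1 0 ω i| := fun i => by
    by_cases hw : weight 1 0 ω i = 0
    · simp [hw]
    have hx := hg.abs_le_of_ne_zero hw
    have hx0 := hg.ne_zero i
    rw [abs_mul, mul_comm]
    refine mul_le_mul_of_nonneg_right ?_ (abs_nonneg _)
    have h2 : C * X ω i ^ 2 ≤ C * D.h n ^ 2 := by
      refine mul_le_mul_of_nonneg_left ?_ houtcome.C_pos.le
      rw [← sq_abs]; exact pow_le_pow_left₀ (abs_nonneg _) hx 2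
    refine le_trans ?_ h2
    have hx' := abs_le.1 (hx.trans hn.le)
    split_ifs with h0
    · rw [← sub_sub]
      exact hab _ ⟨lt_of_le_of_ne h0 hx0.symm, hx'.2⟩
    · rw [← sub_sub]
      exact hab' _ ⟨hx'.1, not_le.1 h0⟩
  refine (Finset.abs_sum_le_sum_abs _ _).trans ((Finset.sum_le_sum fun i _ => h1 i).trans ?_)
  rw [← Finset.mul_sum]
  have h2 := hg.sum_abs_pow_le hA.le hnh 0
  simp only [zero_add, pow_one, pow_zero, div_one] at h2
  exact mul_le_mul_of_nonneg_left h2 (mul_nonneg houtcome.C_pos.le (sq_nonneg _))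

end RDSetup

/-! ### Moment bounds for the nearest-neighbour variance estimates -/

namespace RDSetup

variable {D : RDSetup}

open Classical in
/-- Indicator of unit `j` being one of the nearest neighbours of unit `i`. -/
noncomputable def nbr {n : ℕ} (ω : D.Sample n) (i j : Fin n) : ℝ :=
  if j ∈ neighbors ω i then 1 else 0

/-- Unit `i` and all of its `R` nearest neighbours lie in the estimation window. -/
def Interior {n : ℕ} (ω : D.Sample n) (i : Fin n) : Prop :=
  |X ω i| ≤ D.h n ∧ (∀ j, j ∈ neighbors ω i → |X ω j| ≤ D.h n) ∧ ∑ j, nbr ω i j = D.R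

open Classical in
/-- The local linear weight of an interior unit in a regular sample, zero otherwise. -/
noncomputable def innerWeight (A : ℝ) {n : ℕ} (ω : D.Sample n) (i : Fin n) : ℝ :=
  if GoodDesign A ω ∧ Interior ω i then weight 1 0 ω i else 0

@[simp] theorem nbr_resample {n : ℕ} (ω : D.Sample n) (j : Fin n) (v : ℝ × D.Cov n) :
    nbr (resample ω j v) = nbr ω := by
  funext i k; simp [nbr]

@[simp] theorem innerWeight_resample (A : ℝ) {n : ℕ} (ω : D.Sample n) (j : Fin n)
    (v : ℝ × D.Cov n) : innerWeight A (resample ω j v) = innerWeight A ω := by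
  have h : ∀ i, Interior (resample ω j v) i ↔ Interior ω i := fun i => by
    simp only [Interior, X_resample, nbr_resample, neighbors_resample]
  funext i
  unfold innerWeight
  have h' := and_congr (goodDesign_resample (A := A) ω j v) (h i)
  by_cases hg : GoodDesign A ω ∧ Interior ω i
  · rw [if_pos hg, if_pos (h'.2 hg), weight_resample]
  · rw [if_neg hg, if_neg fun h'' => hg (h'.1 h'')]

theorem measurable_nbr {n : ℕ} (i j : Fin n) : Measurable fun ω : D.Sample n => nbr ω i j := by
  unfold nbr
  exact Measurable.ite (measurableSet_mem_neighbors i j) measurable_const measurable_const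

theorem nbr_nonneg {n : ℕ} (ω : D.Sample n) (i j : Fin n) : 0 ≤ nbr ω i j := by
  unfold nbr; split_ifs <;> norm_num

theorem nbr_sq {n : ℕ} (ω : D.Sample n) (i j : Fin n) : nbr ω i j ^ 2 = nbr ω i j := by
  unfold nbr; split_ifs <;> norm_num

theorem nbr_self {n : ℕ} (ω : D.Sample n) (i : Fin n) : nbr ω i i = 0 := by
  unfold nbr
  rw [if_neg]
  intro h
  exact (mem_sameSide.1 (neighbors_subset ω i h)).1 rfl

theorem sum_nbr_mul {n : ℕ} (ω : D.Sample n) (i : Fin n) (g : Fin n → ℝ) :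
    ∑ j, nbr ω i j * g j = ∑ j ∈ neighbors ω i, g j := by
  classical
  simp [nbr]

theorem measurable_innerWeight (hK : Measurable D.K) (A : ℝ) {n : ℕ} (i : Fin n) :
    Measurable fun ω : D.Sample n => innerWeight A ω i := by
  unfold innerWeight
  refine Measurable.ite ((measurableSet_goodDesign hK A n).inter ?_) (measurable_weight hK i)
    measurable_const
  have hX := fun i : Fin n => measurable_X (D := D) i
  refine (measurableSet_le (hX i).abs measurable_const).inter (MeasurableSet.inter ?_
    (measurableSet_eq_fun (Finset.measurable_fun_sum _ fun j _ => measurable_nbr i j)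
      measurable_const))
  have : {ω : D.Sample n | ∀ j, j ∈ neighbors ω i → |X ω j| ≤ D.h n}
      = ⋂ j, ({ω : D.Sample n | j ∈ neighbors ω i}ᶜ ∪ {ω | |X ω j| ≤ D.h n}) := by
    ext ω; simp [imp_iff_not_or]
  change MeasurableSet {ω : D.Sample n | ∀ j, j ∈ neighbors ω i → |X ω j| ≤ D.h n}
  rw [this]
  exact MeasurableSet.iInter fun j => (measurableSet_mem_neighbors i j).compl.union
    (measurableSet_le (hX j).abs measurable_const)

section

variable {A : ℝ} {n : ℕ} {ω : D.Sample n}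

theorem goodDesign_of_innerWeight {i : Fin n} (h : innerWeight A ω i ≠ 0) :
    GoodDesign A ω ∧ Interior ω i := by
  by_contra hc
  exact h (if_neg hc)

theorem innerWeight_sq_le (ω : D.Sample n) (i : Fin n) :
    innerWeight A ω i ^ 2 ≤ weight 1 0 ω i ^ 2 := by
  unfold innerWeight
  split_ifs
  · exact le_rfl
  · rw [zero_pow two_ne_zero]; positivity

theorem sum_abs_innerWeight_pow_le (hA : 0 ≤ A) (hn : 0 < (n : ℝ) * D.h n) (ω : D.Sample n)
    (k : ℕ) :
    ∑ i, |innerWeight A ω i| ^ (k + 1) ≤ A ^ (k + 2) / ((n : ℝ) * D.h n) ^ k := by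
  by_cases hg : GoodDesign A ω
  · refine le_trans (Finset.sum_le_sum fun i _ => ?_) (hg.sum_abs_pow_le hA hn k)
    exact pow_le_pow_left₀ (abs_nonneg _) (sq_le_sq.1 (innerWeight_sq_le ω i)) _
  · rw [Finset.sum_eq_zero fun i _ => by simp [innerWeight, hg]]
    positivity

theorem sum_innerWeight_sq_le (hA : 0 ≤ A) (hn : 0 < (n : ℝ) * D.h n) (ω : D.Sample n) :
    ∑ i, innerWeight A ω i ^ 2 ≤ A ^ 3 / ((n : ℝ) * D.h n) := by
  simpa using sum_abs_innerWeight_pow_le hA hn ω 1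

theorem sum_innerWeight_pow_four_le (hA : 0 ≤ A) (hn : 0 < (n : ℝ) * D.h n) (ω : D.Sample n) :
    ∑ i, innerWeight A ω i ^ 4 ≤ A ^ 5 / ((n : ℝ) * D.h n) ^ 3 := by
  have := sum_abs_innerWeight_pow_le hA hn ω 3
  refine le_trans (le_of_eq (Finset.sum_congr rfl fun i _ => ?_)) this
  rw [show 3 + 1 = 4 from rfl, Even.pow_abs (by decide)]

theorem RegularAt.moments_of_innerWeight {η : D.Cov n → ℝ} {B C L : ℝ} (hr : RegularAt η B C L)
    {i : Fin n} (h : innerWeight A ω i ≠ 0) : MomentsAt η B (X ω i) :=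
  hr.moments _ (goodDesign_of_innerWeight h).2.1 ((goodDesign_of_innerWeight h).1.ne_zero i)

theorem RegularAt.moments_of_nbr {η : D.Cov n → ℝ} {B C L : ℝ} (hr : RegularAt η B C L)
    {i j : Fin n} (h : innerWeight A ω i ≠ 0) (hj : nbr ω i j ≠ 0) : MomentsAt η B (X ω j) := by
  have hj' : j ∈ neighbors ω i := by
    by_contra hc
    exact hj (if_neg hc)
  exact hr.moments _ ((goodDesign_of_innerWeight h).2.2.1 j hj')
    ((goodDesign_of_innerWeight h).1.ne_zero j)

end

/-- Fluctuation of the squared residuals around the conditional variances. -/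
theorem lintegral_sum_sq_resid_sub_le (hK : Measurable D.K) {A B C L : ℝ} (hA : 0 ≤ A) (hB : 0 ≤ B)
    {n : ℕ} (hn : 0 < (n : ℝ) * D.h n) {η : D.Cov n → ℝ} (hη : Measurable η)
    (hr : RegularAt η B C L) :
    ∫⁻ ω, ENNReal.ofReal ((∑ i, innerWeight A ω i ^ 2 *
        (resid η ω i ^ 2 - D.varM η (X ω i))) ^ 2) ∂(D.P n)
      ≤ ENNReal.ofReal (A ^ 5 / ((n : ℝ) * D.h n) ^ 3 * (2 * B + 2 * (1 + B) ^ 2)) := by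
  have hc := fun i : Fin n => measurable_innerWeight (D := D) hK A i
  have he := fun i : Fin n => measurable_resid hη (D := D) i
  have hv := fun i : Fin n => (measurable_varM hη).comp (measurable_X (D := D) i)
  have hY : ∀ i : Fin n, Measurable fun ω : D.Sample n => innerWeight A ω i ^ 2 *
        (resid η ω i ^ 2 - D.varM η (X ω i)) := fun i =>
    ((hc i).pow_const 2).mul (((he i).pow_const 2).sub (hv i))
  refine (lintegral_sum_sq_le_of_orthogonal _ Finset.univ _ (fun i _ => hY i)
    fun i _ j _ hij => ?_).trans ?_
  · refine integral_eq_zero_of_resample i fun ω => ?_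
    simp only [innerWeight_resample, resid_resample_self, resid_resample_ne η ω hij.symm,
      X_resample]
    rw [integral_mul_const, integral_const_mul]
    by_cases h0 : innerWeight A ω i = 0
    · simp [h0]
    have hm := hr.moments_of_innerWeight h0
    rw [MeasureTheory.integral_sub (hm.integrable_sq hη) (integrable_const _),
      integral_sq_eq_varM hη]
    simp
  · have h1 : ∀ i : Fin n, ∫⁻ ω, ENNReal.ofReal ((innerWeight A ω i ^ 2 *
        (resid η ω i ^ 2 - D.varM η (X ω i))) ^ 2) ∂(D.P n)
        ≤ ∫⁻ ω, ENNReal.ofReal (innerWeight A ω i ^ 4 * (2 * B + 2 * (1 + B) ^ 2)) ∂(D.P n) :=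
      fun i => by
      rw [lintegral_eq_resample i ((hY i).pow_const 2).ennreal_ofReal]
      refine lintegral_mono fun ω => ?_
      simp only [innerWeight_resample, resid_resample_self, X_resample]
      by_cases h0 : innerWeight A ω i = 0
      · simp [h0]
      have hm := hr.moments_of_innerWeight h0
      have hv0 := varM_nonneg η (X ω i)
      have hv1 := hm.varM_le hη hB
      calc _ ≤ ∫⁻ v, ENNReal.ofReal (innerWeight A ω i ^ 4 *
            (2 * (D.adj η v - D.meanM η (X ω i)) ^ 4 + 2 * (1 + B) ^ 2)) ∂(D.cond n (X ω i)) := by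
            refine lintegral_mono fun v => ENNReal.ofReal_le_ofReal ?_
            rw [_root_.mul_pow, show (innerWeight A ω i ^ 2) ^ 2 = innerWeight A ω i ^ 4 by ring]
            refine mul_le_mul_of_nonneg_left ?_ (by positivity)
            nlinarith [sq_nonneg ((D.adj η v - D.meanM η (X ω i)) ^ 2 + D.varM η (X ω i))]
        _ = ENNReal.ofReal (∫ v, innerWeight A ω i ^ 4 *
            (2 * (D.adj η v - D.meanM η (X ω i)) ^ 4 + 2 * (1 + B) ^ 2) ∂(D.cond n (X ω i))) := by
            rw [ofReal_integral_eq_lintegral_ofReal]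
            · exact (((hm.integrable_fourth hη).const_mul 2).add (integrable_const _)).const_mul _
            · exact ae_of_all _ fun v => by positivity
        _ ≤ _ := by
            refine ENNReal.ofReal_le_ofReal ?_
            rw [integral_const_mul]
            refine mul_le_mul_of_nonneg_left ?_ (by positivity)
            rw [integral_add ((hm.integrable_fourth hη).const_mul 2) (integrable_const _),
              integral_const_mul]
            have := hm.integral_fourth_le hη hB
            simp only [integral_const, probReal_univ, smul_eq_mul, one_mul]
            linarith
    refine (Finset.sum_le_sum fun i _ => h1 i).trans ?_
    rw [← lintegral_finsetSum _ fun i _ =>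
      (((hc i).pow_const 4).mul_const _).ennreal_ofReal]
    refine (lintegral_mono fun ω => ?_).trans (le_of_eq (by
      rw [lintegral_const, measure_univ, mul_one]))
    rw [← ENNReal.ofReal_sum_of_nonneg fun i _ =>
      mul_nonneg (by positivity) (by positivity), ← Finset.sum_mul]
    exact ENNReal.ofReal_le_ofReal (mul_le_mul_of_nonneg_right
      (sum_innerWeight_pow_four_le hA hn ω) (by positivity))

/-- Products of the residuals of a unit and of its neighbours. -/
theorem lintegral_sum_resid_mul_sq_le (hK : Measurable D.K) {A B C L : ℝ} (hA : 0 ≤ A) (hB : 0 ≤ B)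
    {n : ℕ} (hn : 0 < (n : ℝ) * D.h n) {η : D.Cov n → ℝ} (hη : Measurable η)
    (hr : RegularAt η B C L) {s : Finset (Fin n × Fin n)} (hs : ∀ p ∈ s, p.swap ∉ s) :
    ∫⁻ ω, ENNReal.ofReal ((∑ p ∈ s, innerWeight A ω p.1 ^ 2 * nbr ω p.1 p.2 *
        (resid η ω p.1 * resid η ω p.2)) ^ 2) ∂(D.P n)
      ≤ ENNReal.ofReal (A ^ 5 / ((n : ℝ) * D.h n) ^ 3 * (D.R * (1 + B) ^ 2)) := by
  have hc := fun i : Fin n => measurable_innerWeight (D := D) hK A i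
  have he := fun i : Fin n => measurable_resid hη (D := D) i
  have hk := fun i j : Fin n => measurable_nbr (D := D) i j
  have hY : ∀ p : Fin n × Fin n, Measurable fun ω : D.Sample n => innerWeight A ω p.1 ^ 2 *
      nbr ω p.1 p.2 * (resid η ω p.1 * resid η ω p.2) := fun p =>
    (((hc p.1).pow_const 2).mul (hk _ _)).mul ((he _).mul (he _))
  have hne : ∀ p ∈ s, p.1 ≠ p.2 := fun p hp h => hs p hp (by
    have : p.swap = p := Prod.ext h.symm h
    rwa [this])
  -- If one unit of p does not occur in p', its residual appears exactly once in the product, and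
  -- redrawing that unit integrates it to zero.
  have hY0 : ∀ p p' : Fin n × Fin n, p.1 ≠ p.2 →
      ((p.1 ≠ p'.1 ∧ p.1 ≠ p'.2) ∨ (p.2 ≠ p'.1 ∧ p.2 ≠ p'.2)) →
      ∫ ω, (innerWeight A ω p.1 ^ 2 * nbr ω p.1 p.2 * (resid η ω p.1 * resid η ω p.2)) *
        (innerWeight A ω p'.1 ^ 2 * nbr ω p'.1 p'.2 * (resid η ω p'.1 * resid η ω p'.2)) ∂(D.P n)
        = 0 := by
    rintro ⟨i, j⟩ ⟨i', j'⟩ hij (⟨h1, h2⟩ | ⟨h1, h2⟩)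
    · refine integral_eq_zero_of_resample i fun ω => ?_
      simp only at hij h1 h2 ⊢
      simp only [innerWeight_resample, nbr_resample, resid_resample_self,
        resid_resample_ne η ω h1.symm, resid_resample_ne η ω h2.symm,
        resid_resample_ne η ω hij.symm]
      rw [integral_mul_const, integral_const_mul, integral_mul_const]
      by_cases h0 : innerWeight A ω i = 0
      · simp [h0]
      · rw [(hr.moments_of_innerWeight h0).integral_sub]; simp
    · refine integral_eq_zero_of_resample j fun ω => ?_
      simp only at hij h1 h2 ⊢
      simp only [innerWeight_resample, nbr_resample, resid_resample_self,
        resid_resample_ne η ω h1.symm, resid_resample_ne η ω h2.symm,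
        resid_resample_ne η ω hij]
      rw [integral_mul_const, integral_const_mul, integral_const_mul]
      by_cases h0 : innerWeight A ω i = 0
      · simp [h0]
      by_cases h3 : nbr ω i j = 0
      · simp [h3]
      · rw [(hr.moments_of_nbr h0 h3).integral_sub]; simp
  refine (lintegral_sum_sq_le_of_orthogonal _ s _ (fun p _ => hY p) fun p hp p' hp' hpp' => ?_).trans
    ?_
  · by_cases h : (p.1 ≠ p'.1 ∧ p.1 ≠ p'.2) ∨ (p.2 ≠ p'.1 ∧ p.2 ≠ p'.2)
    · exact hY0 p p' (hne p hp) h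
    · exfalso
      have h1 := hne p hp
      have h2 := hne p' hp'
      -- Otherwise both entries of p occur in p', so the pairs coincide up to order, which
      -- distinctness and the absence of reversed pairs in `s` exclude.
      have h3 : p' = p ∨ p' = p.swap := by
        obtain ⟨i, j⟩ := p
        obtain ⟨i', j'⟩ := p'
        simp only [Prod.swap_prod_mk, Prod.mk.injEq, ne_eq] at *
        grind
      rcases h3 with h3 | h3
      · exact hpp' h3.symm
      · exact hs p hp (h3 ▸ hp')
  · have hI : ∀ i : Fin n, ∀ (ω : D.Sample n) (b : ℝ), 0 ≤ b → (b ≠ 0 → MomentsAt η B (X ω i)) →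
        ∫⁻ v, ENNReal.ofReal (b * (D.adj η v - D.meanM η (X ω i)) ^ 2) ∂(D.cond n (X ω i))
          ≤ ENNReal.ofReal (b * (1 + B)) := fun i ω b hb hm => by
      by_cases h0 : b = 0
      · simp [h0]
      simp_rw [ENNReal.ofReal_mul hb]
      rw [lintegral_const_mul]
      · exact mul_le_mul_right ((hm h0).lintegral_sq_le hη hB) _
      · exact (((measurable_adj hη).sub_const _).pow_const 2).ennreal_ofReal
    have h1 : ∀ p ∈ s, ∫⁻ ω, ENNReal.ofReal ((innerWeight A ω p.1 ^ 2 * nbr ω p.1 p.2 *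
        (resid η ω p.1 * resid η ω p.2)) ^ 2) ∂(D.P n)
        ≤ ∫⁻ ω, ENNReal.ofReal (innerWeight A ω p.1 ^ 4 * nbr ω p.1 p.2 * (1 + B) ^ 2) ∂(D.P n) := by
      rintro ⟨i, j⟩ hp
      have hij : i ≠ j := hne _ hp
      simp only
      -- Unit i is redrawn first and unit j second; each integration contributes a factor 1 + B.
      rw [lintegral_eq_resample i ((hY (i, j)).pow_const 2).ennreal_ofReal]
      have hm2 : Measurable fun ω : D.Sample n => ENNReal.ofReal
          (innerWeight A ω i ^ 4 * nbr ω i j * (1 + B) * resid η ω j ^ 2) :=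
        ((((((hc i).pow_const 4).mul (hk i j)).mul_const _).mul ((he j).pow_const 2))).ennreal_ofReal
      have hst : ∀ ω, ∫⁻ v, ENNReal.ofReal ((innerWeight A (resample ω i v) i ^ 2 *
          nbr (resample ω i v) i j * (resid η (resample ω i v) i * resid η (resample ω i v) j)) ^ 2)
            ∂(D.cond n (X ω i))
          ≤ ENNReal.ofReal (innerWeight A ω i ^ 4 * nbr ω i j * (1 + B) * resid η ω j ^ 2) := by
        intro ω
        have hb : 0 ≤ innerWeight A ω i ^ 4 * nbr ω i j * resid η ω j ^ 2 :=
          mul_nonneg (mul_nonneg (by positivity) (nbr_nonneg _ _ _)) (sq_nonneg _)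
        have := hI i ω _ hb fun h => hr.moments_of_innerWeight (A := A) fun h0 => h (by simp [h0])
        refine le_trans (le_of_eq (lintegral_congr fun v => ?_)) (this.trans (le_of_eq ?_))
        · simp only [innerWeight_resample, nbr_resample, resid_resample_self,
            resid_resample_ne η ω hij.symm]
          congr 1
          have := nbr_sq ω i j
          linear_combination (innerWeight A ω i ^ 4 * (D.adj η v - D.meanM η (X ω i)) ^ 2 *
            resid η ω j ^ 2) * this
        · congr 1; ring
      refine (lintegral_mono hst).trans ?_
      rw [lintegral_eq_resample j hm2]
      refine lintegral_mono fun ω => ?_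
      have hb : 0 ≤ innerWeight A ω i ^ 4 * nbr ω i j * (1 + B) :=
        mul_nonneg (mul_nonneg (by positivity) (nbr_nonneg _ _ _)) (by positivity)
      have := hI j ω _ hb fun h => hr.moments_of_nbr (A := A) (i := i) (fun h0 => h (by simp [h0]))
        (fun h0 => h (by simp [h0]))
      simp only [innerWeight_resample, nbr_resample, resid_resample_self]
      refine this.trans (le_of_eq ?_)
      congr 1; ring
    refine (Finset.sum_le_sum h1).trans ?_
    have hm : ∀ p : Fin n × Fin n, Measurable fun ω : D.Sample n =>
        ENNReal.ofReal (innerWeight A ω p.1 ^ 4 * nbr ω p.1 p.2 * (1 + B) ^ 2) := fun p =>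
      ((((hc _).pow_const 4).mul (hk _ _)).mul_const _).ennreal_ofReal
    rw [← lintegral_finsetSum _ fun p _ => hm p]
    refine (lintegral_mono fun ω => ?_).trans (le_of_eq (by
      rw [lintegral_const, measure_univ, mul_one]))
    have h0 : ∀ p : Fin n × Fin n, 0 ≤ innerWeight A ω p.1 ^ 4 * nbr ω p.1 p.2 := fun p =>
      mul_nonneg (by positivity) (nbr_nonneg _ _ _)
    rw [← ENNReal.ofReal_sum_of_nonneg fun p _ => mul_nonneg (h0 p) (by positivity),
      ← Finset.sum_mul]
    refine ENNReal.ofReal_le_ofReal ?_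
    rw [← mul_assoc]
    refine mul_le_mul_of_nonneg_right ?_ (by positivity)
    refine (Finset.sum_le_univ_sum_of_nonneg h0).trans ?_
    rw [Fintype.sum_prod_type]
    simp only
    have h2 : ∀ i : Fin n, ∑ j, innerWeight A ω i ^ 4 * nbr ω i j
        = innerWeight A ω i ^ 4 * D.R := fun i => by
      rw [← Finset.mul_sum]
      by_cases h0 : innerWeight A ω i = 0
      · simp [h0]
      · rw [(goodDesign_of_innerWeight h0).2.2.2]
    simp_rw [h2]
    rw [← Finset.sum_mul]
    exact mul_le_mul_of_nonneg_right (sum_innerWeight_pow_four_le hA hn ω) (Nat.cast_nonneg _)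

/-- Squared first-stage errors of a unit and of its neighbours. -/
theorem lintegral_sum_truncErr_sq_le (hK : Measurable D.K) {A ρ : ℝ} (hA : 0 ≤ A) (hρ : 0 ≤ ρ)
    {n : ℕ} (hn : 0 < (n : ℝ) * D.h n) {η : D.Cov n → ℝ} (hη : Measurable η) :
    ∫⁻ ω, ENNReal.ofReal (∑ i, innerWeight A ω i ^ 2 * (truncErr ρ η ω i (Z ω i) ^ 2 +
        ∑ j, nbr ω i j * truncErr ρ η ω j (Z ω j) ^ 2)) ∂(D.P n)
      ≤ ENNReal.ofReal (A ^ 3 / ((n : ℝ) * D.h n) * ((1 + D.R) * ρ)) := by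
  classical
  have hc := fun i : Fin n => measurable_innerWeight (D := D) hK A i
  have hk := fun i j : Fin n => measurable_nbr (D := D) i j
  have hT : ∀ i : Fin n, Measurable fun ω : D.Sample n => truncErr ρ η ω i (Z ω i) := fun i =>
    (measurable_truncErr ρ hη i).comp (measurable_id.prodMk (measurable_Z i))
  have hb : ∀ (ω : D.Sample n) (p : Fin n × Fin n),
      0 ≤ innerWeight A ω p.1 ^ 2 * ((if p.1 = p.2 then 1 else 0) + nbr ω p.1 p.2) := fun ω p => by
    have := nbr_nonneg ω p.1 p.2
    split_ifs <;> positivity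
  -- Unit i is treated as belonging to its own neighbourhood by means of a diagonal indicator,
  -- giving one sum over pairs.
  have e : ∀ (ω : D.Sample n) (g : Fin n → ℝ), ∑ i, innerWeight A ω i ^ 2 * (g i + ∑ j, nbr ω i j * g j)
      = ∑ p : Fin n × Fin n, innerWeight A ω p.1 ^ 2 *
        ((if p.1 = p.2 then 1 else 0) + nbr ω p.1 p.2) * g p.2 := fun ω g => by
    rw [Fintype.sum_prod_type]
    refine Finset.sum_congr rfl fun i _ => ?_
    simp only [mul_assoc, add_mul, ← Finset.mul_sum, Finset.sum_add_distrib]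
    simp
  have hbm : ∀ p : Fin n × Fin n, Measurable fun ω : D.Sample n =>
      innerWeight A ω p.1 ^ 2 * ((if p.1 = p.2 then 1 else 0) + nbr ω p.1 p.2) := fun p =>
    ((hc _).pow_const 2).mul (measurable_const.add (hk _ _))
  have hbT : ∀ p : Fin n × Fin n, Measurable fun ω : D.Sample n =>
      ENNReal.ofReal (innerWeight A ω p.1 ^ 2 * ((if p.1 = p.2 then 1 else 0) + nbr ω p.1 p.2) *
        truncErr ρ η ω p.2 (Z ω p.2) ^ 2) := fun p =>
    ((hbm p).mul ((hT _).pow_const 2)).ennreal_ofReal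
  simp_rw [e _ fun j => truncErr ρ η _ j (Z _ j) ^ 2]
  calc _ = ∑ p : Fin n × Fin n, ∫⁻ ω, ENNReal.ofReal (innerWeight A ω p.1 ^ 2 *
        ((if p.1 = p.2 then 1 else 0) + nbr ω p.1 p.2) * truncErr ρ η ω p.2 (Z ω p.2) ^ 2)
        ∂(D.P n) := by
        rw [← lintegral_finsetSum _ fun p _ => hbT p]
        refine lintegral_congr fun ω => ?_
        rw [ENNReal.ofReal_sum_of_nonneg fun p _ => mul_nonneg (hb ω p) (sq_nonneg _)]
    _ ≤ ∑ p : Fin n × Fin n, ∫⁻ ω, ENNReal.ofReal (innerWeight A ω p.1 ^ 2 *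
        ((if p.1 = p.2 then 1 else 0) + nbr ω p.1 p.2) * ρ) ∂(D.P n) := by
        refine Finset.sum_le_sum fun p _ => ?_
        -- The terms are nonnegative, so no orthogonality is needed: redrawing the unit whose error
        -- is squared suffices, even when the two units lie in different folds.
        rw [lintegral_eq_resample p.2 (hbT p)]
        refine lintegral_mono fun ω => ?_
        simp only [innerWeight_resample, nbr_resample, Z_resample_self,
          truncErr_resample ρ η ω (rfl : fold ω p.2 = fold ω p.2)]
        simp_rw [ENNReal.ofReal_mul (hb ω p)]
        rw [lintegral_const_mul]
        · exact mul_le_mul_right (lintegral_truncErr_sq_le η ω p.2) _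
        · exact (((measurable_truncErr_apply ρ hη ω p.2).comp measurable_snd).pow_const
            2).ennreal_ofReal
    _ = ∫⁻ ω, ENNReal.ofReal (∑ p : Fin n × Fin n, innerWeight A ω p.1 ^ 2 *
        ((if p.1 = p.2 then 1 else 0) + nbr ω p.1 p.2) * ρ) ∂(D.P n) := by
        rw [← lintegral_finsetSum _ fun p _ => ((hbm p).mul_const _).ennreal_ofReal]
        refine lintegral_congr fun ω => ?_
        rw [ENNReal.ofReal_sum_of_nonneg fun p _ => mul_nonneg (hb ω p) hρ]
    _ ≤ _ := by
        refine (lintegral_mono fun ω => ENNReal.ofReal_le_ofReal ?_).trans (le_of_eq (by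
          rw [lintegral_const, measure_univ, mul_one]))
        rw [← e ω fun _ => ρ]
        have h2 : ∀ i, innerWeight A ω i ^ 2 * (ρ + ∑ j, nbr ω i j * ρ)
            = innerWeight A ω i ^ 2 * ((1 + D.R) * ρ) := fun i => by
          by_cases h0 : innerWeight A ω i = 0
          · simp [h0]
          · rw [← Finset.sum_mul, (goodDesign_of_innerWeight h0).2.2.2]; ring
        simp_rw [h2]
        rw [← Finset.sum_mul]
        exact mul_le_mul_of_nonneg_right (sum_innerWeight_sq_le hA hn ω) (by positivity)

end RDSetup

/-! ### Lower bound for the standard error -/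

/-- Young's inequality with weight ε separates e − f from m − d; then f² ≥ 0 is dropped and (m − d)²
≤ 2(m² + d²). In the application e is the unit's residual, f the average residual of its neighbours,
m the difference of conditional means and d that of first-stage errors. Cross terms between
residuals and first-stage errors never arise. -/
theorem sq_add_sub_ge {ε : ℝ} (hε : 0 < ε) (hε1 : ε ≤ 1) (e f m d : ℝ) :
    (1 - ε) * (e ^ 2 - 2 * (e * f)) - 2 / ε * (m ^ 2 + d ^ 2) ≤ (e - f + m - d) ^ 2 := by
  have h1 : (1 - ε) * (e - f) ^ 2 - 1 / ε * (m - d) ^ 2 ≤ (e - f + m - d) ^ 2 := by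
    have : (e - f + m - d) ^ 2 - ((1 - ε) * (e - f) ^ 2 - 1 / ε * (m - d) ^ 2)
        = 1 / ε * (ε * (e - f) + (m - d)) ^ 2 + (m - d) ^ 2 := by
      field_simp; ring
    have h2 : 0 ≤ 1 / ε * (ε * (e - f) + (m - d)) ^ 2 + (m - d) ^ 2 := by positivity
    linarith
  have h2 : 1 / ε * (m - d) ^ 2 ≤ 2 / ε * (m ^ 2 + d ^ 2) := by
    rw [div_mul_eq_mul_div, div_mul_eq_mul_div]
    refine div_le_div_of_nonneg_right ?_ hε.le
    nlinarith [sq_nonneg (m + d)]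
  have h3 : (1 - ε) * (e ^ 2 - 2 * (e * f)) ≤ (1 - ε) * (e - f) ^ 2 :=
    mul_le_mul_of_nonneg_left (by nlinarith [sq_nonneg f]) (by linarith)
  linarith

namespace RDSetup

variable {D : RDSetup}

section

variable {A B C L : ℝ} {n : ℕ} {η : D.Cov n → ℝ} {ω : D.Sample n}

/-- At least nh/A ≥ R + 1 units of the window lie on the side of i, so i has exactly R neighbours.
-/
theorem GoodDesign.interior_of_forall (hA : 0 < A) (hn : 0 < (n : ℝ) * D.h n)
    (hg : GoodDesign A ω) (hR : (D.R : ℝ) + 1 ≤ (n : ℝ) * D.h n / A) {i : Fin n}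
    (hi : |X ω i| ≤ D.h n) (hj : ∀ j, j ∈ neighbors ω i → |X ω j| ≤ D.h n) : Interior ω i := by
  classical
  refine ⟨hi, hj, ?_⟩
  have h1 := hR.trans (hg.card_side_ge hA hn (0 ≤ X ω i))
  set s := Finset.univ.filter fun j => |X ω j| ≤ D.h n ∧ (0 ≤ X ω j ↔ 0 ≤ X ω i)
  have h2 : D.R + 1 ≤ s.card := by exact_mod_cast h1
  have h3 : s.erase i ⊆ sameSide ω i := fun j hj => by
    rw [Finset.mem_erase, Finset.mem_filter] at hj
    exact mem_sameSide.2 ⟨hj.1, hj.2.2.2⟩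
  have h4 : D.R ≤ (sameSide ω i).card := by
    refine le_trans ?_ (Finset.card_le_card h3)
    have := Finset.pred_card_le_card_erase (s := s) (a := i)
    omega
  have h5 := sum_nbr_mul ω i fun _ => 1
  simp only [mul_one] at h5
  rw [h5, Finset.sum_const, card_neighbors ω i h4, nsmul_eq_mul, mul_one]

/-- Only few units in the estimation window have nearest neighbours outside of it. -/
theorem seSq_le_innerWeight (hA : 0 < A) (hB : 0 ≤ B) (hn : 0 < (n : ℝ) * D.h n)
    (hη : Measurable η) (hr : RegularAt η B C L) (hg : GoodDesign A ω)
    (hR : (D.R : ℝ) + 1 ≤ (n : ℝ) * D.h n / A) :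
    seSq η ω ≤ ∑ i, innerWeight A ω i ^ 2 * D.varM η (X ω i)
      + 2 * D.R * ((A / ((n : ℝ) * D.h n)) ^ 2 * (1 + B)) := by
  classical
  -- The exceptional units to the right (`True`) and to the left (`False`) of the cutoff. Each set
  -- has at most R elements, and each element contributes at most κ to the variance.
  set bad : Prop → Finset (Fin n) := fun p => Finset.univ.filter fun i =>
    (0 ≤ X ω i ↔ p) ∧ |X ω i| ≤ D.h n ∧ ∃ j ∈ neighbors ω i, D.h n < |X ω j| with hbad
  have hcard : ∀ p, ((bad p).card : ℝ) ≤ D.R := fun p => by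
    exact_mod_cast card_le_of_far_neighbor ω (D.h n) p (bad p) fun i hi =>
      (Finset.mem_filter.1 hi).2
  have hmem : ∀ {p i}, ((0 ≤ X ω i ↔ p) ∧ |X ω i| ≤ D.h n ∧
      ∃ j ∈ neighbors ω i, D.h n < |X ω j|) → i ∈ bad p := fun h =>
    Finset.mem_filter.2 ⟨Finset.mem_univ _, h⟩
  set κ := (A / ((n : ℝ) * D.h n)) ^ 2 * (1 + B) with hκ
  have hκ0 : 0 ≤ κ := by positivity
  have h1 : ∀ i, weight 1 0 ω i ^ 2 * D.varM η (X ω i)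
      ≤ innerWeight A ω i ^ 2 * D.varM η (X ω i) + (if i ∈ bad True then κ else 0)
        + (if i ∈ bad False then κ else 0) := fun i => by
    have hk : ∀ p : Prop, ∀ _ : Decidable p, 0 ≤ if p then κ else 0 := fun p _ => by
      split_ifs <;> [exact hκ0; exact le_rfl]
    have h0 : 0 ≤ innerWeight A ω i ^ 2 * D.varM η (X ω i) :=
      mul_nonneg (sq_nonneg _) (varM_nonneg _ _)
    by_cases hw : weight 1 0 ω i = 0
    · rw [hw, zero_pow two_ne_zero, zero_mul]
      exact add_nonneg (add_nonneg h0 (hk _ _)) (hk _ _)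
    have hx := hg.abs_le_of_ne_zero hw
    by_cases hi : Interior ω i
    · have : innerWeight A ω i = weight 1 0 ω i := if_pos ⟨hg, hi⟩
      rw [this] at h0 ⊢
      rw [add_assoc]
      exact le_add_of_nonneg_right (add_nonneg (hk _ _) (hk _ _))
    · have hb : weight 1 0 ω i ^ 2 * D.varM η (X ω i) ≤ κ := by
        have := hg.abs_le i
        rw [← sq_abs]
        exact mul_le_mul (pow_le_pow_left₀ (abs_nonneg _) this 2)
          ((hr.moments _ hx (hg.ne_zero i)).varM_le hη hB) (varM_nonneg _ _) (by positivity)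
      have hj : ∃ j ∈ neighbors ω i, D.h n < |X ω j| := by
        by_contra hc
        push Not at hc
        exact hi (hg.interior_of_forall hA hn hR hx hc)
      by_cases hs : 0 ≤ X ω i
      · have : i ∈ bad True := hmem ⟨⟨fun _ => trivial, fun _ => hs⟩, hx, hj⟩
        rw [if_pos this]
        linarith [hk (i ∈ bad False) inferInstance]
      · have : i ∈ bad False := hmem ⟨⟨fun h => hs h, fun h => h.elim⟩, hx, hj⟩
        rw [if_pos this]
        linarith [hk (i ∈ bad True) inferInstance]
  refine (Finset.sum_le_sum fun i _ => h1 i).trans ?_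
  rw [Finset.sum_add_distrib, Finset.sum_add_distrib, add_assoc]
  refine add_le_add le_rfl ?_
  have h2 : ∀ p, ∑ i, (if i ∈ bad p then κ else 0) ≤ D.R * κ := fun p => by
    rw [Finset.sum_ite_mem, Finset.univ_inter, Finset.sum_const, nsmul_eq_mul]
    exact mul_le_mul_of_nonneg_right (hcard p) hκ0
  linarith [h2 True, h2 False]

/-- Lower bound for the nearest-neighbour variance estimate of an interior unit. -/
theorem sigmaHatSq_ge (hr : RegularAt η B C L) (hg : GoodDesign A ω) {i : Fin n}
    (hi : Interior ω i) {ε : ℝ} (hε : 0 < ε) (hε1 : ε ≤ 1) {g : Fin n → ℝ}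
    (hgi : ∀ j, |X ω j| ≤ D.h n → g j = etaHatCF ω (fold ω j) (Z ω j) - η (Z ω j)) :
    (1 - ε) * (resid η ω i ^ 2 - 2 / D.R * ∑ j, nbr ω i j * (resid η ω i * resid η ω j))
      - 2 / ε * ((2 * L * D.h n) ^ 2 + 2 * (g i ^ 2 + ∑ j, nbr ω i j * g j ^ 2))
      ≤ sigmaHatSq ω i := by
  obtain ⟨hx, hxj, hcard⟩ := hi
  have hR : (1 : ℝ) ≤ D.R := by exact_mod_cast D.R_pos
  have hR0 : (D.R : ℝ) ≠ 0 := by positivity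
  have hcard' : ((neighbors ω i).card : ℝ) = D.R := by
    have h5 := sum_nbr_mul ω i fun _ => 1
    simp only [mul_one] at h5
    rw [← hcard, h5]; simp
  have hM : ∀ j, |X ω j| ≤ D.h n → MHat ω j = resid η ω j + D.meanM η (X ω j) - g j := fun j hj => by
    rw [hgi j hj]
    simp only [MHat, resid, M, adj, Z]
    ring
  -- Decomposition into residuals, conditional means and first-stage errors. The means differ by at
  -- most 2Lh, since a unit and its neighbours lie on one side within the window; the first-stage
  -- part is handled by Cauchy–Schwarz over the R neighbours.
  have e1 : MHat ω i - (1 / (D.R : ℝ)) * ∑ j ∈ neighbors ω i, MHat ω j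
      = resid η ω i - (1 / (D.R : ℝ)) * ∑ j ∈ neighbors ω i, resid η ω j
        + (1 / (D.R : ℝ)) * ∑ j ∈ neighbors ω i, (D.meanM η (X ω i) - D.meanM η (X ω j))
        - (g i - (1 / (D.R : ℝ)) * ∑ j ∈ neighbors ω i, g j) := by
    rw [hM i hx, Finset.sum_congr rfl fun j hj => hM j (hxj j hj), Finset.sum_sub_distrib,
      Finset.sum_add_distrib, Finset.sum_sub_distrib, Finset.sum_const, nsmul_eq_mul, hcard']
    field_simp
    ring
  unfold sigmaHatSq
  rw [e1]
  refine le_trans ?_ (sq_add_sub_ge hε hε1 _ _ _ _)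
  have e2 : 2 / (D.R : ℝ) * ∑ j, nbr ω i j * (resid η ω i * resid η ω j)
      = 2 * (resid η ω i * ((1 / (D.R : ℝ)) * ∑ j ∈ neighbors ω i, resid η ω j)) := by
    rw [sum_nbr_mul, ← Finset.mul_sum]
    ring
  rw [e2]
  have hm : ((1 / (D.R : ℝ)) * ∑ j ∈ neighbors ω i, (D.meanM η (X ω i) - D.meanM η (X ω j))) ^ 2
      ≤ (2 * L * D.h n) ^ 2 := by
    rw [sq_le_sq, abs_mul, abs_of_nonneg (by positivity : (0 : ℝ) ≤ 1 / D.R),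
      div_mul_eq_mul_div, one_mul, div_le_iff₀ (by positivity)]
    refine (Finset.abs_sum_le_sum_abs _ _).trans ?_
    refine (Finset.sum_le_card_nsmul _ _ |2 * L * D.h n| fun j hj => ?_).trans ?_
    · have hs := (mem_sameSide.1 (neighbors_subset ω i hj)).2
      have h1 := hr.mean_lip _ _ hx (hxj j hj) (hg.ne_zero i) (hg.ne_zero j) hs.symm
      have h2 : |X ω i - X ω j| ≤ 2 * |D.h n| := by
        have := abs_sub (X ω i) (X ω j)
        linarith [hxj j hj, le_abs_self (D.h n)]
      rw [abs_mul, abs_mul, abs_two]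
      calc _ ≤ |L| * |X ω i - X ω j| :=
            h1.trans (mul_le_mul_of_nonneg_right (le_abs_self L) (abs_nonneg _))
        _ ≤ |L| * (2 * |D.h n|) := mul_le_mul_of_nonneg_left h2 (abs_nonneg _)
        _ = _ := by ring
    · rw [nsmul_eq_mul, hcard', mul_comm]
  have hd : (g i - (1 / (D.R : ℝ)) * ∑ j ∈ neighbors ω i, g j) ^ 2
      ≤ 2 * (g i ^ 2 + ∑ j, nbr ω i j * g j ^ 2) := by
    rw [sum_nbr_mul]
    have h1 : ((1 / (D.R : ℝ)) * ∑ j ∈ neighbors ω i, g j) ^ 2 ≤ ∑ j ∈ neighbors ω i, g j ^ 2 := by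
      have h2 := sq_sum_le_card_mul_sum_sq (s := neighbors ω i) (f := g)
      rw [hcard'] at h2
      have h3 : 0 ≤ ∑ j ∈ neighbors ω i, g j ^ 2 := Finset.sum_nonneg fun j _ => sq_nonneg _
      rw [_root_.mul_pow, div_pow, one_pow, div_mul_eq_mul_div, one_mul,
        div_le_iff₀ (by positivity)]
      nlinarith
    nlinarith [sq_nonneg (g i + (1 / (D.R : ℝ)) * ∑ j ∈ neighbors ω i, g j)]
  have := mul_le_mul_of_nonneg_left (add_le_add hm hd) (by positivity : 0 ≤ 2 / ε)
  linarith

/-- Lower bound for the squared standard error on a regular sample. -/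
theorem sum_weight_sq_mul_sigmaHatSq_ge (hA : 0 < A) (hB : 0 ≤ B) (hn : 0 < (n : ℝ) * D.h n)
    (hη : Measurable η) (hr : RegularAt η B C L) (hg : GoodDesign A ω)
    (hR : (D.R : ℝ) + 1 ≤ (n : ℝ) * D.h n / A) {ε : ℝ} (hε : 0 < ε) (hε1 : ε ≤ 1) {g : Fin n → ℝ}
    (hgi : ∀ j, |X ω j| ≤ D.h n → g j = etaHatCF ω (fold ω j) (Z ω j) - η (Z ω j)) :
    (1 - ε) * (seSq η ω - 2 * D.R * ((A / ((n : ℝ) * D.h n)) ^ 2 * (1 + B))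
        + ∑ i, innerWeight A ω i ^ 2 * (resid η ω i ^ 2 - D.varM η (X ω i))
        - 2 / D.R * ∑ i, ∑ j, innerWeight A ω i ^ 2 * nbr ω i j * (resid η ω i * resid η ω j))
      - 2 / ε * ((2 * L * D.h n) ^ 2 * (A ^ 3 / ((n : ℝ) * D.h n))
        + 2 * ∑ i, innerWeight A ω i ^ 2 * (g i ^ 2 + ∑ j, nbr ω i j * g j ^ 2))
      ≤ ∑ i, weight 1 0 ω i ^ 2 * sigmaHatSq ω i := by
  have h1 : ∀ i, innerWeight A ω i ^ 2 *
      ((1 - ε) * (resid η ω i ^ 2 - 2 / D.R * ∑ j, nbr ω i j * (resid η ω i * resid η ω j))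
      - 2 / ε * ((2 * L * D.h n) ^ 2 + 2 * (g i ^ 2 + ∑ j, nbr ω i j * g j ^ 2)))
      ≤ weight 1 0 ω i ^ 2 * sigmaHatSq ω i := fun i => by
    -- Variance estimates are nonnegative, so discarding non-interior units only lowers the sum.
    have hs : 0 ≤ sigmaHatSq ω i := sq_nonneg _
    refine le_trans ?_ (mul_le_mul_of_nonneg_right (innerWeight_sq_le (A := A) ω i) hs)
    by_cases h0 : innerWeight A ω i = 0
    · simp [h0]
    · exact mul_le_mul_of_nonneg_left
        (sigmaHatSq_ge hr hg (goodDesign_of_innerWeight h0).2 hε hε1 hgi) (sq_nonneg _)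
  refine le_trans ?_ (Finset.sum_le_sum fun i _ => h1 i)
  have h2 := seSq_le_innerWeight hA hB hn hη hr hg hR
  have h3 := sum_innerWeight_sq_le hA.le hn ω
  have e : ∑ i, innerWeight A ω i ^ 2 *
      ((1 - ε) * (resid η ω i ^ 2 - 2 / D.R * ∑ j, nbr ω i j * (resid η ω i * resid η ω j))
      - 2 / ε * ((2 * L * D.h n) ^ 2 + 2 * (g i ^ 2 + ∑ j, nbr ω i j * g j ^ 2)))
      = (1 - ε) * (∑ i, innerWeight A ω i ^ 2 * D.varM η (X ω i)
        + ∑ i, innerWeight A ω i ^ 2 * (resid η ω i ^ 2 - D.varM η (X ω i))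
        - 2 / D.R * ∑ i, ∑ j, innerWeight A ω i ^ 2 * nbr ω i j * (resid η ω i * resid η ω j))
      - 2 / ε * ((2 * L * D.h n) ^ 2 * ∑ i, innerWeight A ω i ^ 2
        + 2 * ∑ i, innerWeight A ω i ^ 2 * (g i ^ 2 + ∑ j, nbr ω i j * g j ^ 2)) := by
    have e2 : ∀ i, ∑ j, innerWeight A ω i ^ 2 * nbr ω i j * (resid η ω i * resid η ω j)
        = innerWeight A ω i ^ 2 * ∑ j, nbr ω i j * (resid η ω i * resid η ω j) := fun i => by
      rw [Finset.mul_sum]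
      exact Finset.sum_congr rfl fun j _ => by ring
    have e3 : ∀ i, innerWeight A ω i ^ 2 *
        ((1 - ε) * (resid η ω i ^ 2 - 2 / D.R * ∑ j, nbr ω i j * (resid η ω i * resid η ω j))
        - 2 / ε * ((2 * L * D.h n) ^ 2 + 2 * (g i ^ 2 + ∑ j, nbr ω i j * g j ^ 2)))
        = (1 - ε) * (innerWeight A ω i ^ 2 * D.varM η (X ω i))
          + (1 - ε) * (innerWeight A ω i ^ 2 * (resid η ω i ^ 2 - D.varM η (X ω i)))
          - ((1 - ε) * (2 / D.R)) *
            (innerWeight A ω i ^ 2 * ∑ j, nbr ω i j * (resid η ω i * resid η ω j))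
          - (2 / ε * (2 * L * D.h n) ^ 2) * innerWeight A ω i ^ 2
          - (2 / ε * 2) * (innerWeight A ω i ^ 2 * (g i ^ 2 + ∑ j, nbr ω i j * g j ^ 2)) :=
      fun i => by ring
    rw [Finset.sum_congr rfl fun i _ => e3 i]
    simp_rw [e2]
    rw [Finset.sum_sub_distrib, Finset.sum_sub_distrib, Finset.sum_sub_distrib,
      Finset.sum_add_distrib]
    simp only [← Finset.mul_sum (s := Finset.univ) (a := 1 - ε),
      ← Finset.mul_sum (s := Finset.univ) (a := (1 - ε) * (2 / (D.R : ℝ))),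
      ← Finset.mul_sum (s := Finset.univ) (a := 2 / ε * (2 * L * D.h n) ^ 2),
      ← Finset.mul_sum (s := Finset.univ) (a := 2 / ε * 2)]
    ring
  rw [e]
  have h4 : (1 - ε) * (seSq η ω - 2 * D.R * ((A / ((n : ℝ) * D.h n)) ^ 2 * (1 + B)))
      ≤ (1 - ε) * ∑ i, innerWeight A ω i ^ 2 * D.varM η (X ω i) :=
    mul_le_mul_of_nonneg_left (by linarith) (by linarith)
  have h5 := mul_le_mul_of_nonneg_left (mul_le_mul_of_nonneg_left h3 (sq_nonneg (2 * L * D.h n)))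
    (by positivity : 0 ≤ 2 / ε)
  linarith

theorem seSq_le (hA : 0 ≤ A) (hB : 0 ≤ B) (hn : 0 < (n : ℝ) * D.h n) (hη : Measurable η)
    (hr : RegularAt η B C L) (hg : GoodDesign A ω) :
    seSq η ω ≤ (1 + B) * (A ^ 3 / ((n : ℝ) * D.h n)) := by
  refine le_trans ?_ (mul_le_mul_of_nonneg_left (hg.sum_sq_le hA hn) (by positivity))
  unfold seSq
  rw [Finset.mul_sum]
  refine Finset.sum_le_sum fun i _ => ?_
  by_cases hw : weight 1 0 ω i = 0
  · simp [hw]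
  · rw [mul_comm]
    exact mul_le_mul_of_nonneg_right
      ((hr.moments _ (hg.abs_le_of_ne_zero hw) (hg.ne_zero i)).varM_le hη hB) (sq_nonneg _)

end

theorem IsLittleOP.of_lintegral_sq_le_div {ξ : ∀ n, D.Sample n → ℝ} (hD : D.DesignRegularity)
    (hξ : ∀ n, Measurable (ξ n)) {a b : ℝ}
    (h : ∀ᶠ n in atTop, ∫⁻ ω, ENNReal.ofReal (ξ n ω ^ 2) ∂(D.P n)
      ≤ ENNReal.ofReal (a / ((n : ℝ) * D.h n) ^ 3 * b)) :
    D.IsLittleOP fun n ω => (n : ℝ) * D.h n * ξ n ω := by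
  refine IsLittleOP.of_lintegral_sq (fun n => (hξ n).const_mul _)
    (β := fun n => a * b * ((n : ℝ) * D.h n)⁻¹) ?_ ?_
  · have := (tendsto_inv_atTop_zero.comp hD.nh_tendsto).const_mul (a * b)
    simpa using this
  · filter_upwards [h, hD.nh_tendsto.eventually_gt_atTop 0] with n hn hnh
    have e : ∀ ω, ENNReal.ofReal (((n : ℝ) * D.h n * ξ n ω) ^ 2)
        = ENNReal.ofReal (((n : ℝ) * D.h n) ^ 2) * ENNReal.ofReal (ξ n ω ^ 2) := fun ω => by
      rw [← ENNReal.ofReal_mul (by positivity)]; congr 1; ring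
    simp_rw [e]
    rw [lintegral_const_mul _ ((hξ n).pow_const 2).ennreal_ofReal]
    refine (mul_le_mul_right hn _).trans (le_of_eq ?_)
    rw [← ENNReal.ofReal_mul (by positivity)]
    congr 1
    field_simp

/-- The standard error does not underestimate the conditional variance asymptotically. -/
theorem whp_seHat_sq_ge (hD : D.DesignRegularity) {T : ∀ n, Set (D.Cov n → ℝ)}
    {etaBar : ∀ n, D.Cov n → ℝ} (hfirst : D.FirstStage T etaBar D.suppXh) {A B C L : ℝ}
    (hA : 0 < A) (hB : 0 ≤ B) (hgood : D.WHP fun _ ω => GoodDesign A ω)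
    (hreg : ∀ᶠ n in atTop, RegularAt (etaBar n) B C L) {ε : ℝ} (hε : 0 < ε) :
    D.WHP fun n ω => (n : ℝ) * D.h n * seSq (etaBar n) ω - ε
      ≤ (n : ℝ) * D.h n * ∑ i, weight 1 0 ω i ^ 2 * sigmaHatSq ω i := by
  have hη : ∀ n, Measurable (etaBar n) := fun n => (hfirst.subset n (hfirst.mem n)).1
  obtain ⟨ρ, hρ0, hρ, hrate⟩ := hfirst.exists_rate
  have hpos := hD.nh_tendsto.eventually_gt_atTop 0
  have hK := hD.K_measurable
  have mc := fun (n : ℕ) (i : Fin n) => measurable_innerWeight (D := D) hK A i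
  have me := fun (n : ℕ) (i : Fin n) => measurable_resid (hη n) (D := D) i
  have mv := fun (n : ℕ) (i : Fin n) => (measurable_varM (hη n)).comp (measurable_X (D := D) i)
  have mk := fun (n : ℕ) (i j : Fin n) => measurable_nbr (D := D) i j
  have mT : ∀ (n : ℕ) (i : Fin n), Measurable fun ω : D.Sample n =>
      truncErr (ρ n) (etaBar n) ω i (Z ω i) := fun n i =>
    (measurable_truncErr (ρ n) (hη n) i).comp (measurable_id.prodMk (measurable_Z i))
  have u1 : D.IsLittleOP fun n ω => (n : ℝ) * D.h n * ∑ i, innerWeight A ω i ^ 2 *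
      (resid (etaBar n) ω i ^ 2 - D.varM (etaBar n) (X ω i)) := by
    refine IsLittleOP.of_lintegral_sq_le_div hD (a := A ^ 5) (b := 2 * B + 2 * (1 + B) ^ 2)
      (fun n => Finset.measurable_fun_sum _ fun i _ => ((mc n i).pow_const 2).mul
        (((me n i).pow_const 2).sub (mv n i))) ?_
    filter_upwards [hpos, hreg] with n hn hr
    exact lintegral_sum_sq_resid_sub_le hK hA.le hB hn (hη n) hr
  have u2 : ∀ s : ∀ n, Finset (Fin n × Fin n), (∀ n, ∀ p ∈ s n, p.swap ∉ s n) →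
      D.IsLittleOP fun n ω => (n : ℝ) * D.h n * ∑ p ∈ s n, innerWeight A ω p.1 ^ 2 *
        nbr ω p.1 p.2 * (resid (etaBar n) ω p.1 * resid (etaBar n) ω p.2) := fun s hs => by
    refine IsLittleOP.of_lintegral_sq_le_div hD (a := A ^ 5) (b := D.R * (1 + B) ^ 2)
      (fun n => Finset.measurable_fun_sum _ fun p _ => (((mc n p.1).pow_const 2).mul
        (mk n _ _)).mul ((me n _).mul (me n _))) ?_
    filter_upwards [hpos, hreg] with n hn hr
    exact lintegral_sum_resid_mul_sq_le hK hA.le hB hn (hη n) hr (hs n)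
  have u2' : D.IsLittleOP fun n ω => (n : ℝ) * D.h n * ∑ i, ∑ j, innerWeight A ω i ^ 2 *
      nbr ω i j * (resid (etaBar n) ω i * resid (etaBar n) ω j) := by
    -- Splitting by i < j and j < i gives two index sets free of reversed pairs; the diagonal
    -- vanishes because no unit is its own neighbour.
    refine ((u2 (fun n => Finset.univ.filter fun p => p.1 < p.2) fun n p hp => ?_).add
      (u2 (fun n => Finset.univ.filter fun p => p.2 < p.1) fun n p hp => ?_)).mono
      (WHP.of_eventually (Eventually.of_forall fun n ω => le_of_eq ?_))
    · simp only [Finset.mem_filter, Finset.mem_univ, true_and, Prod.fst_swap, Prod.snd_swap,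
        not_lt] at hp ⊢
      exact hp.le
    · simp only [Finset.mem_filter, Finset.mem_univ, true_and, Prod.fst_swap, Prod.snd_swap,
        not_lt] at hp ⊢
      exact hp.le
    · rw [← mul_add, ← Fintype.sum_prod_type' (f := fun i j => innerWeight A ω i ^ 2 *
        nbr ω i j * (resid (etaBar n) ω i * resid (etaBar n) ω j)), Finset.sum_filter,
        Finset.sum_filter, ← Finset.sum_add_distrib]
      congr 2
      refine Finset.sum_congr rfl fun p _ => ?_
      rcases lt_trichotomy p.1 p.2 with h | h | h
      · rw [if_pos h, if_neg h.not_gt, add_zero]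
      · rw [if_neg h.not_lt, if_neg h.not_gt, h, nbr_self]; simp
      · rw [if_pos h, if_neg h.not_gt, zero_add]
  have u3 : D.IsLittleOP fun n ω => (n : ℝ) * D.h n * ∑ i, innerWeight A ω i ^ 2 *
      (truncErr (ρ n) (etaBar n) ω i (Z ω i) ^ 2 +
        ∑ j, nbr ω i j * truncErr (ρ n) (etaBar n) ω j (Z ω j) ^ 2) := by
    have hm : ∀ n, Measurable fun ω : D.Sample n => ∑ i, innerWeight A ω i ^ 2 *
      (truncErr (ρ n) (etaBar n) ω i (Z ω i) ^ 2 +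
        ∑ j, nbr ω i j * truncErr (ρ n) (etaBar n) ω j (Z ω j) ^ 2) := fun n =>
      Finset.measurable_fun_sum _ fun i _ => ((mc n i).pow_const 2).mul
        (((mT n i).pow_const 2).add (Finset.measurable_fun_sum _ fun j _ =>
          (mk n i j).mul ((mT n j).pow_const 2)))
    refine IsLittleOP.of_lintegral_abs (fun n => (hm n).const_mul _)
      (β := fun n => A ^ 3 * (1 + D.R) * ρ n) ?_ ?_
    · simpa using hρ.const_mul (A ^ 3 * (1 + (D.R : ℝ)))
    · filter_upwards [hpos] with n hn
      have e : ∀ ω : D.Sample n, ENNReal.ofReal |(n : ℝ) * D.h n * ∑ i, innerWeight A ω i ^ 2 *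
          (truncErr (ρ n) (etaBar n) ω i (Z ω i) ^ 2 +
            ∑ j, nbr ω i j * truncErr (ρ n) (etaBar n) ω j (Z ω j) ^ 2)|
          = ENNReal.ofReal ((n : ℝ) * D.h n) * ENNReal.ofReal (∑ i, innerWeight A ω i ^ 2 *
          (truncErr (ρ n) (etaBar n) ω i (Z ω i) ^ 2 +
            ∑ j, nbr ω i j * truncErr (ρ n) (etaBar n) ω j (Z ω j) ^ 2)) := fun ω => by
        rw [← ENNReal.ofReal_mul hn.le, abs_of_nonneg]
        refine mul_nonneg hn.le (Finset.sum_nonneg fun i _ => mul_nonneg (sq_nonneg _)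
          (add_nonneg (sq_nonneg _) (Finset.sum_nonneg fun j _ =>
            mul_nonneg (nbr_nonneg _ _ _) (sq_nonneg _))))
      simp_rw [e]
      rw [lintegral_const_mul _ (hm n).ennreal_ofReal]
      refine (mul_le_mul_right (lintegral_sum_truncErr_sq_le hK hA.le (hρ0 n) hn (hη n)) _).trans
        (le_of_eq ?_)
      rw [← ENNReal.ofReal_mul hn.le]
      congr 1
      have hn0 := hn.ne'
      field_simp
      exact mul_div_cancel_left₀ _ hn0
  -- Since nh · s² ≤ (1 + B)A³, the loss from the factor 1 − ε₁ is at most ε/8. The five remaining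
  -- errors (boundary units, squared residuals, products, means, first stage) also cost at most ε/8
  -- each.
  set ε₁ := min 1 (ε / (8 * ((1 + B) * A ^ 3 + 1))) with hε₁
  have hBA : 0 < (1 + B) * A ^ 3 + 1 := by positivity
  have hε₁0 : 0 < ε₁ := lt_min one_pos (by positivity)
  have hε₁1 : ε₁ ≤ 1 := min_le_left _ _
  have hε₁2 : ε₁ * ((1 + B) * A ^ 3) ≤ ε / 8 := by
    have h1 : ε₁ ≤ ε / (8 * ((1 + B) * A ^ 3 + 1)) := min_le_right _ _
    rw [le_div_iff₀ (by positivity)] at h1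
    nlinarith
  have hε8 : 0 < ε / 8 := by positivity
  have v1 := u1.whp hε8
  have v2 := (u2'.const_mul (2 / D.R)).whp hε8
  have v3 := (u3.const_mul (4 / ε₁)).whp hε8
  have l1 : ∀ᶠ n : ℕ in atTop, 2 * D.R * (A ^ 2 * (1 + B)) * ((n : ℝ) * D.h n)⁻¹ < ε / 8 := by
    have := (tendsto_inv_atTop_zero.comp hD.nh_tendsto).const_mul (2 * D.R * (A ^ 2 * (1 + B)))
    rw [mul_zero] at this
    exact this.eventually (gt_mem_nhds hε8)
  have l2 : ∀ᶠ n in atTop, 2 / ε₁ * ((2 * L * D.h n) ^ 2 * A ^ 3) < ε / 8 := by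
    have : Tendsto (fun n => 2 / ε₁ * ((2 * L * D.h n) ^ 2 * A ^ 3)) atTop
        (𝓝 (2 / ε₁ * ((2 * L * 0) ^ 2 * A ^ 3))) :=
      (((hD.h_tendsto.const_mul _).pow 2).mul_const _).const_mul _
    rw [mul_zero, zero_pow two_ne_zero, zero_mul, mul_zero] at this
    exact this.eventually (gt_mem_nhds hε8)
  have l3 : ∀ᶠ n : ℕ in atTop, (D.R : ℝ) + 1 ≤ (n : ℝ) * D.h n / A :=
    (hD.nh_tendsto.atTop_div_const hA).eventually_ge_atTop _
  refine ((hgood.and hfirst.whp_mem).and ((v1.and v2).and v3)).mono ?_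
  filter_upwards [hpos, hreg, l1, l2, l3, hrate, hD.eventually_mem_suppX] with n hn hr h1 h2 h3 hrt
    hX ω ⟨⟨hg, hT⟩, ⟨a1, a2⟩, a3⟩
  have hgi : ∀ j, |X ω j| ≤ D.h n → truncErr (ρ n) (etaBar n) ω j (Z ω j)
      = etaHatCF ω (fold ω j) (Z ω j) - etaBar n (Z ω j) := fun j hj => by
    rw [truncErr_eq (hrt _ (hT _) _ ⟨hX _ hj, abs_le.1 hj⟩)]
  have key := mul_le_mul_of_nonneg_left
    (sum_weight_sq_mul_sigmaHatSq_ge hA hB hn (hη n) hr hg h3 hε₁0 hε₁1 hgi) hn.le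
  refine le_trans ?_ key
  have hs := mul_le_mul_of_nonneg_left (seSq_le hA.le hB hn (hη n) hr hg) hn.le
  set N := (n : ℝ) * D.h n with hN
  set U1 := ∑ i, innerWeight A ω i ^ 2 * (resid (etaBar n) ω i ^ 2 - D.varM (etaBar n) (X ω i))
  set U2 := ∑ i, ∑ j, innerWeight A ω i ^ 2 * nbr ω i j *
    (resid (etaBar n) ω i * resid (etaBar n) ω j)
  set U3 := ∑ i, innerWeight A ω i ^ 2 * (truncErr (ρ n) (etaBar n) ω i (Z ω i) ^ 2 +
        ∑ j, nbr ω i j * truncErr (ρ n) (etaBar n) ω j (Z ω j) ^ 2)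
  have e1 : N * ((1 - ε₁) * (seSq (etaBar n) ω - 2 * D.R * ((A / N) ^ 2 * (1 + B)) + U1
      - 2 / D.R * U2) - 2 / ε₁ * ((2 * L * D.h n) ^ 2 * (A ^ 3 / N) + 2 * U3))
      = (1 - ε₁) * (N * seSq (etaBar n) ω - 2 * D.R * (A ^ 2 * (1 + B)) * N⁻¹ + N * U1
        - 2 / D.R * (N * U2)) - (2 / ε₁ * ((2 * L * D.h n) ^ 2 * A ^ 3) + 4 / ε₁ * (N * U3)) := by
    have hN0 : N ≠ 0 := hn.ne'
    have hR0 : (D.R : ℝ) ≠ 0 := Nat.cast_ne_zero.2 D.R_pos.ne'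
    field_simp
    ring
  rw [e1]
  have hs' : N * seSq (etaBar n) ω ≤ (1 + B) * A ^ 3 := by
    refine hs.trans (le_of_eq ?_)
    have hN0 : N ≠ 0 := hn.ne'
    field_simp
  have b1 := abs_lt.1 a1
  have b2 := abs_lt.1 a2
  have b3 := abs_lt.1 a3
  have c1 : ε₁ * (N * seSq (etaBar n) ω) ≤ ε / 8 :=
    (mul_le_mul_of_nonneg_left hs' hε₁0.le).trans hε₁2
  have c2 : -(3 * (ε / 8)) ≤ (1 - ε₁) * (- (2 * D.R * (A ^ 2 * (1 + B)) * N⁻¹) + N * U1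
        - 2 / D.R * (N * U2)) := by
    have h0 : 0 ≤ 1 - ε₁ := by linarith
    have : -(3 * (ε / 8)) ≤ - (2 * D.R * (A ^ 2 * (1 + B)) * N⁻¹) + N * U1
        - 2 / D.R * (N * U2) := by linarith [b1.1, b2.2]
    nlinarith [mul_le_mul_of_nonneg_left this h0]
  linarith [b3.2]

end RDSetup

/-! ### Normal quantiles and coverage -/

namespace RDSetup

/-- The infimum defining the quantile is attained by right-continuity of the distribution function.
-/
theorem le_cdf_stdNormalQuantile {u : ℝ} (hu0 : 0 < u) (hu1 : u < 1) :
    u ≤ cdf (gaussianReal 0 1) (stdNormalQuantile u) := by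
  set S := {z : ℝ | u ≤ cdf (gaussianReal 0 1) z} with hS
  have hne : S.Nonempty :=
    (((tendsto_cdf_atTop (gaussianReal 0 1)).eventually (lt_mem_nhds hu1)).exists).imp
      fun z hz => hz.le
  obtain ⟨m, hm⟩ := ((tendsto_cdf_atBot (gaussianReal 0 1)).eventually (gt_mem_nhds hu0)).exists
  have hbdd : BddBelow S := ⟨m, fun z hz => by
    by_contra hc
    exact absurd (hz.trans (monotone_cdf _ (not_le.1 hc).le)) (not_le.2 hm)⟩
  have hlim : Tendsto (cdf (gaussianReal 0 1)) (𝓝[>] (sInf S))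
      (𝓝 (cdf (gaussianReal 0 1) (sInf S))) :=
    ((cdf (gaussianReal 0 1)).right_continuous (sInf S)).mono_left
      (nhdsWithin_mono _ Set.Ioi_subset_Ici_self)
  refine ge_of_tendsto hlim ?_
  filter_upwards [self_mem_nhdsWithin] with x hx
  obtain ⟨y, hy, hyx⟩ := exists_lt_of_csInf_lt hne hx
  exact hy.trans (monotone_cdf _ hyx.le)

theorem one_sub_le_gaussianReal_Ioo {α : ℝ} (hα : α ∈ Set.Ioo (0 : ℝ) 1) :
    1 - α ≤ (gaussianReal 0 1).real (Set.Ioo (-stdNormalQuantile (1 - α / 2))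
      (stdNormalQuantile (1 - α / 2))) := by
  have h := le_cdf_stdNormalQuantile (u := 1 - α / 2) (by linarith [hα.2]) (by linarith [hα.1])
  set z := stdNormalQuantile (1 - α / 2)
  set γ := gaussianReal 0 1
  rw [cdf_eq_real] at h
  have h1 : γ.real (Set.Ioi z) ≤ α / 2 := by
    rw [← Set.compl_Iic, probReal_compl_eq_one_sub measurableSet_Iic]
    linarith
  have := nullSingletonClass_gaussianReal (μ := 0) (v := 1) one_ne_zero
  have h2 : γ.real (Set.Ici z) ≤ α / 2 := by
    rwa [measureReal_congr (Ioi_ae_eq_Ici (a := z) (μ := γ)).symm]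
  have h3 : γ.real (Set.Iic (-z)) = γ.real (Set.Ici z) := by
    have e : γ.map (fun x => -x) = γ := by
      rw [gaussianReal_map_neg, neg_zero]
    conv_lhs => rw [← e]
    rw [measureReal_def, Measure.map_apply measurable_neg measurableSet_Iic, ← measureReal_def]
    congr 1
    ext x; simp
  have h4 : (Set.Ioo (-z) z)ᶜ ⊆ Set.Iic (-z) ∪ Set.Ici z := fun x hx => by
    by_contra hc
    simp only [Set.mem_union, Set.mem_Iic, Set.mem_Ici, not_or, not_le] at hc
    exact hx ⟨hc.1, hc.2⟩
  have h5 := (measureReal_mono (μ := γ) h4).trans (measureReal_union_le _ _)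
  rw [probReal_compl_eq_one_sub measurableSet_Ioo] at h5
  linarith

/-- Shrunken intervals increase to (−z, z), so continuity from below leaves a margin δ, which later
absorbs bias, first-stage error and the error in the standard error. The bound δ < z holds because
an empty interval cannot have mass above b ≥ 0. -/
theorem exists_lt_gaussianReal_Ioo {b z : ℝ} (hb0 : 0 ≤ b)
    (hb : b < (gaussianReal 0 1).real (Set.Ioo (-z) z)) :
    ∃ δ : ℝ, 0 < δ ∧ δ < z ∧ b < (gaussianReal 0 1).real (Set.Ioo (-(z - δ)) (z - δ)) := by
  set s : ℕ → Set ℝ := fun k => Set.Ioo (-(z - 1 / ((k : ℝ) + 1))) (z - 1 / ((k : ℝ) + 1)) with hs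
  have hmono : Monotone s := fun k l hkl => by
    have : 1 / ((l : ℝ) + 1) ≤ 1 / ((k : ℝ) + 1) :=
      one_div_le_one_div_of_le (by positivity) (by exact_mod_cast Nat.succ_le_succ hkl)
    exact Set.Ioo_subset_Ioo (by linarith) (by linarith)
  have hU : ⋃ k, s k = Set.Ioo (-z) z := by
    ext x
    simp only [Set.mem_iUnion, hs, Set.mem_Ioo, ← abs_lt]
    constructor
    · rintro ⟨k, hk⟩
      have : 0 < 1 / ((k : ℝ) + 1) := by positivity
      linarith
    · intro hx
      obtain ⟨k, hk⟩ := exists_nat_one_div_lt (sub_pos.2 hx)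
      exact ⟨k, by linarith⟩
  have hlim := tendsto_measure_iUnion_atTop (μ := gaussianReal 0 1) hmono
  rw [hU] at hlim
  have hlim' := (ENNReal.tendsto_toReal (measure_ne_top _ _)).comp hlim
  obtain ⟨k, hk⟩ := (hlim'.eventually (lt_mem_nhds hb)).exists
  have hk' : b < (gaussianReal 0 1).real (s k) := hk
  refine ⟨1 / ((k : ℝ) + 1), by positivity, ?_, hk'⟩
  by_contra hc
  have : s k = ∅ := Set.Ioo_eq_empty (by linarith)
  rw [this] at hk'
  simp at hk'
  linarith

variable {D : RDSetup}

/-- On a regular sample, the confidence interval covers the RD parameter if the studentized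
infeasible error is bounded away from the critical value and the remainder terms are small. -/
theorem abs_sub_le_mul_seHat {A C z δ : ℝ} {n : ℕ} {η : D.Cov n → ℝ} {ω : D.Sample n}
    (hn : 0 < (n : ℝ) * D.h n) (hC : 0 < C) (hg : GoodDesign A ω) (hz : 0 < z) (hδ : 0 < δ)
    (hδz : δ < z) (hse : C ≤ (n : ℝ) * D.h n * seSq η ω)
    (hstud : |studentized A η ω| < z - δ)
    (hhat : (n : ℝ) * D.h n * seSq η ω - δ / (2 * z) * C
      ≤ (n : ℝ) * D.h n * ∑ i, weight 1 0 ω i ^ 2 * sigmaHatSq ω i)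
    (hfirst : |√((n : ℝ) * D.h n) * ∑ i, weight 1 0 ω i *
      (etaHatCF ω (fold ω i) (Z ω i) - η (Z ω i))| < δ * √C / 4)
    (hbias : √((n : ℝ) * D.h n) * |∑ i, weight 1 0 ω i * D.meanM η (X ω i) - D.tau n|
      < δ * √C / 4) :
    |tauHat 1 0 ω - D.tau n| ≤ z * seHat 1 0 ω := by
  set N := (n : ℝ) * D.h n
  have hseq : 0 < seSq η ω := pos_of_mul_pos_right (hC.trans_le hse) hn.le
  set s := √(N * seSq η ω) with hs
  have hss : s ^ 2 = N * seSq η ω := Real.sq_sqrt (by positivity)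
  have hCs : √C ≤ s := Real.sqrt_le_sqrt hse
  have hs0 : 0 < s := (Real.sqrt_pos.2 hC).trans_le hCs
  have e1 : tauHat 1 0 ω - D.tau n = √(seSq η ω) * studentized A η ω
      + (∑ i, weight 1 0 ω i * D.meanM η (X ω i) - D.tau n)
      - ∑ i, weight 1 0 ω i * (etaHatCF ω (fold ω i) (Z ω i) - η (Z ω i)) := by
    have h1 : √(seSq η ω) * studentized A η ω = ∑ i, weight 1 0 ω i * resid η ω i := by
      unfold studentized
      rw [Finset.mul_sum]
      refine Finset.sum_congr rfl fun i _ => ?_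
      rw [studWeight, if_pos hg]
      have := (Real.sqrt_pos.2 hseq).ne'
      field_simp
    rw [h1, add_sub, ← Finset.sum_add_distrib, sub_right_comm, ← Finset.sum_sub_distrib]
    congr 1
    refine Finset.sum_congr rfl fun i _ => ?_
    simp only [MHat, resid, M, adj, Z]
    ring
  have hN := Real.sqrt_pos.2 hn
  have hsN : √N * √(seSq η ω) = s := (Real.sqrt_mul hn.le _).symm
  have key1 : √N * |tauHat 1 0 ω - D.tau n| ≤ s * (z - δ) + δ * √C / 2 := by
    have h1 : √N * |√(seSq η ω) * studentized A η ω| ≤ s * (z - δ) := by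
      rw [abs_mul, abs_of_nonneg (Real.sqrt_nonneg _), ← mul_assoc, hsN]
      exact mul_le_mul_of_nonneg_left hstud.le hs0.le
    rw [abs_mul, abs_of_nonneg hN.le] at hfirst
    rw [e1]
    have h2 := mul_le_mul_of_nonneg_left ((abs_sub (√(seSq η ω) * studentized A η ω
      + (∑ i, weight 1 0 ω i * D.meanM η (X ω i) - D.tau n))
      (∑ i, weight 1 0 ω i * (etaHatCF ω (fold ω i) (Z ω i) - η (Z ω i)))).trans
      (add_le_add (abs_add_le _ _) le_rfl)) hN.le
    refine h2.trans ?_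
    rw [mul_add, mul_add]
    linarith
  -- With κ = δ/(2z) ∈ [0, 1], (1 − κ)² s² ≤ (1 − κ) s² ≤ s² − κC, as C ≤ s².
  have key2 : s * (1 - δ / (2 * z)) ≤ √N * seHat 1 0 ω := by
    have hκ : δ / (2 * z) ≤ 1 := by rw [div_le_one (by positivity)]; linarith
    have hκ0 : 0 ≤ δ / (2 * z) := by positivity
    unfold seHat
    rw [← Real.sqrt_mul hn.le]
    refine Real.le_sqrt_of_sq_le (le_trans ?_ hhat)
    rw [_root_.mul_pow, hss]
    have : δ / (2 * z) * C ≤ δ / (2 * z) * (N * seSq η ω) := mul_le_mul_of_nonneg_left hse hκ0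
    have h3 : 0 ≤ δ / (2 * z) * (1 - δ / (2 * z)) * (N * seSq η ω) := by
      have : 0 ≤ 1 - δ / (2 * z) := by linarith
      positivity
    nlinarith
  -- The margin is split in half: z(1 − δ/(2z)) = z − δ/2 pays for the standard error, and the other
  -- δ/2 covers the two remainder terms because √C ≤ s.
  have key3 : s * (z - δ) + δ * √C / 2 ≤ z * (s * (1 - δ / (2 * z))) := by
    have : z * (s * (1 - δ / (2 * z))) = s * (z - δ) + δ * s / 2 := by field_simp; ring
    rw [this]
    nlinarith
  have := key1.trans (key3.trans (mul_le_mul_of_nonneg_left key2 hz.le))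
  rw [mul_left_comm] at this
  exact le_of_mul_le_mul_left this hN

/-- Asymptotic coverage of the undersmoothing confidence interval. -/
theorem eventually_le_coverage {T : ∀ n, Set (D.Cov n → ℝ)} {etaBar : ∀ n, D.Cov n → ℝ}
    {Xtilde : ℕ → Set ℝ} {C L q B α : ℝ} (hα : α ∈ Set.Ioo (0 : ℝ) 1)
    (hfirst : D.FirstStage T etaBar D.suppXh) (hderiv : D.DerivativeRates T etaBar)
    (hD : D.DesignRegularity) (houtcome : D.OutcomeRegularity etaBar C L q)
    (hXtilde_sub : ∀ n, D.suppXh n ⊆ Xtilde n)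
    (hmoment : D.FourthMoments T (fun n => Xtilde n ∩ D.suppX) B)
    (hmean : ∀ n, D.SidewiseLipschitz L (D.meanM (etaBar n)))
    (hunder : Tendsto (fun n : ℕ => (n : ℝ) * D.h n ^ 5) atTop (𝓝 0)) {b : ℝ} (hb0 : 0 < b)
    (hb : b < 1 - α) :
    ∀ᶠ n in atTop, b ≤ (D.P n).real {ω | D.tau n ∈ CIus α ω} := by
  have hη : ∀ n, Measurable (etaBar n) := fun n => (hfirst.subset n (hfirst.mem n)).1
  have hC := houtcome.C_pos
  have hB : 0 ≤ max B 0 := le_max_right _ _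
  obtain ⟨A, hA, hgood⟩ := exists_goodDesign hD
  have hreg := eventually_regularAt hD hfirst.mem houtcome hXtilde_sub hmoment hmean
  set z := stdNormalQuantile (1 - α / 2) with hz
  -- The gap b' − b is the probability given up to the exceptional events.
  obtain ⟨b', hbb', hb'⟩ := exists_between hb
  obtain ⟨δ, hδ, hδz, hδb⟩ := exists_lt_gaussianReal_Ioo (hb0.trans hbb').le
    (hb'.trans_le (one_sub_le_gaussianReal_Ioo hα))
  rw [← hz] at hδz hδb
  have hz0 : 0 < z := hδ.trans hδz
  have hCA : 0 < 1 / (C * A) := by positivity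
  have hst := eventually_studentized_lt hD hη hA hB hC hgood hreg (hb0.trans hbb').le hδb
  have hse := whp_seHat_sq_ge hD hfirst hA hB hgood hreg
    (ε := δ / (2 * z) * (1 / (C * A))) (by positivity)
  have hfe := (isLittleOP_first_stage_error hD hfirst hderiv hA hgood hunder).whp
    (ε := δ * √(1 / (C * A)) / 4) (by positivity)
  have hbl : ∀ᶠ n : ℕ in atTop, √((n : ℝ) * D.h n) * (C * D.h n ^ 2 * A ^ 2)
      < δ * √(1 / (C * A)) / 4 := by
    have h1 : Tendsto (fun n : ℕ => √((n : ℝ) * D.h n ^ 5) * (C * A ^ 2)) atTop (𝓝 0) := by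
      have := ((Real.continuous_sqrt.tendsto 0).comp hunder).mul_const (C * A ^ 2)
      simpa using this
    filter_upwards [h1.eventually (gt_mem_nhds (by positivity :
      0 < δ * √(1 / (C * A)) / 4))] with n hn
    refine lt_of_eq_of_lt ?_ hn
    have hh := hD.h_pos n
    rw [show (n : ℝ) * D.h n ^ 5 = (n : ℝ) * D.h n * (D.h n ^ 2) ^ 2 by ring,
      Real.sqrt_mul (x := (n : ℝ) * D.h n) (by positivity), Real.sqrt_sq (by positivity)]
    ring
  have hcov := ((hgood.and hse).and hfe).eventually_measureReal_ge
    (q := fun n ω => |studentized A (etaBar n) ω| < z - δ)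
    (r := fun n ω => D.tau n ∈ CIus α ω) ?_ (sub_pos.2 hbb')
  · filter_upwards [hst, hcov] with n h1 h2
    linarith
  · filter_upwards [hreg, hbl, hD.nh_tendsto.eventually_gt_atTop 0,
      eventually_abs_bias_le hD houtcome (fun n => hfirst.subset n (hfirst.mem n)) hA]
      with n hr hbn hn hbias ω ⟨⟨hg, h1⟩, h2⟩ h3
    have hse0 : 1 / (C * A) ≤ (n : ℝ) * D.h n * seSq (etaBar n) ω := by
      have := seSq_lower hA hC hn hr hg
      rwa [div_le_iff₀ hn, mul_comm (seSq _ _)] at this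
    have := abs_sub_le_mul_seHat hn hCA hg hz0 hδ hδz hse0 h3 h1 h2
      ((mul_le_mul_of_nonneg_left (hbias ω hg) (Real.sqrt_nonneg _)).trans_lt hbn)
    rw [abs_le] at this
    exact ⟨by linarith [this.2], by linarith [this.1]⟩

end RDSetup

theorem mainTheorem7 (D : RDSetup)
    (T : ∀ n, Set (D.Cov n → ℝ)) (etaBar : ∀ n, D.Cov n → ℝ) (Xtilde : ℕ → Set ℝ)
    (C L q B α : ℝ) (hα : α ∈ Set.Ioo (0 : ℝ) 1)
    (hfirst : D.FirstStage T etaBar D.suppXh)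
    (hderiv : D.DerivativeRates T etaBar)
    (hdesign : D.DesignRegularity)
    (houtcome : D.OutcomeRegularity etaBar C L q)
    (hremainder : D.NeighborRemainder etaBar 1)
    (hXtilde_open : ∀ n, IsOpen (Xtilde n))
    (hXtilde_sub : ∀ n, D.suppXh n ⊆ Xtilde n)
    (hfirst' : D.FirstStage T etaBar fun n => Xtilde n ∩ D.suppX)
    (hmoment : D.FourthMoments T (fun n => Xtilde n ∩ D.suppX) B)
    (hmean : ∀ n, D.SidewiseLipschitz L (D.meanM (etaBar n)))
    (hvar : ∀ n, D.SidewiseLipschitz L (D.varM (etaBar n)))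
    (hunder : Tendsto (fun n : ℕ => (n : ℝ) * D.h n ^ 5) atTop (𝓝 0)) :
    ∃ ε : ℕ → ℝ, Tendsto ε atTop (𝓝 0) ∧
      ∀ n, 1 - α + ε n ≤ (D.P n).real {ω | D.tau n ∈ RDSetup.CIus α ω} := by
  -- The witness is the negative part of the coverage error, so the inequality holds for every n and
  -- only a lower bound on the liminf of the coverage remains.
  refine ⟨fun n => min 0 ((D.P n).real {ω | D.tau n ∈ RDSetup.CIus α ω} - (1 - α)), ?_,
    fun n => ?_⟩
  swap
  · have := min_le_right (0 : ℝ) ((D.P n).real {ω | D.tau n ∈ RDSetup.CIus α ω} - (1 - α))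
    simp only
    linarith
  refine tendsto_order.2 ⟨fun a ha => ?_, fun a ha =>
    Eventually.of_forall fun n => (min_le_left _ _).trans_lt ha⟩
  have hα1 : 0 < 1 - α := by linarith [hα.2]
  -- The maximum with 0 keeps b positive, as the coverage lemma requires, even when 1 − α + a is
  -- negative.
  obtain ⟨b, hb, hb1⟩ := exists_between (max_lt hα1 (by linarith : 1 - α + a < 1 - α))
  filter_upwards [RDSetup.eventually_le_coverage hα hfirst hderiv hdesign houtcome hXtilde_sub
    hmoment hmean hunder ((le_max_left _ _).trans_lt hb) hb1] with n hn
  exact lt_min ha (by linarith [(le_max_right 0 (1 - α + a)).trans_lt hb])
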